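/- Let $w$ be a word of length $n$ over a linearly ordered alphabet, and let $\#$ be an end marker that is smaller than all letters. Positions are numbered from $1$. For a nonempty interval $\gamma=[i\mathinner{..}j]\subseteq[1\mathinner{..}n]$ the induced suffix tree $T(\gamma)$ is obtained from the suffix tree of $w$ (the compact trie of the words $w[p\mathinner{..}n]\#$, $1\le p\le n$, in which the leaf $w[p\mathinner{..}n]\#$ is annotated with $p$) by keeping only the leaves annotated with elements of $\gamma$ and all their ancestors, and compacting the result. Its explicit nodes are the root, the leaves and the branching nodes. A tree is stored as the list of its explicit nodes in left-to-right preorder (equivalently, lexicographic order), each with the index of its parent, its length, a position in the interval at which it occurs (which, with the lengths, gives the label of the edge from its parent as a factor of $w\#$), and its annotation if it is a leaf. There is an algorithm ExtractSubtrees on the word RAM with words of $O(\log n)$ bits that does the following, for every such $w$ and $\gamma$ and every finite set $\mathcal K$ of nonempty intervals contained in $\gamma$ (in particular for every subfamily of an $m$-staircase covering $\gamma$, such as a staircase reduced with respect to an $f$-factorization of $w[i\mathinner{..}j]$). Given $\gamma$, $\mathcal K$ and $T(\gamma)$, it builds all the induced suffix trees $T(\lambda)$, $\lambda\in\mathcal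 K$, in $O(|\gamma|+\|\mathcal K\|)$ time, where $\|\mathcal K\|=\sum_{\lambda\in\mathcal K}|\lambda|$. The program and the constants do not depend on the alphabet, $w$, $\gamma$ or $\mathcal K$. -/

import Mathlib

/-! ### Word RAM

A word RAM with finitely many used registers and a random access memory.  Programs are structured
(sequence, branching, loops).  Every elementary instruction and every evaluation of a test takes one
step.  The parameter `W` bounds the words: an instruction that would compute a number `≥ W` cannot
be executed, so a program has a run only if none of its computed values overflows. -/

namespace WordRAM

/-- Arithmetic and bitwise instructions on words. -/
inductive Op
  | add | sub | mul | div | mod | and | or | xor | shl | shr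

/-- `sub` is truncated at `0`; division by `0` gives `0`. -/
def Op.eval : Op → ℕ → ℕ → ℕ
  | .add, x, y => x + y
  | .sub, x, y => x - y
  | .mul, x, y => x * y
  | .div, x, y => x / y
  | .mod, x, y => x % y
  | .and, x, y => x &&& y
  | .or, x, y => x ||| y
  | .xor, x, y => x ^^^ y
  | .shl, x, y => x <<< y
  | .shr, x, y => x >>> y

/-- Comparisons of two words. -/
inductive Cmp
  | lt | le | eq | ne

def Cmp.Holds : Cmp → ℕ → ℕ → Prop
  | .lt, x, y => x < y
  | .le, x, y => x ≤ y
  | .eq, x, y => x = y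
  | .ne, x, y => x ≠ y

/-- Programs; the natural numbers `r`, `a`, `b` are names of registers. -/
inductive Program
  /-- do nothing -/
  | skip
  /-- register `r` receives the constant `k` -/
  | const (r k : ℕ)
  /-- register `r` receives the result of the operation on the registers `a` and `b` -/
  | op (o : Op) (r a b : ℕ)
  /-- register `r` receives the memory cell whose address is in register `a` -/
  | load (r a : ℕ)
  /-- the memory cell whose address is in register `a` receives register `b` -/
  | store (a b : ℕ)
  | seq (p q : Program)
  | ite (c : Cmp) (a b : ℕ) (p q : Program)
  | while (c : Cmp) (a b : ℕ) (p : Program)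

structure State where
  reg : ℕ → ℕ
  mem : ℕ → ℕ

def State.setReg (s : State) (r x : ℕ) : State := { s with reg := Function.update s.reg r x }

def State.setMem (s : State) (a x : ℕ) : State := { s with mem := Function.update s.mem a x }

/-- `Exec W p s t s'`: on words smaller than `W`, the program `p` started in the state `s` halts in
the state `s'` after exactly `t` steps. -/
inductive Exec (W : ℕ) : Program → State → ℕ → State → Prop
  | skip (s : State) : Exec W .skip s 1 s
  | const (s : State) (r k : ℕ) (h : k < W) : Exec W (.const r k) s 1 (s.setReg r k)
  | op (s : State) (o : Op) (r a b : ℕ) (h : o.eval (s.reg a) (s.reg b) < W) :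
      Exec W (.op o r a b) s 1 (s.setReg r (o.eval (s.reg a) (s.reg b)))
  | load (s : State) (r a : ℕ) : Exec W (.load r a) s 1 (s.setReg r (s.mem (s.reg a)))
  | store (s : State) (a b : ℕ) : Exec W (.store a b) s 1 (s.setMem (s.reg a) (s.reg b))
  | seq {p q : Program} {s s₁ s₂ : State} {t₁ t₂ : ℕ} :
      Exec W p s t₁ s₁ → Exec W q s₁ t₂ s₂ → Exec W (.seq p q) s (t₁ + t₂) s₂
  | ite_true {c : Cmp} {a b : ℕ} {p q : Program} {s s₁ : State} {t : ℕ} :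
      c.Holds (s.reg a) (s.reg b) → Exec W p s t s₁ → Exec W (.ite c a b p q) s (t + 1) s₁
  | ite_false {c : Cmp} {a b : ℕ} {p q : Program} {s s₁ : State} {t : ℕ} :
      ¬ c.Holds (s.reg a) (s.reg b) → Exec W q s t s₁ → Exec W (.ite c a b p q) s (t + 1) s₁
  | while_true {c : Cmp} {a b : ℕ} {p : Program} {s s₁ s₂ : State} {t₁ t₂ : ℕ} :
      c.Holds (s.reg a) (s.reg b) → Exec W p s t₁ s₁ → Exec W (.while c a b p) s₁ t₂ s₂ →
      Exec W (.while c a b p) s (t₁ + t₂ + 1) s₂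
  | while_false {c : Cmp} {a b : ℕ} {p : Program} {s : State} :
      ¬ c.Holds (s.reg a) (s.reg b) → Exec W (.while c a b p) s 1 s

end WordRAM

/-! ### Induced suffix trees -/

namespace SuffixTree

/-- The interval `[lo .. hi]` of positions. -/
structure Interval where
  lo : ℕ
  hi : ℕ

/-- The number of elements of `[lo .. hi]`. -/
def Interval.length (I : Interval) : ℕ := I.hi + 1 - I.lo

/-- The position `i` lies in the interval. -/
def Interval.Contains (I : Interval) (i : ℕ) : Prop := I.lo ≤ i ∧ i ≤ I.hi

/-- `I` is a nonempty interval contained in `J`. -/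
def Interval.IsWithin (I J : Interval) : Prop := J.lo ≤ I.lo ∧ I.lo ≤ I.hi ∧ I.hi ≤ J.hi

/-- The total length of the intervals of a family. -/
def totalLength (K : List Interval) : ℕ := (K.map Interval.length).sum

variable {α : Type*}

/-- The word `w[i .. n]#`, for `1 ≤ i ≤ n = |w|`; positions are counted from `1`.  The end marker `#`
is `⊥`, which is not a letter and is smaller than all letters. -/
def suffixWord (w : List α) (i : ℕ) : List (WithBot α) :=
  (w.drop (i - 1)).map (fun a => (a : WithBot α)) ++ [⊥]

/-- The leaf of the suffix tree annotated with `i` is `suffixWord w i`; nodes, explicit or implicit,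
are identified with the words that they represent, so ancestors are prefixes.
`IsNode w γ v`: the node `v` is a leaf with label in `γ` or an ancestor of such a leaf. -/
def IsNode (w : List α) (γ : Interval) (v : List (WithBot α)) : Prop :=
  ∃ i, γ.Contains i ∧ v <+: suffixWord w i

/-- `v` is the leaf annotated with `i`, where `i` lies in `γ`. -/
def IsLeaf (w : List α) (γ : Interval) (v : List (WithBot α)) (i : ℕ) : Prop :=
  γ.Contains i ∧ v = suffixWord w i

/-- `v` has at least two children, in the tree of all selected nodes. -/
def IsBranching (w : List α) (γ : Interval) (v : List (WithBot α)) : Prop :=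
  ∃ a b, a ≠ b ∧ IsNode w γ (v ++ [a]) ∧ IsNode w γ (v ++ [b])

/-- `v` is an explicit node of the induced suffix tree `T(γ)`: the root, a leaf or a branching
node.  All other selected nodes become implicit when the tree is compacted. -/
def IsExplicit (w : List α) (γ : Interval) (v : List (WithBot α)) : Prop :=
  v = [] ∨ (∃ i, IsLeaf w γ v i) ∨ IsBranching w γ v

/-- `u` is the closest explicit proper ancestor of `v` in `T(γ)`; the root is its own parent. -/
def IsParent (w : List α) (γ : Interval) (u v : List (WithBot α)) : Prop :=
  (v = [] ∧ u = []) ∨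
    (IsExplicit w γ u ∧ u <+: v ∧ u ≠ v ∧
      ∀ u', IsExplicit w γ u' → u' <+: v → u' ≠ v → u' <+: u)

/-- The memory contains, from the address `base` on, the induced suffix tree `T(γ)` of `w`:
the number of its explicit nodes, followed by a record of four cells for each explicit node.  The
records are ordered lexicographically (which is the left-to-right preorder of the tree, children
being ordered by the first letters of their edges).  The record of `v` consists of
* the index of the record of the parent of `v`, counted from `0`;
* the length of `v`;
* a position in `γ` at which `v` occurs; together with the lengths of `v` and of its parent it
  gives the label of the edge above `v` as a factor of `w#`;
* the annotation of `v` if `v` is a leaf, and `0` otherwise. -/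
def Represents [LinearOrder α] (mem : ℕ → ℕ) (base : ℕ) (w : List α) (γ : Interval) : Prop :=
  ∃ nodes : List (List (WithBot α)),
    nodes.Pairwise (· < ·) ∧
    (∀ v, v ∈ nodes ↔ IsExplicit w γ v) ∧
    mem base = nodes.length ∧
    ∀ (k : ℕ) (v : List (WithBot α)), nodes[k]? = some v →
      (∃ u, nodes[mem (base + 4 * k + 1)]? = some u ∧ IsParent w γ u v) ∧
      mem (base + 4 * k + 2) = v.length ∧
      (γ.Contains (mem (base + 4 * k + 3)) ∧ v <+: suffixWord w (mem (base + 4 * k + 3))) ∧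
      (∀ i, IsLeaf w γ v i → mem (base + 4 * k + 4) = i) ∧
      ((¬ ∃ i, IsLeaf w γ v i) → mem (base + 4 * k + 4) = 0)

/-- The memory contains the input: the two ends of `γ`, the number of intervals of the family `K`,
the two ends of each of them, and the tree `T(γ)`.  Nothing is assumed about the remaining cells
and about the registers. -/
def IsInput [LinearOrder α] (w : List α) (γ : Interval) (K : List Interval)
    (s : WordRAM.State) : Prop :=
  s.mem 0 = γ.lo ∧ s.mem 1 = γ.hi ∧ s.mem 2 = K.length ∧
  (∀ (k : ℕ) (I : Interval), K[k]? = some I →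
    s.mem (2 * k + 3) = I.lo ∧ s.mem (2 * k + 4) = I.hi) ∧
  Represents s.mem (2 * K.length + 3) w γ

/-- Register `0` holds the address of an array whose `k`-th entry is the address of the tree `T(I)`
of the `k`-th interval `I` of the family `K`. -/
def IsOutput [LinearOrder α] (w : List α) (K : List Interval) (s : WordRAM.State) : Prop :=
  ∀ (k : ℕ) (I : Interval), K[k]? = some I → Represents s.mem (s.mem (s.reg 0 + k)) w I

end SuffixTree

/-! Number the explicit nodes of T(γ) by 0, …, M − 1 in the given order. Since every suffix word
ends with the end marker, no leaf is a prefix of another one. So two distinct leaves diverge, and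
the branching nodes of T(λ) are the longest common prefixes of pairs of its leaves. Hence the
explicit nodes of T(λ) are exactly the lowest common ancestors, taken in T(γ), of pairs from the set
formed by the root and the leaves of λ (`IsListing.explicit_iff`). The words can then be forgotten:
a `PreorderTree` keeps only parents and the fact that the descendants of a node form a range of
indices. Parents in T(λ) are again lowest common ancestors. If p is the predecessor of v among the
nodes of T(λ), then a proper ancestor of v in T(λ) has index at most p, so it is also an ancestor of
p, and the parent of v is lca(p, v) (`IsListing.represents`).

The rest is bucket sorting. Every interval is put into the buckets of its leaves. A scan of the
buckets in preorder meets the leaves of all intervals in preorder simultaneously. The lowest common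
ancestor of two leaves is that of two consecutive leaves between them (`PreorderTree.lca_eq_or`), so
when the leaf v of λ follows the leaf l, it suffices to put λ into second buckets at v and at lca(l,
v) (`Joined.step`). A second scan meets the nodes of each T(λ) in preorder, with repetitions
adjacent, and appends their records (`Emitted.step`). The position stored with a bucket element
supplies an occurrence of the node inside λ.

Lowest common ancestors take constant time by the inlabel method of Schieber and Vishkin
(`PreorderTree.min_climb_eq_lca`), with tables for the highest and the lowest bits. The first
buckets have ‖K‖ elements in total, the second ones 2‖K‖, and M ≤ 2(|γ| + 1) because consecutive
seeds generate all nodes (`PreorderTree.card_le_of_closure`). Thus the time is O(|γ| + ‖K‖).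

The program is written in a small language with arrays of side S, compiled to the RAM; `Prog.Tri` is
total correctness with a time bound, and `Prog.wp` handles loop-free parts. The arrays occupy order
S² cells but are never cleared as a whole: a cell is used only after it has been written, so the
space costs no time. A duplicate-free family has at most n² intervals, so S is polynomial in n and
all addresses fit into O(log n) bits (`size_bound`). -/

namespace WordRAM

/-! ### A language with expressions and two-dimensional arrays -/

/-- Expressions over variables and cells of two-dimensional arrays; `get r a b` is the cell with
the coordinates `a`, `b` of the array `r`, and `size` bounds the coordinates. -/
inductive Expr
  | var (x : ℕ)
  | const (k : ℕ)
  | size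
  | bin (o : Op) (a b : Expr)
  | get (r : ℕ) (a b : Expr)

/-- The values of the variables and of the cells of the arrays. -/
structure Store where
  v : ℕ → ℕ
  a : ℕ → ℕ → ℕ → ℕ

namespace Store

def set (σ : Store) (x k : ℕ) : Store := { σ with v := Function.update σ.v x k }

def put (σ : Store) (r a b k : ℕ) : Store :=
  { σ with a := fun r' a' b' => if r' = r ∧ a' = a ∧ b' = b then k else σ.a r' a' b' }

@[simp] theorem set_v (σ : Store) (x k y : ℕ) :
    (σ.set x k).v y = if y = x then k else σ.v y := by
  simp [set, Function.update_apply]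

@[simp] theorem set_a (σ : Store) (x k : ℕ) : (σ.set x k).a = σ.a := rfl

@[simp] theorem put_v (σ : Store) (r a b k : ℕ) : (σ.put r a b k).v = σ.v := rfl

@[simp] theorem put_a (σ : Store) (r a b k r' a' b' : ℕ) :
    (σ.put r a b k).a r' a' b' = if r' = r ∧ a' = a ∧ b' = b then k else σ.a r' a' b' := rfl

end Store

namespace Expr

instance : Add Expr := ⟨bin .add⟩
instance : Sub Expr := ⟨bin .sub⟩
instance : Mul Expr := ⟨bin .mul⟩
instance : Div Expr := ⟨bin .div⟩
instance : Mod Expr := ⟨bin .mod⟩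

/-- The value of an expression, if `S` is the bound of the coordinates. -/
def eval (S : ℕ) (σ : Store) : Expr → ℕ
  | var x => σ.v x
  | const k => k
  | size => S
  | bin o a b => o.eval (a.eval S σ) (b.eval S σ)
  | get r a b => σ.a r (a.eval S σ) (b.eval S σ)

/-- The evaluation neither overflows nor leaves the ranges of the arrays. -/
def Ok (W S : ℕ) (σ : Store) : Expr → Prop
  | var _ => True
  | const k => k < W
  | size => True
  | bin o a b => a.Ok W S σ ∧ b.Ok W S σ ∧ o.eval (a.eval S σ) (b.eval S σ) < W
  | get r a b => a.Ok W S σ ∧ b.Ok W S σ ∧ r < 31 ∧ a.eval S σ < S ∧ b.eval S σ < S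

section
variable (W S : ℕ) (σ : Store) (a b : Expr) (r x k : ℕ)

@[simp] theorem eval_var : (var x).eval S σ = σ.v x := rfl
@[simp] theorem eval_const : (const k).eval S σ = k := rfl
@[simp] theorem eval_size : size.eval S σ = S := rfl
@[simp] theorem eval_get : (get r a b).eval S σ = σ.a r (a.eval S σ) (b.eval S σ) := rfl
@[simp] theorem eval_add : (a + b).eval S σ = a.eval S σ + b.eval S σ := rfl
@[simp] theorem eval_sub : (a - b).eval S σ = a.eval S σ - b.eval S σ := rfl
@[simp] theorem eval_mul : (a * b).eval S σ = a.eval S σ * b.eval S σ := rfl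
@[simp] theorem eval_div : (a / b).eval S σ = a.eval S σ / b.eval S σ := rfl
@[simp] theorem eval_mod : (a % b).eval S σ = a.eval S σ % b.eval S σ := rfl
@[simp] theorem eval_and : (bin .and a b).eval S σ = a.eval S σ &&& b.eval S σ := rfl
@[simp] theorem eval_or : (bin .or a b).eval S σ = a.eval S σ ||| b.eval S σ := rfl
@[simp] theorem eval_xor : (bin .xor a b).eval S σ = a.eval S σ ^^^ b.eval S σ := rfl

@[simp] theorem ok_var : (var x).Ok W S σ ↔ True := Iff.rfl
@[simp] theorem ok_const : (const k).Ok W S σ ↔ k < W := Iff.rfl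
@[simp] theorem ok_size : size.Ok W S σ ↔ True := Iff.rfl
@[simp] theorem ok_get : (get r a b).Ok W S σ ↔
    a.Ok W S σ ∧ b.Ok W S σ ∧ r < 31 ∧ a.eval S σ < S ∧ b.eval S σ < S := Iff.rfl
@[simp] theorem ok_add : (a + b).Ok W S σ ↔
    a.Ok W S σ ∧ b.Ok W S σ ∧ a.eval S σ + b.eval S σ < W := Iff.rfl
@[simp] theorem ok_sub : (a - b).Ok W S σ ↔
    a.Ok W S σ ∧ b.Ok W S σ ∧ a.eval S σ - b.eval S σ < W := Iff.rfl
@[simp] theorem ok_mul : (a * b).Ok W S σ ↔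
    a.Ok W S σ ∧ b.Ok W S σ ∧ a.eval S σ * b.eval S σ < W := Iff.rfl
@[simp] theorem ok_div : (a / b).Ok W S σ ↔
    a.Ok W S σ ∧ b.Ok W S σ ∧ a.eval S σ / b.eval S σ < W := Iff.rfl
@[simp] theorem ok_mod : (a % b).Ok W S σ ↔
    a.Ok W S σ ∧ b.Ok W S σ ∧ a.eval S σ % b.eval S σ < W := Iff.rfl
@[simp] theorem ok_and : (bin .and a b).Ok W S σ ↔
    a.Ok W S σ ∧ b.Ok W S σ ∧ a.eval S σ &&& b.eval S σ < W := Iff.rfl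
@[simp] theorem ok_or : (bin .or a b).Ok W S σ ↔
    a.Ok W S σ ∧ b.Ok W S σ ∧ a.eval S σ ||| b.eval S σ < W := Iff.rfl
@[simp] theorem ok_xor : (bin .xor a b).Ok W S σ ↔
    a.Ok W S σ ∧ b.Ok W S σ ∧ a.eval S σ ^^^ b.eval S σ < W := Iff.rfl

end

/-- The number of steps of the evaluation. -/
def cost : Expr → ℕ
  | var _ => 1
  | const _ => 1
  | size => 1
  | bin _ a b => a.cost + (b.cost + 1)
  | get _ a b => 1 + (1 + (a.cost + (1 + (1 + (b.cost + (1 + 1))))))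

/-- The register that receives the value.  The variable `x` is in the register `2 * x`, and register
`1` contains the bound of the coordinates. -/
def loc : Expr → ℕ → ℕ
  | var x, _ => 2 * x
  | size, _ => 1
  | _, d => 2 * d + 3

/-- The program that evaluates an expression; it uses the odd registers from `2 * d + 3` on as
temporaries. -/
def compile : Expr → ℕ → Program
  | var _, _ => .skip
  | size, _ => .skip
  | const k, d => .const (2 * d + 3) k
  | bin o a b, d => .seq (a.compile d) (.seq (b.compile (d + 1))
      (.op o (2 * d + 3) (a.loc d) (b.loc (d + 1))))
  | get r a b, d =>
      .seq (.const (2 * d + 3) r) (.seq (.op .mul (2 * d + 3) (2 * d + 3) 1)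
      (.seq (a.compile (d + 1)) (.seq (.op .add (2 * d + 3) (2 * d + 3) (a.loc (d + 1)))
      (.seq (.op .mul (2 * d + 3) (2 * d + 3) 1) (.seq (b.compile (d + 1))
      (.seq (.op .add (2 * d + 3) (2 * d + 3) (b.loc (d + 1))) (.load (2 * d + 3) (2 * d + 3))))))))

/-- The first part says that a value computed at depth d survives an evaluation at depth d + 1; the
second that a result at depth 0 is never in register 5, which serves as scratch space for
assignments and writes. -/
theorem loc_prop (e : Expr) (d : ℕ) :
    (e.loc d % 2 = 0 ∨ e.loc d < 2 * (d + 1) + 3) ∧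
      (e.loc d = 2 * d + 3 ∨ e.loc d % 2 = 0 ∨ e.loc d = 1) := by
  cases e <;> simp [loc]

end Expr

/-- The address of the cell `a`, `b` of the array `r`. -/
def address (S r a b : ℕ) : ℕ := (r * S + a) * S + b

theorem address_lt {W S r a b : ℕ} (hW : 32 * (S * S) ≤ W) (hr : r < 31) (ha : a < S) (hb : b < S) :
    address S r a b < W := by
  unfold address
  nlinarith [Nat.mul_le_mul_right (S * S) (show r + 1 ≤ 32 by omega),
    Nat.mul_le_mul_right S (show a + 1 ≤ S by omega)]

/-- An address is a number in base S with lowest digits b and a; the leading part r needs no bound.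
-/
theorem address_inj {S r a b r' a' b' : ℕ} (ha : a < S) (hb : b < S) (ha' : a' < S) (hb' : b' < S) :
    address S r a b = address S r' a' b' ↔ r = r' ∧ a = a' ∧ b = b' := by
  unfold address
  refine ⟨fun h => ?_, fun ⟨h, h', h''⟩ => by rw [h, h', h'']⟩
  have key : ∀ {x y x' y' : ℕ}, y < S → y' < S → x * S + y = x' * S + y' → x = x' ∧ y = y' := by
    intro x y x' y' hy hy' e
    have h1 : (x * S + y) / S = (x' * S + y') / S := by rw [e]
    have h2 : (x * S + y) % S = (x' * S + y') % S := by rw [e]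
    rw [mul_comm, mul_comm x', Nat.mul_add_div (by omega), Nat.mul_add_div (by omega),
      Nat.div_eq_of_lt hy, Nat.div_eq_of_lt hy'] at h1
    rw [mul_comm, mul_comm x', Nat.mul_add_mod, Nat.mul_add_mod, Nat.mod_eq_of_lt hy,
      Nat.mod_eq_of_lt hy'] at h2
    exact ⟨by omega, h2⟩
  obtain ⟨h1, h2⟩ := key hb hb' h
  obtain ⟨h3, h4⟩ := key ha ha' h1
  exact ⟨h3, h4, h2⟩

/-- The state contains the store, and the bound of the coordinates in register `1`. -/
structure State.Models (S : ℕ) (s : State) (σ : Store) : Prop where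
  size : s.reg 1 = S
  var : ∀ x, s.reg (2 * x) = σ.v x
  cell : ∀ r a b, a < S → b < S → s.mem (address S r a b) = σ.a r a b

/-- `s'` differs from `s` at most in the odd registers from `2 * d + 3` on. -/
structure State.SameBelow (d : ℕ) (s s' : State) : Prop where
  mem : s'.mem = s.mem
  reg : ∀ x, x % 2 = 0 ∨ x < 2 * d + 3 → s'.reg x = s.reg x

theorem State.SameBelow.models {S d : ℕ} {s s' : State} {σ : Store} (h : State.SameBelow d s s')
    (hs : s.Models S σ) : s'.Models S σ where
  size := by rw [h.reg 1 (by omega), hs.size]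
  var x := by rw [h.reg _ (by omega), hs.var]
  cell r a b ha hb := by rw [h.mem, hs.cell r a b ha hb]

theorem State.SameBelow.trans {d d' : ℕ} {s s' s'' : State} (h : State.SameBelow d s s')
    (h' : State.SameBelow d' s' s'') (hd : d ≤ d') : State.SameBelow d s s'' where
  mem := by rw [h'.mem, h.mem]
  reg x hx := by rw [h'.reg x (by omega), h.reg x hx]

theorem State.sameBelow_setReg (d : ℕ) (s : State) (k : ℕ) :
    State.SameBelow d s (s.setReg (2 * d + 3) k) where
  mem := rfl
  reg x hx := by simp only [State.setReg, Function.update_apply]; rw [if_neg (by omega)]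

@[simp] theorem State.setReg_reg (s : State) (r x y : ℕ) :
    (s.setReg r x).reg y = if y = r then x else s.reg y := by
  simp [State.setReg, Function.update_apply]

@[simp] theorem State.setReg_mem (s : State) (r x : ℕ) : (s.setReg r x).mem = s.mem := rfl

theorem address_aux_lt {W S r a : ℕ} (hW : 32 * (S * S) ≤ W) (hr : r < 31) (ha : a < S) :
    r < W ∧ r * S < W ∧ r * S + a < W ∧ (r * S + a) * S < W := by
  have h := address_lt hW hr ha (show 0 < S by omega)
  have h' : (r * S + a) * 1 ≤ (r * S + a) * S := Nat.mul_le_mul_left _ (by omega)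
  have h'' : r * 1 ≤ r * S := Nat.mul_le_mul_left _ (by omega)
  unfold address at h
  omega

theorem Expr.exec_compile {W S : ℕ} (hW : 32 * (S * S) ≤ W) {σ : Store} (e : Expr) :
    ∀ (d : ℕ) (s : State), s.Models S σ → e.Ok W S σ →
      ∃ s', Exec W (e.compile d) s e.cost s' ∧ State.SameBelow d s s' ∧
        s'.reg (e.loc d) = e.eval S σ := by
  induction e with
  | var x => exact fun d s hs _ => ⟨s, .skip s, ⟨rfl, fun _ _ => rfl⟩, hs.var x⟩
  | size => exact fun d s hs _ => ⟨s, .skip s, ⟨rfl, fun _ _ => rfl⟩, hs.size⟩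
  | const k =>
    exact fun d s hs h => ⟨_, .const s _ k h, State.sameBelow_setReg _ _ _, by simp [loc, eval]⟩
  | bin o a b iha ihb =>
    rintro d s hs ⟨ha, hb, ho⟩
    obtain ⟨s₁, e₁, h₁, r₁⟩ := iha d s hs ha
    obtain ⟨s₂, e₂, h₂, r₂⟩ := ihb (d + 1) s₁ (h₁.models hs) hb
    have r₃ : s₂.reg (a.loc d) = a.eval S σ := by rw [h₂.reg _ (a.loc_prop d).1, r₁]
    refine ⟨_, e₁.seq (e₂.seq (.op _ _ _ _ _ ?_)),
      (h₁.trans h₂ (by omega)).trans (State.sameBelow_setReg _ _ _) le_rfl, ?_⟩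
    · rwa [r₂, r₃]
    · rw [State.setReg_reg, if_pos (show loc (bin o a b) d = 2 * d + 3 from rfl), r₂, r₃]
      rfl
  | get r a b iha ihb =>
    rintro d s hs ⟨ha, hb, hr, haS, hbS⟩
    obtain ⟨w₁, w₂, w₃, w₄⟩ := address_aux_lt hW hr haS
    have w₅ := address_lt hW hr haS hbS
    have e₁ := Exec.const (W := W) s (2 * d + 3) r w₁
    have h₁ := State.sameBelow_setReg d s r
    have r₁ : (s.setReg (2 * d + 3) r).reg (2 * d + 3) = r := by simp
    generalize s.setReg (2 * d + 3) r = s₁ at e₁ h₁ r₁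
    have hm := h₁.models hs
    have e₂ := Exec.op (W := W) s₁ .mul (2 * d + 3) (2 * d + 3) 1
      (by rw [r₁, hm.size]; exact w₂)
    rw [r₁, hm.size] at e₂
    simp only [Op.eval] at e₂
    have h₂ := h₁.trans (State.sameBelow_setReg d s₁ (r * S)) le_rfl
    have r₂ : (s₁.setReg (2 * d + 3) (r * S)).reg (2 * d + 3) = r * S := by simp
    generalize s₁.setReg (2 * d + 3) (r * S) = s₂ at e₂ h₂ r₂
    obtain ⟨s₃, e₃, h₃, r₃⟩ := iha (d + 1) s₂ (h₂.models hs) ha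
    have r₃' := h₃.reg (2 * d + 3) (by omega)
    have h₃ := h₂.trans h₃ (by omega)
    have e₄ := Exec.op (W := W) s₃ .add (2 * d + 3) (2 * d + 3) (a.loc (d + 1))
      (by rw [r₃, r₃', r₂]; exact w₃)
    rw [r₃, r₃', r₂] at e₄
    simp only [Op.eval] at e₄
    have h₄ := h₃.trans (State.sameBelow_setReg d s₃ (r * S + a.eval S σ)) le_rfl
    have r₄ : (s₃.setReg (2 * d + 3) (r * S + a.eval S σ)).reg (2 * d + 3) = r * S + a.eval S σ := by
      simp
    generalize s₃.setReg (2 * d + 3) (r * S + a.eval S σ) = s₄ at e₄ h₄ r₄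
    have hm := h₄.models hs
    have e₅ := Exec.op (W := W) s₄ .mul (2 * d + 3) (2 * d + 3) 1
      (by rw [r₄, hm.size]; exact w₄)
    rw [r₄, hm.size] at e₅
    simp only [Op.eval] at e₅
    have h₅ := h₄.trans (State.sameBelow_setReg d s₄ ((r * S + a.eval S σ) * S)) le_rfl
    have r₅ : (s₄.setReg (2 * d + 3) ((r * S + a.eval S σ) * S)).reg (2 * d + 3) =
      (r * S + a.eval S σ) * S := by simp
    generalize s₄.setReg (2 * d + 3) ((r * S + a.eval S σ) * S) = s₅ at e₅ h₅ r₅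
    obtain ⟨s₆, e₆, h₆, r₆⟩ := ihb (d + 1) s₅ (h₅.models hs) hb
    have r₆' := h₆.reg (2 * d + 3) (by omega)
    have h₆ := h₅.trans h₆ (by omega)
    have e₇ := Exec.op (W := W) s₆ .add (2 * d + 3) (2 * d + 3) (b.loc (d + 1))
      (by rw [r₆, r₆', r₅]; exact w₅)
    rw [r₆, r₆', r₅] at e₇
    simp only [Op.eval] at e₇
    have h₇ := h₆.trans (State.sameBelow_setReg d s₆ (address S r (a.eval S σ) (b.eval S σ))) le_rfl
    have r₇ : (s₆.setReg (2 * d + 3) (address S r (a.eval S σ) (b.eval S σ))).reg (2 * d + 3) =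
      address S r (a.eval S σ) (b.eval S σ) := by simp
    change Exec W _ s₆ 1 (s₆.setReg (2 * d + 3) (address S r (a.eval S σ) (b.eval S σ))) at e₇
    generalize s₆.setReg (2 * d + 3) (address S r (a.eval S σ) (b.eval S σ)) = s₇ at e₇ h₇ r₇
    refine ⟨_, e₁.seq (e₂.seq (e₃.seq (e₄.seq (e₅.seq (e₆.seq (e₇.seq (.load s₇ _ _))))))),
      h₇.trans (State.sameBelow_setReg _ _ _) le_rfl, ?_⟩
    rw [r₇, (h₇.models hs).cell _ _ _ haS hbS]
    simp [loc, eval]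

/-! ### Programs over stores -/

inductive Prog
  | skip
  | assign (x : ℕ) (e : Expr)
  | write (r : ℕ) (a b e : Expr)
  | seq (p q : Prog)
  | ite (c : Cmp) (a b : Expr) (p q : Prog)
  | loop (c : Cmp) (a b : Expr) (p : Prog)

namespace Prog

/-- There is no move instruction, so an assignment adds a zero held in register 5. In a write the
value stays in place while the address is built in register 5, and the coordinates are evaluated at
depth 2 so as to disturb neither. A `while` only tests registers, hence the operands of a guard are
evaluated before the loop and again at the end of each round. -/
def compile : Prog → Program
  | skip => .skip
  | assign x e => .seq (e.compile 0) (.seq (.const 5 0) (.op .add (2 * x) (e.loc 0) 5))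
  | write r a b e =>
      .seq (e.compile 0) (.seq (.const 5 r) (.seq (.op .mul 5 5 1) (.seq (a.compile 2)
      (.seq (.op .add 5 5 (a.loc 2)) (.seq (.op .mul 5 5 1) (.seq (b.compile 2)
      (.seq (.op .add 5 5 (b.loc 2)) (.store 5 (e.loc 0)))))))))
  | seq p q => .seq p.compile q.compile
  | ite c a b p q => .seq (a.compile 0) (.seq (b.compile 1)
      (.ite c (a.loc 0) (b.loc 1) p.compile q.compile))
  | loop c a b p => .seq (a.compile 0) (.seq (b.compile 1)
      (.while c (a.loc 0) (b.loc 1) (.seq p.compile (.seq (a.compile 0) (b.compile 1)))))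

/-- A bound for the number of steps of a program, if all loops are executed at most once. -/
def cost : Prog → ℕ
  | skip => 1
  | assign _ e => e.cost + 2
  | write _ a b e => e.cost + a.cost + b.cost + 6
  | seq p q => p.cost + q.cost
  | ite _ a b p q => a.cost + b.cost + p.cost + q.cost + 1
  | loop _ a b p => p.cost + a.cost + b.cost + 2

/-- A program started in the store `σ` stops after at most `T` steps in a store with the property
`Q`. -/
def Tri (W S : ℕ) (p : Prog) (σ : Store) (T : ℕ) (Q : Store → Prop) : Prop :=
  ∀ s : State, s.Models S σ → ∃ t s' σ', Exec W p.compile s t s' ∧ t ≤ T ∧ s'.Models S σ' ∧ Q σ'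

variable {W S : ℕ}

theorem Tri.mono {p : Prog} {σ : Store} {T T' : ℕ} {Q Q' : Store → Prop} (h : Tri W S p σ T Q)
    (hT : T ≤ T') (hQ : ∀ σ', Q σ' → Q' σ') : Tri W S p σ T' Q' := by
  intro s hs
  obtain ⟨t, s', σ', h₁, h₂, h₃, h₄⟩ := h s hs
  exact ⟨t, s', σ', h₁, h₂.trans hT, h₃, hQ _ h₄⟩

theorem Tri.seq {p q : Prog} {σ : Store} {T T' : ℕ} {Q : Store → Prop}
    (h : Tri W S p σ T fun σ' => Tri W S q σ' T' Q) : Tri W S (.seq p q) σ (T + T') Q := by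
  intro s hs
  obtain ⟨t, s', σ', h₁, h₂, h₃, h₄⟩ := h s hs
  obtain ⟨t', s'', σ'', h₁', h₂', h₃', h₄'⟩ := h₄ s' h₃
  exact ⟨_, s'', σ'', h₁.seq h₁', by omega, h₃', h₄'⟩

/-- The weakest precondition of a program without loops. -/
def wp (W S : ℕ) : Prog → (Store → Prop) → Store → Prop
  | skip, Q, σ => Q σ
  | assign x e, Q, σ => e.Ok W S σ ∧ e.eval S σ < W ∧ Q (σ.set x (e.eval S σ))
  | write r a b e, Q, σ => a.Ok W S σ ∧ b.Ok W S σ ∧ e.Ok W S σ ∧ r < 31 ∧ a.eval S σ < S ∧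
      b.eval S σ < S ∧ Q (σ.put r (a.eval S σ) (b.eval S σ) (e.eval S σ))
  | seq p q, Q, σ => wp W S p (wp W S q Q) σ
  | ite c a b p q, Q, σ => a.Ok W S σ ∧ b.Ok W S σ ∧
      (c.Holds (a.eval S σ) (b.eval S σ) → wp W S p Q σ) ∧
      (¬ c.Holds (a.eval S σ) (b.eval S σ) → wp W S q Q σ)
  | loop _ _ _ _, _, _ => False

/-- Both shapes are needed: a continued run for the first test of a guard, and a run that stops
after the two evaluations for the end of a loop body. -/
theorem exec_pair (hW : 32 * (S * S) ≤ W) {σ : Store} {s : State} (hs : s.Models S σ) {a b : Expr}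
    (ha : a.Ok W S σ) (hb : b.Ok W S σ) : ∃ s', (∀ {p : Program} {s'' : State} {t : ℕ},
      Exec W p s' t s'' → Exec W (.seq (a.compile 0) (.seq (b.compile 1) p)) s
        (a.cost + (b.cost + t)) s'') ∧
      Exec W (.seq (a.compile 0) (b.compile 1)) s (a.cost + b.cost) s' ∧
      s'.Models S σ ∧ s'.reg (a.loc 0) = a.eval S σ ∧ s'.reg (b.loc 1) = b.eval S σ := by
  obtain ⟨s₁, e₁, h₁, r₁⟩ := a.exec_compile hW 0 s hs ha
  obtain ⟨s₂, e₂, h₂, r₂⟩ := b.exec_compile hW 1 s₁ (h₁.models hs) hb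
  exact ⟨s₂, fun h => e₁.seq (e₂.seq h), e₁.seq e₂, h₂.models (h₁.models hs),
    by rw [h₂.reg _ (a.loc_prop 0).1, r₁], r₂⟩

/-- The bound on the value is a separate hypothesis because a loaded cell may contain any number,
while the final addition of zero must not overflow. -/
theorem Tri.assign (hW : 32 * (S * S) ≤ W) {σ : Store} {x : ℕ} {e : Expr} {Q : Store → Prop}
    (he : e.Ok W S σ) (hv : e.eval S σ < W) (hQ : Q (σ.set x (e.eval S σ))) :
    Tri W S (.assign x e) σ (e.cost + 2) Q := by
  intro s hs
  obtain ⟨s₁, e₁, h₁, r₁⟩ := e.exec_compile hW 0 s hs he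
  have e₂ := Exec.const (W := W) s₁ 5 0 (by omega)
  have hl := e.loc_prop 0
  have r₂ : (s₁.setReg 5 0).reg (e.loc 0) = e.eval S σ := by
    rw [State.setReg_reg, if_neg (by omega), r₁]
  have h₂ : (s₁.setReg 5 0).Models S σ :=
    (State.sameBelow_setReg 1 s₁ 0).models (h₁.models hs)
  have r₂' : (s₁.setReg 5 0).reg 5 = 0 := by simp
  generalize s₁.setReg 5 0 = s₂ at e₂ r₂ r₂' h₂
  have e₃ := Exec.op (W := W) s₂ .add (2 * x) (e.loc 0) 5 (by rw [r₂, r₂']; exact hv)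
  rw [r₂, r₂'] at e₃
  refine ⟨_, _, _, e₁.seq (e₂.seq e₃), le_rfl, ?_, hQ⟩
  simp only [Op.eval, add_zero]
  refine ⟨?_, fun y => ?_, fun r a b ha hb => ?_⟩
  · rw [State.setReg_reg, if_neg (by omega), h₂.size]
  · simp [h₂.var]
  · rw [State.setReg_mem, h₂.cell _ _ _ ha hb, Store.set_a]

theorem Tri.write (hW : 32 * (S * S) ≤ W) {σ : Store} {r : ℕ} {a b e : Expr} {Q : Store → Prop}
    (ha : a.Ok W S σ) (hb : b.Ok W S σ) (he : e.Ok W S σ) (hr : r < 31) (haS : a.eval S σ < S)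
    (hbS : b.eval S σ < S) (hQ : Q (σ.put r (a.eval S σ) (b.eval S σ) (e.eval S σ))) :
    Tri W S (.write r a b e) σ (e.cost + a.cost + b.cost + 6) Q := by
  intro s hs
  obtain ⟨w₁, w₂, w₃, w₄⟩ := address_aux_lt hW hr haS
  have w₅ := address_lt hW hr haS hbS
  obtain ⟨s₀, e₀, h₀, r₀⟩ := e.exec_compile hW 0 s hs he
  have hl : e.loc 0 % 2 = 0 ∨ e.loc 0 < 2 * 1 + 3 := (e.loc_prop 0).1
  have hs := h₀.models hs
  have e₁ := Exec.const (W := W) s₀ 5 r w₁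
  have h₁ := State.sameBelow_setReg 1 s₀ r
  have r₁ : (s₀.setReg 5 r).reg 5 = r := by simp
  change State.SameBelow 1 s₀ (s₀.setReg 5 r) at h₁
  generalize s₀.setReg 5 r = s₁ at e₁ h₁ r₁
  have hm := h₁.models hs
  have e₂ := Exec.op (W := W) s₁ .mul 5 5 1 (by rw [r₁, hm.size]; exact w₂)
  rw [r₁, hm.size] at e₂
  simp only [Op.eval] at e₂
  have h₂ := h₁.trans (State.sameBelow_setReg 1 s₁ (r * S)) le_rfl
  have r₂ : (s₁.setReg 5 (r * S)).reg 5 = r * S := by simp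
  change State.SameBelow 1 s₀ (s₁.setReg 5 (r * S)) at h₂
  generalize s₁.setReg 5 (r * S) = s₂ at e₂ h₂ r₂
  obtain ⟨s₃, e₃, h₃, r₃⟩ := a.exec_compile hW 2 s₂ (h₂.models hs) ha
  have r₃' := h₃.reg 5 (by omega)
  have h₃ := h₂.trans h₃ (by omega)
  have e₄ := Exec.op (W := W) s₃ .add 5 5 (a.loc 2) (by rw [r₃, r₃', r₂]; exact w₃)
  rw [r₃, r₃', r₂] at e₄
  simp only [Op.eval] at e₄
  have h₄ := h₃.trans (State.sameBelow_setReg 1 s₃ (r * S + a.eval S σ)) le_rfl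
  have r₄ : (s₃.setReg 5 (r * S + a.eval S σ)).reg 5 = r * S + a.eval S σ := by simp
  change State.SameBelow 1 s₀ (s₃.setReg 5 (r * S + a.eval S σ)) at h₄
  generalize s₃.setReg 5 (r * S + a.eval S σ) = s₄ at e₄ h₄ r₄
  have hm := h₄.models hs
  have e₅ := Exec.op (W := W) s₄ .mul 5 5 1 (by rw [r₄, hm.size]; exact w₄)
  rw [r₄, hm.size] at e₅
  simp only [Op.eval] at e₅
  have h₅ := h₄.trans (State.sameBelow_setReg 1 s₄ ((r * S + a.eval S σ) * S)) le_rfl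
  have r₅ : (s₄.setReg 5 ((r * S + a.eval S σ) * S)).reg 5 = (r * S + a.eval S σ) * S := by simp
  change State.SameBelow 1 s₀ (s₄.setReg 5 ((r * S + a.eval S σ) * S)) at h₅
  generalize s₄.setReg 5 ((r * S + a.eval S σ) * S) = s₅ at e₅ h₅ r₅
  obtain ⟨s₆, e₆, h₆, r₆⟩ := b.exec_compile hW 2 s₅ (h₅.models hs) hb
  have r₆' := h₆.reg 5 (by omega)
  have h₆ := h₅.trans h₆ (by omega)
  have e₇ := Exec.op (W := W) s₆ .add 5 5 (b.loc 2) (by rw [r₆, r₆', r₅]; exact w₅)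
  rw [r₆, r₆', r₅] at e₇
  change Exec W _ s₆ 1 (s₆.setReg 5 (address S r (a.eval S σ) (b.eval S σ))) at e₇
  have h₇ := h₆.trans (State.sameBelow_setReg 1 s₆ (address S r (a.eval S σ) (b.eval S σ))) le_rfl
  have r₇ : (s₆.setReg 5 (address S r (a.eval S σ) (b.eval S σ))).reg 5 =
    address S r (a.eval S σ) (b.eval S σ) := by simp
  change State.SameBelow 1 s₀ (s₆.setReg 5 (address S r (a.eval S σ) (b.eval S σ))) at h₇
  generalize s₆.setReg 5 (address S r (a.eval S σ) (b.eval S σ)) = s₇ at e₇ h₇ r₇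
  have e₈ := Exec.store (W := W) s₇ 5 (e.loc 0)
  have hm := h₇.models hs
  rw [r₇, h₇.reg _ hl, r₀] at e₈
  refine ⟨_, _, _, e₀.seq (e₁.seq (e₂.seq (e₃.seq (e₄.seq (e₅.seq (e₆.seq (e₇.seq e₈))))))),
    by omega, ?_, hQ⟩
  refine ⟨hm.size, hm.var, fun r' a' b' ha' hb' => ?_⟩
  simp only [State.setMem, Function.update_apply, address_inj ha' hb' haS hbS, Store.put_a,
    hm.cell _ _ _ ha' hb']

theorem Tri.ite (hW : 32 * (S * S) ≤ W) {σ : Store} {c : Cmp} {a b : Expr} {p q : Prog}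
    {T : ℕ} {Q : Store → Prop} (ha : a.Ok W S σ) (hb : b.Ok W S σ)
    (hp : c.Holds (a.eval S σ) (b.eval S σ) → Tri W S p σ T Q)
    (hq : ¬ c.Holds (a.eval S σ) (b.eval S σ) → Tri W S q σ T Q) :
    Tri W S (.ite c a b p q) σ (a.cost + b.cost + T + 1) Q := by
  intro s hs
  obtain ⟨s₁, e₁, -, h₁, r₁, r₂⟩ := exec_pair hW hs ha hb
  by_cases h : c.Holds (a.eval S σ) (b.eval S σ)
  · obtain ⟨t, s', σ', h₂, h₃, h₄⟩ := hp h s₁ h₁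
    exact ⟨_, s', σ', e₁ (.ite_true (by rwa [r₁, r₂]) h₂), by omega, h₄⟩
  · obtain ⟨t, s', σ', h₂, h₃, h₄⟩ := hq h s₁ h₁
    exact ⟨_, s', σ', e₁ (.ite_false (by rwa [r₁, r₂]) h₂), by omega, h₄⟩

theorem tri_of_wp (hW : 32 * (S * S) ≤ W) (p : Prog) :
    ∀ {σ : Store} {Q : Store → Prop}, p.wp W S Q σ → Tri W S p σ p.cost Q := by
  induction p with
  | skip => exact fun hQ s hs => ⟨1, s, _, .skip s, le_rfl, hs, hQ⟩
  | assign x e => exact fun ⟨h₁, h₂, h₃⟩ => Tri.assign hW h₁ h₂ h₃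
  | write r a b e => exact fun ⟨h₁, h₂, h₃, h₄, h₅, h₆, h₇⟩ => Tri.write hW h₁ h₂ h₃ h₄ h₅ h₆ h₇
  | seq p q ihp ihq => exact fun h => Tri.seq ((ihp h).mono le_rfl fun _ => ihq)
  | ite c a b p q ihp ihq =>
    rintro σ Q ⟨h₁, h₂, h₃, h₄⟩
    refine (Tri.ite hW (T := p.cost + q.cost) (Q := Q) h₁ h₂ (fun h => (ihp (h₃ h)).mono (by omega) ?_)
      fun h => (ihq (h₄ h)).mono (by omega) ?_).mono (by simp only [cost]; omega) ?_ <;>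
    exact fun _ => id
  | loop c a b p => exact fun h => h.elim

/-- The number N of rounds is known in advance and `Inv i` holds after i of them, so termination is
part of the rule. The proof is by induction on the number of remaining rounds, starting from a state
in which the guard has just been evaluated. -/
theorem Tri.loop (hW : 32 * (S * S) ≤ W) {c : Cmp} {a b : Expr} {p : Prog} {Q : Store → Prop}
    {N : ℕ} (Inv : ℕ → Store → Prop) (T : ℕ → ℕ) {σ : Store} (h0 : Inv 0 σ)
    (hstep : ∀ i < N, ∀ σ, Inv i σ → a.Ok W S σ ∧ b.Ok W S σ ∧
      c.Holds (a.eval S σ) (b.eval S σ) ∧ Tri W S p σ (T i) (Inv (i + 1)))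
    (hend : ∀ σ, Inv N σ → a.Ok W S σ ∧ b.Ok W S σ ∧ ¬ c.Holds (a.eval S σ) (b.eval S σ) ∧ Q σ) :
    Tri W S (.loop c a b p) σ
      ((∑ i ∈ Finset.range N, (T i + (a.cost + b.cost + 1))) + (a.cost + b.cost + 1)) Q := by
  have key : ∀ k i, i + k = N → ∀ σ, Inv i σ → ∀ s : State, s.Models S σ →
      ∃ s₁, Exec W (.seq (a.compile 0) (b.compile 1)) s (a.cost + b.cost) s₁ ∧
      (∀ {p : Program} {s'' : State} {t : ℕ},
        Exec W p s₁ t s'' → Exec W (.seq (a.compile 0) (.seq (b.compile 1) p)) s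
          (a.cost + (b.cost + t)) s'') ∧
      ∃ t s' σ', Exec W (.while c (a.loc 0) (b.loc 1)
        (.seq p.compile (.seq (a.compile 0) (b.compile 1)))) s₁ t s' ∧
        t ≤ (∑ j ∈ Finset.range k, (T (i + j) + (a.cost + b.cost + 1))) + 1 ∧
        s'.Models S σ' ∧ Q σ' := by
    intro k
    induction k with
    | zero =>
      intro i hi σ hσ s hs
      obtain rfl : i = N := by omega
      obtain ⟨ha, hb, hc, hQ⟩ := hend σ hσ
      obtain ⟨s₁, e₁, e₂, h₁, r₁, r₂⟩ := exec_pair hW hs ha hb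
      exact ⟨s₁, e₂, e₁, 1, s₁, σ, .while_false (by rwa [r₁, r₂]), by simp, h₁, hQ⟩
    | succ k ih =>
      intro i hi σ hσ s hs
      obtain ⟨ha, hb, hc, hT⟩ := hstep i (by omega) σ hσ
      obtain ⟨s₁, e₁, e₂, h₁, r₁, r₂⟩ := exec_pair hW hs ha hb
      obtain ⟨t, s₂, σ₂, e₃, ht, h₂, hI⟩ := hT s₁ h₁
      obtain ⟨s₃, e₄, -, t', s₄, σ₄, e₅, ht', h₄, hQ⟩ := ih (i + 1) (by omega) σ₂ hI s₂ h₂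
      refine ⟨s₁, e₂, e₁, _, s₄, σ₄, .while_true (by rwa [r₁, r₂]) (e₃.seq e₄) e₅, ?_, h₄, hQ⟩
      rw [Finset.sum_range_succ', add_zero]
      simp only [add_assoc, add_comm 1] at ht' ⊢
      omega
  intro s hs
  obtain ⟨s₁, -, e₁, t, s', σ', e₂, ht, h⟩ := key N 0 (by omega) σ h0 s hs
  refine ⟨_, s', σ', e₁ e₂, ?_, h⟩
  simp only [zero_add] at ht
  omega

/-- The variable `x` runs from its present value up to the value of the expression `b`. -/
def upTo (x : ℕ) (b : Expr) (p : Prog) : Prog :=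
  .loop .lt (.var x) b (.seq p (.assign x (.var x + .const 1)))

/-- The invariant is stated after the increment of the counter. Each round pays 5 steps for the
increment and `b.cost + 2` for the guard and its test. -/
theorem Tri.upTo (hW : 32 * (S * S) ≤ W) {x : ℕ} {b : Expr} {p : Prog} {Q : Store → Prop}
    {N i₀ : ℕ} (Inv : ℕ → Store → Prop) (T : ℕ → ℕ) {σ : Store} (h0 : Inv 0 σ) (hx : σ.v x = i₀)
    (hN : i₀ + N + 1 < W)
    (hb : ∀ i ≤ N, ∀ σ, Inv i σ → b.Ok W S σ ∧ b.eval S σ = i₀ + N)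
    (hstep : ∀ i < N, ∀ σ, σ.v x = i₀ + i → Inv i σ →
      Tri W S p σ (T i) fun σ' => σ'.v x = i₀ + i ∧ Inv (i + 1) (σ'.set x (i₀ + (i + 1))))
    (hend : ∀ σ, Inv N σ → σ.v x = i₀ + N → Q σ) :
    Tri W S (upTo x b p) σ
      ((∑ i ∈ Finset.range N, (T i + (b.cost + 7))) + (b.cost + 2)) Q := by
  refine (Tri.loop hW (N := N) (fun i σ => Inv i σ ∧ σ.v x = i₀ + i)
    (fun i => T i + 5) ⟨h0, hx⟩ ?_ ?_).mono ?_ fun _ => id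
  · rintro i hi σ ⟨hI, hx⟩
    obtain ⟨h₁, h₂⟩ := hb i hi.le σ hI
    refine ⟨trivial, h₁, ?_, Tri.seq ((hstep i hi σ hx hI).mono le_rfl ?_)⟩
    · simp only [Cmp.Holds, Expr.eval_var]; omega
    · rintro σ' ⟨hx', hI'⟩
      refine (Tri.assign hW ?_ ?_ ?_).mono (by simp only [HAdd.hAdd, Add.add, Expr.cost]; decide)
        fun _ => id
      · simp only [Expr.ok_add, Expr.ok_var, Expr.ok_const, Expr.eval_var, Expr.eval_const]
        exact ⟨trivial, by omega, by omega⟩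
      · simp only [Expr.eval_add, Expr.eval_var, Expr.eval_const]; omega
      · simp only [Expr.eval_add, Expr.eval_var, Expr.eval_const, hx', add_assoc]
        exact ⟨hI', by simp⟩
  · rintro σ ⟨hI, hx⟩
    obtain ⟨h₁, h₂⟩ := hb N le_rfl σ hI
    refine ⟨trivial, h₁, ?_, hend σ hI hx⟩
    simp only [Cmp.Holds, Expr.eval_var]; omega
  · simp only [Expr.cost]
    refine Nat.add_le_add (Finset.sum_le_sum fun i _ => by omega) (by omega)

end Prog

end WordRAM

/-! ### Powers of two -/

/-- The largest power of two that is at most `x`, and `1` for `x = 0`. -/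
def highBit (x : ℕ) : ℕ := 2 ^ Nat.log 2 x

/-- `p` is the smallest power of two in the binary representation of `c`. -/
def IsLowBit (c p : ℕ) : Prop := ∃ j, p = 2 ^ j ∧ c.testBit j = true ∧ ∀ i < j, c.testBit i = false

theorem highBit_of_two_le {x : ℕ} (h : 2 ≤ x) : highBit x = 2 * highBit (x / 2) := by
  rw [highBit, highBit, Nat.log_of_one_lt_of_le (by norm_num) h, pow_succ, mul_comm]

theorem highBit_le {x : ℕ} (h : x ≠ 0) : highBit x ≤ x := Nat.pow_log_le_self 2 h

theorem isLowBit_of_odd {c : ℕ} (h : c % 2 = 1) : IsLowBit c 1 :=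
  ⟨0, rfl, by simp [Nat.testBit_zero, h], by simp⟩

theorem isLowBit_of_even {c p : ℕ} (h : c % 2 = 0) (hp : IsLowBit (c / 2) p) :
    IsLowBit c (2 * p) := by
  obtain ⟨j, rfl, hj, hi⟩ := hp
  refine ⟨j + 1, by ring, by rwa [Nat.testBit_succ], fun i hij => ?_⟩
  cases i with
  | zero => simp [Nat.testBit_zero, h]
  | succ i => rw [Nat.testBit_succ]; exact hi i (by omega)

theorem IsLowBit.le {c p : ℕ} (h : IsLowBit c p) : p ≤ c := by
  obtain ⟨j, rfl, hj, -⟩ := h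
  exact Nat.ge_two_pow_of_testBit hj

/-- Either side says that a and b have the same bits from position k on. -/
theorem div_two_pow_eq_iff (a b k : ℕ) : a / 2 ^ k = b / 2 ^ k ↔ a ^^^ b < 2 ^ k := by
  rw [← Nat.shiftRight_eq_div_pow, ← Nat.shiftRight_eq_div_pow, ← Nat.xor_eq_zero_iff,
    ← Nat.shiftRight_xor_distrib, Nat.shiftRight_eq_div_pow, Nat.div_eq_zero_iff]
  simp

theorem div_two_pow_eq_iff_log {a b k : ℕ} (h : a ≠ b) :
    a / 2 ^ k = b / 2 ^ k ↔ Nat.log 2 (a ^^^ b) < k := by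
  rw [div_two_pow_eq_iff, Nat.log_lt_iff_lt_pow (by norm_num)]
  exact fun h' => h (Nat.xor_eq_zero_iff.1 h')

theorem div_two_pow_eq_of_log {a b k : ℕ} (h : Nat.log 2 (a ^^^ b) < k) :
    a / 2 ^ k = b / 2 ^ k := by
  rw [div_two_pow_eq_iff]
  exact Nat.lt_pow_of_log_lt (by norm_num) h

/-- The numbers a and b lie below the power of two following M, which is at most 2M. This is why bit
tables up to 2M suffice. -/
theorem xor_lt_two_mul {a b M : ℕ} (ha : a ≤ M) (hb : b ≤ M) (hM : 0 < M) : a ^^^ b < 2 * M + 1 := by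
  have h := Nat.lt_pow_succ_log_self (b := 2) (by norm_num) M
  have h' := Nat.xor_lt_two_pow (ha.trans_lt h) (hb.trans_lt h)
  have h'' := Nat.pow_log_le_self 2 hM.ne'
  rw [Nat.succ_eq_add_one, pow_succ] at h'
  omega

/-- Subtracting the remainder modulo 2 ^ k clears the k lowest bits. -/
theorem testBit_sub_mod (c k j : ℕ) :
    (c - c % 2 ^ k).testBit j = (decide (k ≤ j) && c.testBit j) := by
  have h : c - c % 2 ^ k = 2 ^ k * (c / 2 ^ k) := by
    have := Nat.div_add_mod c (2 ^ k)
    omega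
  rw [h, Nat.testBit_two_pow_mul, Nat.testBit_div_two_pow]
  by_cases hk : k ≤ j
  · rw [Nat.sub_add_cancel hk]
  · simp [hk]

theorem testBit_log {y : ℕ} (hy : y ≠ 0) : y.testBit (Nat.log 2 y) = true := by
  have h₁ := Nat.lt_pow_succ_log_self (b := 2) (by norm_num) y
  have h₂ := Nat.pow_log_le_self 2 hy
  have h : y / 2 ^ Nat.log 2 y = 1 := by
    rw [Nat.succ_eq_add_one, pow_succ] at h₁
    exact Nat.div_eq_of_lt_le (by omega) (by omega)
  simp [Nat.testBit_eq_decide_div_mod_eq, h]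

theorem le_log_of_testBit {y j : ℕ} (h : y.testBit j = true) : j ≤ Nat.log 2 y :=
  Nat.le_log_of_pow_le (by norm_num) (Nat.ge_two_pow_of_testBit h)

/-! ### Trees in preorder -/

/-- A tree whose nodes are numbered in preorder by `0, …, size - 1`.  The descendants of `v` are the
nodes from `v` to `last v`. -/
structure PreorderTree where
  size : ℕ
  last : ℕ → ℕ
  par : ℕ → ℕ
  size_pos : 0 < size
  le_last : ∀ v, v ≤ last v
  last_lt : ∀ v < size, last v < size
  last_zero : last 0 = size - 1
  nested : ∀ u v, u ≤ v → v ≤ last u → last v ≤ last u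
  par_zero : par 0 = 0
  par_lt : ∀ v < size, 0 < v → par v < v
  le_last_par : ∀ v < size, v ≤ last (par v)
  le_par : ∀ u v, v < size → u < v → v ≤ last u → u ≤ par v

namespace PreorderTree

variable (τ : PreorderTree)

/-- `u` is an ancestor of `v` or equal to `v`. -/
def Anc (u v : ℕ) : Prop := u ≤ v ∧ v ≤ τ.last u

instance (u v : ℕ) : Decidable (τ.Anc u v) := inferInstanceAs (Decidable (_ ∧ _))

/-- The lowest common ancestor. -/
def lca (x y : ℕ) : ℕ := Nat.findGreatest (fun u => τ.Anc u x ∧ τ.Anc u y) x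

variable {τ} {u v x y z : ℕ}

theorem Anc.refl (v : ℕ) : τ.Anc v v := ⟨le_rfl, τ.le_last v⟩

theorem Anc.trans (h : τ.Anc u v) (h' : τ.Anc v x) : τ.Anc u x :=
  ⟨h.1.trans h'.1, h'.2.trans (τ.nested _ _ h.1 h.2)⟩

theorem Anc.antisymm (h : τ.Anc u v) (h' : τ.Anc v u) : u = v := le_antisymm h.1 h'.1

theorem Anc.convex (h : τ.Anc u x) (h₁ : u ≤ v) (h₂ : v ≤ x) : τ.Anc u v := ⟨h₁, h₂.trans h.2⟩

theorem Anc.comparable (h : τ.Anc u x) (h' : τ.Anc v x) : τ.Anc u v ∨ τ.Anc v u := by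
  rcases le_total u v with h₁ | h₁
  · exact .inl (h.convex h₁ h'.1)
  · exact .inr (h'.convex h₁ h.1)

theorem Anc.lt (h : τ.Anc u v) (hv : v < τ.size) : u < τ.size := h.1.trans_lt hv

theorem anc_zero (hv : v < τ.size) : τ.Anc 0 v := ⟨Nat.zero_le _, by rw [τ.last_zero]; omega⟩

theorem par_lt_size (hv : v < τ.size) : τ.par v < τ.size := by
  rcases Nat.eq_zero_or_pos v with rfl | h
  · rwa [τ.par_zero]
  · exact (τ.par_lt v hv h).trans hv

theorem par_le (hv : v < τ.size) : τ.par v ≤ v := by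
  rcases Nat.eq_zero_or_pos v with rfl | h
  · exact τ.par_zero.le
  · exact (τ.par_lt v hv h).le

theorem anc_par (hv : v < τ.size) : τ.Anc (τ.par v) v := ⟨par_le hv, τ.le_last_par v hv⟩

theorem Anc.of_ne (h : τ.Anc u v) (hne : u ≠ v) (hv : v < τ.size) : τ.Anc u (τ.par v) :=
  h.convex (τ.le_par u v hv (lt_of_le_of_ne h.1 hne) h.2) (par_le hv)

/-- A proper descendant of `u` is a descendant of a child of `u`. -/
theorem Anc.exists_child (h : τ.Anc u v) (hne : u ≠ v) (hv : v < τ.size) :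
    ∃ c, u < c ∧ c < τ.size ∧ τ.par c = u ∧ τ.Anc c v := by
  induction v using Nat.strong_induction_on with
  | _ v ih =>
    have hv0 : 0 < v := lt_of_le_of_lt (Nat.zero_le u) (lt_of_le_of_ne h.1 hne)
    by_cases hu : u = τ.par v
    · exact ⟨v, lt_of_le_of_ne h.1 hne, hv, hu.symm, .refl v⟩
    · obtain ⟨c, h₁, h₂, h₃, h₄⟩ := ih _ (τ.par_lt v hv hv0) (h.of_ne hne hv) hu (par_lt_size hv)
      exact ⟨c, h₁, h₂, h₃, h₄.trans (anc_par hv)⟩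

/-- Any common ancestor is at most the greatest one, which is at most x; by convexity of the range
of descendants it is an ancestor of the greatest one. -/
theorem anc_lca_iff (hx : x < τ.size) (hy : y < τ.size) :
    τ.Anc u (τ.lca x y) ↔ τ.Anc u x ∧ τ.Anc u y := by
  have hz : τ.Anc (τ.lca x y) x ∧ τ.Anc (τ.lca x y) y :=
    Nat.findGreatest_spec (P := fun u => τ.Anc u x ∧ τ.Anc u y) (Nat.zero_le x)
      ⟨anc_zero hx, anc_zero hy⟩
  refine ⟨fun h => ⟨h.trans hz.1, h.trans hz.2⟩, fun h => h.1.convex ?_ hz.1.1⟩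
  exact Nat.le_findGreatest h.1.1 h

theorem lca_anc_left (hx : x < τ.size) (hy : y < τ.size) : τ.Anc (τ.lca x y) x :=
  ((anc_lca_iff hx hy).1 (.refl _)).1

theorem lca_anc_right (hx : x < τ.size) (hy : y < τ.size) : τ.Anc (τ.lca x y) y :=
  ((anc_lca_iff hx hy).1 (.refl _)).2

theorem lca_lt (hx : x < τ.size) (hy : y < τ.size) : τ.lca x y < τ.size :=
  (lca_anc_left hx hy).lt hx

theorem eq_lca (hx : x < τ.size) (hy : y < τ.size) (h : ∀ u, τ.Anc u z ↔ τ.Anc u x ∧ τ.Anc u y) :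
    z = τ.lca x y :=
  Anc.antisymm ((anc_lca_iff hx hy).2 ((h z).1 (.refl z)))
    ((h _).2 ((anc_lca_iff hx hy).1 (.refl _)))

theorem lca_self (hx : x < τ.size) : τ.lca x x = x := (eq_lca hx hx fun u => by simp).symm

theorem lca_comm (hx : x < τ.size) (hy : y < τ.size) : τ.lca x y = τ.lca y x :=
  eq_lca hy hx fun u => by rw [anc_lca_iff hx hy, and_comm]

theorem lca_zero_left (hx : x < τ.size) : τ.lca 0 x = 0 :=
  Nat.le_zero.1 (lca_anc_left τ.size_pos hx).1

theorem lca_zero_right (hx : x < τ.size) : τ.lca x 0 = 0 :=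
  Nat.le_zero.1 (lca_anc_right hx τ.size_pos).1

/-- The lowest common ancestor of the ends of a range is one of those of two parts of the range. -/
theorem lca_eq_or (hxy : x ≤ y) (hyz : y ≤ z) (hz : z < τ.size) :
    τ.lca x z = τ.lca x y ∨ τ.lca x z = τ.lca y z := by
  have hy : y < τ.size := hyz.trans_lt hz
  have hx : x < τ.size := hxy.trans_lt hy
  have h : τ.Anc (τ.lca x z) y :=
    (lca_anc_right hx hz).convex ((lca_anc_left hx hz).1.trans hxy) hyz
  rcases Anc.comparable (lca_anc_right hx hy) (lca_anc_left hy hz) with h' | h'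
  · refine .inl (Anc.antisymm ((anc_lca_iff hx hy).2 ⟨lca_anc_left hx hz, h⟩) ?_)
    exact (anc_lca_iff hx hz).2 ⟨lca_anc_left hx hy, h'.trans (lca_anc_right hy hz)⟩
  · refine .inr (Anc.antisymm ((anc_lca_iff hy hz).2 ⟨h, lca_anc_right hx hz⟩) ?_)
    exact (anc_lca_iff hx hz).2 ⟨h'.trans (lca_anc_left hx hy), lca_anc_right hy hz⟩

/-! ### Lowest common ancestors by inlabel numbers -/

variable (τ)

/-- The number of trailing zeros of the inlabel number of `v`. -/
def height (v : ℕ) : ℕ := Nat.log 2 (v ^^^ (τ.last v + 1))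

/-- The inlabel number of `v`: the number divisible by the largest power of two among
`v + 1, …, last v + 1`. -/
def inlabel (v : ℕ) : ℕ := (τ.last v + 1) / highBit (v ^^^ (τ.last v + 1)) *
  highBit (v ^^^ (τ.last v + 1))

/-- The bits of `A` are the heights of the ancestors of `v`. -/
def IsMask (v A : ℕ) : Prop := ∀ j, A.testBit j = true ↔ ∃ u, τ.Anc u v ∧ τ.height u = j

/-- `hd` maps inlabel numbers to the topmost nodes with these numbers. -/
def IsHead (hd : ℕ → ℕ) : Prop :=
  ∀ v < τ.size, hd (τ.inlabel v) ≤ v ∧ τ.inlabel (hd (τ.inlabel v)) = τ.inlabel v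

/-- The lowest ancestor of `x` of height `log P`. -/
def climb (hd : ℕ → ℕ) (A P x : ℕ) : ℕ :=
  if A % P = 0 then x
  else τ.par (hd (τ.inlabel x / (2 * highBit (A % P)) * (2 * highBit (A % P)) + highBit (A % P)))

variable {τ}

/-- The height is the highest position at which v and last v + 1 differ; equivalently, the largest k
such that a multiple of 2 ^ k lies in v + 1, …, last v + 1. -/
theorem div_eq_iff_height (v k : ℕ) :
    v / 2 ^ k = (τ.last v + 1) / 2 ^ k ↔ τ.height v < k :=
  div_two_pow_eq_iff_log (by have := τ.le_last v; omega)

theorem inlabel_bounds (v : ℕ) : v < τ.inlabel v ∧ τ.inlabel v ≤ τ.last v + 1 := by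
  have h := (not_congr (div_eq_iff_height (τ := τ) v (τ.height v))).2 (lt_irrefl _)
  have hle : v / 2 ^ τ.height v ≤ (τ.last v + 1) / 2 ^ τ.height v :=
    Nat.div_le_div_right (by have := τ.le_last v; omega)
  refine ⟨?_, Nat.div_mul_le_self _ _⟩
  change v < (τ.last v + 1) / 2 ^ τ.height v * 2 ^ τ.height v
  rw [← Nat.div_lt_iff_lt_mul (by positivity)]
  omega

/-- The range of an ancestor is larger and contains at least the same multiples of powers of two. -/
theorem height_le_of_anc (h : τ.Anc u v) : τ.height v ≤ τ.height u := by
  by_contra! hlt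
  have h₁ := (div_eq_iff_height (τ := τ) u _).2 hlt
  have h₂ := (not_congr (div_eq_iff_height (τ := τ) v _)).2 (lt_irrefl _)
  have h₃ : u / 2 ^ τ.height v ≤ v / 2 ^ τ.height v := Nat.div_le_div_right h.1
  have h₄ : v / 2 ^ τ.height v ≤ (τ.last v + 1) / 2 ^ τ.height v :=
    Nat.div_le_div_right (by have := τ.le_last v; omega)
  have h₅ : (τ.last v + 1) / 2 ^ τ.height v ≤ (τ.last u + 1) / 2 ^ τ.height v :=
    Nat.div_le_div_right (by have := τ.nested _ _ h.1 h.2; omega)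
  omega

/-- The inlabel number is determined by the height and any number of the range. -/
theorem inlabel_eq (h₁ : v ≤ x) (h₂ : x ≤ τ.last v + 1) :
    τ.inlabel v = x / 2 ^ (τ.height v + 1) * 2 ^ (τ.height v + 1) + 2 ^ τ.height v := by
  have e := (div_eq_iff_height (τ := τ) v _).2 (Nat.lt_succ_self _)
  have ne := (not_congr (div_eq_iff_height (τ := τ) v _)).2 (lt_irrefl _)
  rw [Nat.succ_eq_add_one] at e
  have hx₁ : v / 2 ^ (τ.height v + 1) ≤ x / 2 ^ (τ.height v + 1) := Nat.div_le_div_right h₁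
  have hx₂ : x / 2 ^ (τ.height v + 1) ≤ (τ.last v + 1) / 2 ^ (τ.height v + 1) :=
    Nat.div_le_div_right h₂
  have hx : x / 2 ^ (τ.height v + 1) = (τ.last v + 1) / 2 ^ (τ.height v + 1) := by omega
  have hle : v / 2 ^ τ.height v ≤ (τ.last v + 1) / 2 ^ τ.height v :=
    Nat.div_le_div_right (by have := τ.le_last v; omega)
  rw [hx]
  change (τ.last v + 1) / 2 ^ τ.height v * 2 ^ τ.height v = _
  rw [pow_succ, ← Nat.div_div_eq_div_mul] at e ⊢
  rw [← Nat.div_div_eq_div_mul] at e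
  have : (τ.last v + 1) / 2 ^ τ.height v = (τ.last v + 1) / 2 ^ τ.height v / 2 * 2 + 1 := by omega
  conv_lhs => rw [this]
  ring

/-- The inlabel number of v lies in the range of u, and all numbers of that range share their bits
above the height of u. So the inlabel number of an ancestor is recovered from its height alone,
without knowing the ancestor. -/
theorem inlabel_eq_of_anc (h : τ.Anc u v) :
    τ.inlabel u = τ.inlabel v / 2 ^ (τ.height u + 1) * 2 ^ (τ.height u + 1) + 2 ^ τ.height u := by
  have h₁ := inlabel_bounds (τ := τ) v
  have h₂ := τ.nested _ _ h.1 h.2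
  exact inlabel_eq (by have := h.1; omega) (by omega)

theorem testBit_inlabel (v : ℕ) : (τ.inlabel v).testBit (τ.height v) = true ∧
    ∀ i < τ.height v, (τ.inlabel v).testBit i = false := by
  have h := inlabel_eq (τ := τ) (le_refl v) (by have := τ.le_last v; omega)
  have h' : τ.inlabel v = 2 ^ τ.height v * (2 * (v / 2 ^ (τ.height v + 1)) + 1) := by
    rw [h]; ring
  rw [h']
  refine ⟨?_, fun i hi => ?_⟩
  · rw [Nat.testBit_two_pow_mul]; simp [Nat.testBit_zero]
  · rw [Nat.testBit_two_pow_mul]; simp; omega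

theorem height_eq_of_inlabel_eq (h : τ.inlabel u = τ.inlabel v) : τ.height u = τ.height v := by
  have hu := testBit_inlabel (τ := τ) u
  have hv := testBit_inlabel (τ := τ) v
  rw [h] at hu
  rcases lt_trichotomy (τ.height u) (τ.height v) with h' | h' | h'
  · simp [hv.2 _ h'] at hu
  · exact h'
  · simp [hu.2 _ h'] at hv

theorem inlabel_eq_of_height_eq (h : τ.Anc u v) (hh : τ.height u = τ.height v) :
    τ.inlabel u = τ.inlabel v := by
  have h₁ := inlabel_bounds (τ := τ) v
  have h₂ := τ.nested _ _ h.1 h.2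
  rw [inlabel_eq (τ := τ) (v := u) (x := v) h.1 (by have := h.2; omega),
    inlabel_eq (τ := τ) (v := v) (le_refl v) (by have := τ.le_last v; omega), hh]

/-- The node preceding the common inlabel number by one is a descendant of both. So nodes with equal
inlabel numbers lie on one path from the root. -/
theorem comparable_of_inlabel_eq (h : τ.inlabel u = τ.inlabel v) : τ.Anc u v ∨ τ.Anc v u := by
  have hu := inlabel_bounds (τ := τ) u
  have hv := inlabel_bounds (τ := τ) v
  exact Anc.comparable (x := τ.inlabel u - 1) ⟨by omega, by omega⟩ ⟨by omega, by omega⟩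

/-- If x has an ancestor below the height of z, let k be the largest such height, found in the mask,
and w the topmost node on its chain. The height k is less than that of z, so w is a proper
descendant of z. Were the parent of w still lower than z, maximality of k would give it the height
and the inlabel number of w, contrary to the choice of w as topmost. Otherwise x itself has the
height of z. -/
theorem climb_spec {hd : ℕ → ℕ} {A : ℕ} (hhd : τ.IsHead hd) (hx : x < τ.size) (hz : τ.Anc z x)
    (hA : τ.IsMask x A) : τ.Anc (τ.climb hd A (2 ^ τ.height z) x) x ∧
      τ.Anc z (τ.climb hd A (2 ^ τ.height z) x) ∧
      τ.height (τ.climb hd A (2 ^ τ.height z) x) = τ.height z := by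
  unfold climb
  have hbit : ∀ j, (A % 2 ^ τ.height z).testBit j = true ↔
      j < τ.height z ∧ ∃ u, τ.Anc u x ∧ τ.height u = j := by
    intro j
    rw [Nat.testBit_mod_two_pow, Bool.and_eq_true, decide_eq_true_iff, hA j]
  split_ifs with h
  · refine ⟨.refl x, hz, le_antisymm (height_le_of_anc hz) ?_⟩
    by_contra! hlt
    have := (hbit (τ.height x)).2 ⟨hlt, x, .refl x, rfl⟩
    simp [h] at this
  · set B := A % 2 ^ τ.height z
    obtain ⟨hk, u, hu, huk⟩ := (hbit (Nat.log 2 B)).1 (testBit_log h)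
    have hlab : τ.inlabel x / (2 * highBit B) * (2 * highBit B) + highBit B = τ.inlabel u := by
      rw [inlabel_eq_of_anc hu, huk, highBit, pow_succ, mul_comm 2]
    rw [hlab]
    have hus := hu.lt hx
    obtain ⟨hw₁, hw₂⟩ := hhd u hus
    generalize hw : hd (τ.inlabel u) = w at hw₁ hw₂
    have hwu : τ.Anc w u := by
      rcases comparable_of_inlabel_eq hw₂ with h' | h'
      · exact h'
      · rw [le_antisymm hw₁ h'.1]; exact .refl u
    have hwk : τ.height w = Nat.log 2 B := by rw [height_eq_of_inlabel_eq hw₂, huk]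
    have hwx := hwu.trans hu
    have hws := hwx.lt hx
    have hzw : τ.Anc z w := by
      rcases hz.comparable hwx with h' | h'
      · exact h'
      · have := height_le_of_anc h'; omega
    have hne : z ≠ w := by rintro rfl; omega
    have hzp := hzw.of_ne hne hws
    have hpw := anc_par hws
    refine ⟨hpw.trans hwx, hzp, le_antisymm (height_le_of_anc hzp) ?_⟩
    by_contra! hlt
    have h₁ := le_log_of_testBit ((hbit _).2 ⟨hlt, _, hpw.trans hwx, rfl⟩)
    have h₂ := height_le_of_anc hpw
    have h₃ := inlabel_eq_of_height_eq hpw (by omega)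
    have h₄ := (hhd _ (par_lt_size hws)).1
    rw [h₃, hw₂, hw] at h₄
    have h₅ := hzw.1
    have h₆ := τ.par_lt w hws (by omega)
    omega

theorem head_lt {hd : ℕ → ℕ} {A k : ℕ} (hhd : τ.IsHead hd) (hx : x < τ.size) (hA : τ.IsMask x A)
    (h : A % 2 ^ k ≠ 0) : hd (τ.inlabel x / (2 * highBit (A % 2 ^ k)) * (2 * highBit (A % 2 ^ k)) +
      highBit (A % 2 ^ k)) < τ.size := by
  have hb := testBit_log h
  rw [Nat.testBit_mod_two_pow, Bool.and_eq_true, hA] at hb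
  obtain ⟨-, u, hu, huk⟩ := hb
  rw [highBit, mul_comm 2, ← pow_succ, ← huk, ← inlabel_eq_of_anc hu]
  exact (hhd u (hu.lt hx)).1.trans_lt (hu.lt hx)

theorem testBit_common {A A' : ℕ} (hA : τ.IsMask x A) (hA' : τ.IsMask y A') (i : ℕ) :
    ((A &&& A') - (A &&& A') % highBit (τ.inlabel x ^^^ τ.inlabel y)).testBit i = true ↔
      Nat.log 2 (τ.inlabel x ^^^ τ.inlabel y) ≤ i ∧ (∃ u, τ.Anc u x ∧ τ.height u = i) ∧
        ∃ u, τ.Anc u y ∧ τ.height u = i := by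
  rw [highBit, testBit_sub_mod, Nat.testBit_and, Bool.and_eq_true, Bool.and_eq_true,
    decide_eq_true_iff, hA i, hA' i]

theorem testBit_height {A A' : ℕ} (hA : τ.IsMask x A) (hA' : τ.IsMask y A') (hzx : τ.Anc z x)
    (hzy : τ.Anc z y) :
    ((A &&& A') - (A &&& A') % highBit (τ.inlabel x ^^^ τ.inlabel y)).testBit (τ.height z) =
      true := by
  rw [testBit_common hA hA']
  refine ⟨?_, ⟨z, hzx, rfl⟩, ⟨z, hzy, rfl⟩⟩
  have h₁ := inlabel_eq_of_anc hzx
  rw [inlabel_eq_of_anc hzy] at h₁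
  have h₂ : τ.inlabel x / 2 ^ (τ.height z + 1) = τ.inlabel y / 2 ^ (τ.height z + 1) :=
    (Nat.eq_of_mul_eq_mul_right (by positivity) (Nat.add_right_cancel h₁)).symm
  rw [div_two_pow_eq_iff] at h₂
  -- For equal inlabel numbers the logarithm is 0 and no bits are cleared.
  by_cases h₃ : τ.inlabel x ^^^ τ.inlabel y = 0
  · simp [h₃]
  · exact Nat.lt_succ_iff.1 ((Nat.log_lt_iff_lt_pow (by norm_num) h₃).2 h₂)

theorem common_ne_zero {A A' : ℕ} (hx : x < τ.size) (hy : y < τ.size)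
    (hA : τ.IsMask x A) (hA' : τ.IsMask y A') :
    (A &&& A') - (A &&& A') % highBit (τ.inlabel x ^^^ τ.inlabel y) ≠ 0 := by
  intro h
  have := testBit_height hA hA' (anc_zero hx) (anc_zero hy)
  simp [h] at this

/-- The lowest common bit of the masks, from the highest difference of the inlabel numbers on, is
the height of the lowest common ancestor z. Indeed, ancestors of x and y of a common height in that
region have equal inlabel numbers and are comparable, so the upper one is a common ancestor and lies
above z. The two climbs then reach the chain of z, and the upper of their results is z. -/
theorem min_climb_eq_lca {hd : ℕ → ℕ} {A A' P : ℕ} (hhd : τ.IsHead hd) (hx : x < τ.size)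
    (hy : y < τ.size) (hA : τ.IsMask x A) (hA' : τ.IsMask y A')
    (hP : IsLowBit ((A &&& A') - (A &&& A') % highBit (τ.inlabel x ^^^ τ.inlabel y)) P) :
    min (τ.climb hd A P x) (τ.climb hd A' P y) = τ.lca x y := by
  obtain ⟨j, rfl, hj, hi⟩ := hP
  set z := τ.lca x y
  have hzx : τ.Anc z x := lca_anc_left hx hy
  have hzy : τ.Anc z y := lca_anc_right hx hy
  have hjz : j = τ.height z := by
    apply le_antisymm
    · by_contra! hlt
      simpa [testBit_height hA hA' hzx hzy] using hi _ hlt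
    · by_contra! hlt
      obtain ⟨h₁, ⟨u, hu, huj⟩, u', hu', huj'⟩ :=
        (testBit_common hA hA' j).1 hj
      have h₂ : τ.inlabel u = τ.inlabel u' := by
        rw [inlabel_eq_of_anc hu, inlabel_eq_of_anc hu', huj, huj',
          div_two_pow_eq_of_log (Nat.lt_succ_of_le h₁)]
      rcases comparable_of_inlabel_eq h₂ with h | h
      · have := height_le_of_anc ((anc_lca_iff hx hy).2 ⟨hu, h.trans hu'⟩)
        change τ.height z ≤ _ at this
        omega
      · have := height_le_of_anc ((anc_lca_iff hx hy).2 ⟨h.trans hu, hu'⟩)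
        change τ.height z ≤ _ at this
        omega
  rw [hjz]
  obtain ⟨a₁, a₂, a₃⟩ := climb_spec hhd hx hzx hA
  obtain ⟨b₁, b₂, b₃⟩ := climb_spec hhd hy hzy hA'
  generalize τ.climb hd A (2 ^ τ.height z) x = x' at a₁ a₂ a₃
  generalize τ.climb hd A' (2 ^ τ.height z) y = y' at b₁ b₂ b₃
  have hlab : τ.inlabel x' = τ.inlabel y' := by
    rw [← inlabel_eq_of_height_eq a₂ a₃.symm, inlabel_eq_of_height_eq b₂ b₃.symm]
  rcases comparable_of_inlabel_eq hlab with h | h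
  · rw [min_eq_left h.1]
    exact Anc.antisymm ((anc_lca_iff hx hy).2 ⟨a₁, h.trans b₁⟩) a₂
  · rw [min_eq_right h.1]
    exact Anc.antisymm ((anc_lca_iff hx hy).2 ⟨h.trans a₁, b₁⟩) b₂

theorem height_le_log (hv : v < τ.size) : τ.height v ≤ Nat.log 2 τ.size := by
  have h₁ := τ.last_lt v hv
  have h := Nat.lt_pow_succ_log_self (b := 2) (by norm_num) τ.size
  have h' := Nat.xor_lt_two_pow (hv.trans h) ((show τ.last v + 1 ≤ τ.size by omega).trans_lt h)
  exact Nat.lt_succ_iff.1 (Nat.log_lt_of_lt_pow (by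
    have := τ.le_last v
    rw [Ne, Nat.xor_eq_zero_iff]; omega) h')

/-- Heights are at most log size. The bound keeps masks within the range of the bit tables. -/
theorem IsMask.lt {A : ℕ} (hv : v < τ.size) (hA : τ.IsMask v A) : A < 2 * τ.size + 1 := by
  have h : A < 2 ^ (Nat.log 2 τ.size + 1) := by
    refine Nat.lt_pow_two_of_testBit _ fun i hi => ?_
    rw [← Bool.not_eq_true, hA i]
    rintro ⟨u, hu, rfl⟩
    have := height_le_log (hu.lt hv)
    omega
  have h' := Nat.pow_log_le_self 2 τ.size_pos.ne'
  rw [pow_succ] at h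
  omega

theorem IsMask.step {A : ℕ} (hv : v < τ.size) (hA : τ.IsMask (τ.par v) A) :
    τ.IsMask v (A ||| highBit (v ^^^ (τ.last v + 1))) := by
  intro j
  rw [Nat.testBit_or, Bool.or_eq_true, hA j, highBit, Nat.testBit_two_pow, decide_eq_true_iff]
  constructor
  · rintro (⟨u, hu, h⟩ | h)
    · exact ⟨u, hu.trans (anc_par hv), h⟩
    · exact ⟨v, .refl v, h⟩
  · rintro ⟨u, hu, h⟩
    by_cases hne : u = v
    · exact .inr (hne ▸ h)
    · exact .inl ⟨u, hu.of_ne hne hv, h⟩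

theorem isMask_zero : τ.IsMask 0 (0 ||| highBit (0 ^^^ (τ.last 0 + 1))) := by
  intro j
  rw [Nat.zero_or, highBit, Nat.testBit_two_pow, decide_eq_true_iff]
  constructor
  · exact fun h => ⟨0, .refl 0, h⟩
  · rintro ⟨u, hu, h⟩
    obtain rfl := Nat.le_zero.1 hu.1
    exact h

/-! ### Closure under lowest common ancestors -/

variable (τ)

/-- The lowest common ancestors of pairs of elements of `L`. -/
def closure (L : Set ℕ) : Set ℕ := {z | ∃ x ∈ L, ∃ y ∈ L, z = τ.lca x y}

variable {τ} {L : Set ℕ}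

theorem subset_closure (hL : ∀ x ∈ L, x < τ.size) (hx : x ∈ L) : x ∈ τ.closure L :=
  ⟨x, hx, x, hx, (lca_self (hL x hx)).symm⟩

theorem closure_lt (hL : ∀ x ∈ L, x < τ.size) (hz : z ∈ τ.closure L) : z < τ.size := by
  obtain ⟨x, hx, y, hy, rfl⟩ := hz
  exact lca_lt (hL x hx) (hL y hy)

theorem mem_closure_of_le (hL : ∀ x ∈ L, x < τ.size) (hz : z ∈ τ.closure L) :
    ∃ x ∈ L, ∃ y ∈ L, x ≤ y ∧ z = τ.lca x y := by
  obtain ⟨x, hx, y, hy, rfl⟩ := hz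
  rcases le_total x y with h | h
  · exact ⟨x, hx, y, hy, h, rfl⟩
  · exact ⟨y, hy, x, hx, h, lca_comm (hL x hx) (hL y hy)⟩

/-- An ancestor of two nodes is an ancestor of everything between them, so four elements of L have
the same common ancestors as the least and the greatest of them. -/
theorem lca_mem_closure (hL : ∀ x ∈ L, x < τ.size) (hu : u ∈ τ.closure L) (hv : v ∈ τ.closure L) :
    τ.lca u v ∈ τ.closure L := by
  obtain ⟨x, hx, y, hy, hxy, rfl⟩ := mem_closure_of_le hL hu
  obtain ⟨x', hx', y', hy', hxy', rfl⟩ := mem_closure_of_le hL hv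
  have mx : min x x' ∈ L := by rcases min_choice x x' with h | h <;> rwa [h]
  have my : max y y' ∈ L := by rcases max_choice y y' with h | h <;> rwa [h]
  refine ⟨_, mx, _, my, eq_lca (hL _ mx) (hL _ my) fun w => ?_⟩
  rw [anc_lca_iff (lca_lt (hL x hx) (hL y hy)) (lca_lt (hL x' hx') (hL y' hy')),
    anc_lca_iff (hL x hx) (hL y hy), anc_lca_iff (hL x' hx') (hL y' hy')]
  constructor
  · rintro ⟨⟨h₁, h₂⟩, h₃, h₄⟩
    refine ⟨?_, ?_⟩
    · rcases min_choice x x' with h | h <;> rwa [h]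
    · rcases max_choice y y' with h | h <;> rwa [h]
  · rintro ⟨h₁, h₂⟩
    have h₃ : ∀ i, min x x' ≤ i → i ≤ max y y' → τ.Anc w i :=
      fun i hi hi' => h₂.convex (h₁.1.trans hi) hi'
    exact ⟨⟨h₃ _ (by omega) (by omega), h₃ _ (by omega) (by omega)⟩,
      h₃ _ (by omega) (by omega), h₃ _ (by omega) (by omega)⟩

/-- There are at most twice as many nodes in the closure. -/
theorem card_le_of_closure {F : Finset ℕ} (hF : ∀ x ∈ F, x < τ.size)
    (h : ∀ v < τ.size, v ∈ τ.closure (F : Set ℕ)) : τ.size ≤ 2 * F.card := by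
  classical
  let pred : ℕ → ℕ := fun y => Nat.findGreatest (fun x => x ∈ F ∧ x < y) y
  -- Splitting at the predecessor of y in F, the lowest common ancestor is either that of y and its
  -- predecessor or that of a pair with smaller right end. So F and one new node for each element of
  -- F suffice.
  have key : ∀ y, ∀ x ∈ F, y ∈ F → x ≤ y →
      τ.lca x y ∈ F ∪ F.image fun y => τ.lca (pred y) y := by
    intro y
    induction y using Nat.strong_induction_on with
    | _ y ih =>
      intro x hx hy hxy
      by_cases hne : x = y
      · rw [hne, lca_self (hF y hy)]
        exact Finset.mem_union_left _ hy
      · have hp : pred y ∈ F ∧ pred y < y :=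
          Nat.findGreatest_spec (P := fun x => x ∈ F ∧ x < y) hxy ⟨hx, by omega⟩
        have hxp : x ≤ pred y :=
          Nat.le_findGreatest (P := fun x => x ∈ F ∧ x < y) hxy ⟨hx, by omega⟩
        rcases lca_eq_or hxp hp.2.le (hF y hy) with h | h
        · rw [h]
          exact ih _ hp.2 x hx hp.1 hxp
        · rw [h]
          exact Finset.mem_union_right _ (Finset.mem_image_of_mem (fun y => τ.lca (pred y) y) hy)
  have hsub : Finset.range τ.size ⊆ F ∪ F.image fun y => τ.lca (pred y) y := by
    intro v hv
    obtain ⟨x, hx, y, hy, hxy, rfl⟩ := mem_closure_of_le hF (h v (Finset.mem_range.1 hv))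
    exact key y x hx hy hxy
  have h₁ := Finset.card_le_card hsub
  have h₂ := Finset.card_union_le F (F.image fun y => τ.lca (pred y) y)
  have h₃ := Finset.card_image_le (s := F) (f := fun y => τ.lca (pred y) y)
  rw [Finset.card_range] at h₁
  omega

end PreorderTree

/-! ### Lexicographic order and prefixes -/

namespace List

variable {β : Type*}

theorem not_lt_of_isPrefix [LinearOrder β] {u v : List β} (h : u <+: v) : ¬ v < u := by
  induction u generalizing v with
  | nil => simp
  | cons a u ih =>
    obtain ⟨t, rfl⟩ := h
    rw [cons_append, cons_lt_cons_iff]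
    rintro (h | ⟨-, h⟩)
    · exact lt_irrefl _ h
    · exact ih ⟨t, rfl⟩ h

/-- The words with a given prefix are convex in the lexicographic order; this makes the descendants
of a node a range of indices. -/
theorem isPrefix_of_between [LinearOrder β] {u x y z : List β} (hx : u <+: x) (hz : u <+: z)
    (hxy : ¬ y < x) (hyz : ¬ z < y) : u <+: y := by
  induction u generalizing x y z with
  | nil => exact nil_prefix
  | cons a u ih =>
    obtain ⟨s, rfl⟩ := hx
    obtain ⟨t, rfl⟩ := hz
    cases y with
    | nil => simp at hxy
    | cons b y =>
      rw [cons_append, cons_lt_cons_iff] at hxy hyz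
      simp only [not_or, not_and, _root_.not_lt] at hxy hyz
      obtain rfl : a = b := le_antisymm hxy.1 hyz.1
      rw [cons_prefix_cons]
      exact ⟨rfl, ih ⟨s, rfl⟩ ⟨t, rfl⟩ (_root_.not_lt.2 (hxy.2 rfl)) (_root_.not_lt.2 (hyz.2 rfl))⟩

/-- Two words, none of which is a prefix of the other, diverge after a common prefix. -/
theorem exists_diverge {s t : List β} (h : ¬ s <+: t) (h' : ¬ t <+: s) :
    ∃ v a b, a ≠ b ∧ v ++ [a] <+: s ∧ v ++ [b] <+: t := by
  induction s generalizing t with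
  | nil => exact (h nil_prefix).elim
  | cons x s ih =>
    cases t with
    | nil => exact (h' nil_prefix).elim
    | cons y t =>
      by_cases hxy : x = y
      · subst hxy
        rw [cons_prefix_cons] at h h'
        obtain ⟨v, a, b, hab, h₁, h₂⟩ := ih (fun e => h ⟨rfl, e⟩) (fun e => h' ⟨rfl, e⟩)
        exact ⟨x :: v, a, b, hab, by simpa using h₁, by simpa using h₂⟩
      · exact ⟨[], x, y, hxy, by simp, by simp⟩

/-- A longer common prefix would have to continue v by both a and b. This is the universal property
of the lowest common ancestor. -/
theorem isPrefix_of_diverge {s t v u : List β} {a b : β} (hab : a ≠ b) (hs : v ++ [a] <+: s)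
    (ht : v ++ [b] <+: t) : u <+: v ↔ u <+: s ∧ u <+: t := by
  constructor
  · exact fun h => ⟨(h.trans (prefix_append _ _)).trans hs, (h.trans (prefix_append _ _)).trans ht⟩
  · rintro ⟨h₁, h₂⟩
    rcases Nat.lt_or_ge v.length u.length with h | h
    · have e₁ := prefix_of_prefix_length_le hs h₁ (by simp; omega)
      have e₂ := prefix_of_prefix_length_le ht h₂ (by simp; omega)
      have := prefix_of_prefix_length_le e₁ e₂ (by simp)
      have := this.eq_of_length (by simp)
      simp at this
      exact (hab this).elim
    · exact prefix_of_prefix_length_le h₁ ((prefix_append _ _).trans hs) h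

theorem length_filter_range (p : ℕ → Prop) [DecidablePred p] (M : ℕ) :
    ((range M).filter p).length = Nat.count p M := by
  induction M with
  | zero => simp
  | succ M ih =>
    rw [range_succ, filter_append, length_append, ih, Nat.count_succ]
    simp only [filter_cons, filter_nil, decide_eq_true_eq]
    split_ifs <;> rfl

/-- The index of a node in the list of selected nodes is its rank `Nat.count p v`; all record
indices of the small trees are expressed this way. -/
theorem getElem?_filter_range (p : ℕ → Prop) [DecidablePred p] {M v : ℕ} (hv : v < M) (hp : p v) :
    ((range M).filter p)[Nat.count p v]? = some v := by
  induction M with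
  | zero => omega
  | succ M ih =>
    rw [range_succ, filter_append]
    rcases Nat.lt_succ_iff_lt_or_eq.1 hv with h | rfl
    · rw [getElem?_append_left, ih h]
      rw [length_filter_range]
      exact Nat.count_strict_mono hp h
    · rw [getElem?_append_right (by rw [length_filter_range]), length_filter_range]
      simp [hp]

end List

namespace SuffixTree

variable {α : Type*} {w : List α} {γ I : Interval} {i j : ℕ} {u v : List (WithBot α)}

/-! ### The words of suffixes -/

/-- The coercion in the definition acts on the whole list, as a `flatMap` of singletons under an
identity `map`; this is the usable form. -/
theorem suffixWord_eq (w : List α) (i : ℕ) :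
    suffixWord w i = (w.drop (i - 1)).map WithBot.some ++ [⊥] := by
  simp only [suffixWord, List.map_id', List.append_cancel_right_eq]
  exact List.flatMap_pure_eq_map _ _

theorem length_suffixWord (w : List α) (i : ℕ) :
    (suffixWord w i).length = w.length - (i - 1) + 1 := by
  simp [suffixWord_eq]

/-- Otherwise the end marker of the shorter word would face a letter of the longer one. -/
theorem eq_of_suffixWord_isPrefix (hi : 1 ≤ i) (hi' : i ≤ w.length) (hj : 1 ≤ j)
    (hj' : j ≤ w.length) (h : suffixWord w i <+: suffixWord w j) : i = j := by
  have hle := h.length_le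
  rw [length_suffixWord, length_suffixWord] at hle
  have e₁ : (suffixWord w i)[w.length - (i - 1)]? = some ⊥ := by
    simp [suffixWord_eq]
  obtain ⟨t, ht⟩ := h
  have e₂ : (suffixWord w j)[w.length - (i - 1)]? = some ⊥ := by
    rw [← ht, List.getElem?_append_left (by rw [length_suffixWord]; omega), e₁]
  by_contra hne
  have hlt : w.length - (i - 1) < w.length - (j - 1) := by omega
  rw [suffixWord_eq, List.getElem?_append_left (by simpa using hlt), List.getElem?_map] at e₂
  simp only [Option.map_eq_some_iff] at e₂
  obtain ⟨a, -, ha⟩ := e₂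
  exact WithBot.coe_ne_bot ha

theorem suffixWord_ne_nil (w : List α) (i : ℕ) : suffixWord w i ≠ [] := by simp [suffixWord_eq]

theorem Interval.Contains.mono (h : I.Contains i) (hI : I.IsWithin γ) : γ.Contains i :=
  ⟨hI.1.trans h.1, h.2.trans hI.2.2⟩

theorem IsExplicit.mono (h : IsExplicit w I v) (hI : I.IsWithin γ) : IsExplicit w γ v := by
  rcases h with h | ⟨i, h⟩ | ⟨a, b, hab, ⟨i, hi, h⟩, j, hj, h'⟩
  · exact .inl h
  · exact .inr (.inl ⟨i, h.1.mono hI, h.2⟩)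
  · exact .inr (.inr ⟨a, b, hab, ⟨i, hi.mono hI, h⟩, j, hj.mono hI, h'⟩)

/-- A leaf of the larger tree that is an explicit node of the smaller tree is a leaf of it. -/
theorem isLeaf_of_isExplicit (hγ : γ.IsWithin ⟨1, w.length⟩) (hI : I.IsWithin γ)
    (h : IsExplicit w I v) (hv : IsLeaf w γ v i) : IsLeaf w I v i := by
  have key : ∀ j, I.Contains j → v <+: suffixWord w j → I.Contains i ∧ i = j := by
    intro j hj hp
    have h₁ := hv.1.mono hγ
    have h₂ := (hj.mono hI).mono hγ
    have := eq_of_suffixWord_isPrefix h₁.1 h₁.2 h₂.1 h₂.2 (hv.2 ▸ hp)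
    exact ⟨this ▸ hj, this⟩
  rcases h with h | ⟨j, h⟩ | ⟨a, b, hab, ⟨j, hj, h⟩, -⟩
  · exact (suffixWord_ne_nil w i (hv.2.symm.trans h)).elim
  · exact ⟨(key j h.1 (h.2 ▸ List.prefix_rfl)).1, hv.2⟩
  · obtain ⟨h₁, rfl⟩ := key j hj ((List.prefix_append _ _).trans h)
    have := h.length_le
    rw [← hv.2] at this
    simp at this

/-! ### The explicit nodes in preorder -/

/-- `nd` lists the explicit nodes of `T(γ)` in lexicographic order, and `par` maps the index of a
node to that of its parent. -/
structure IsListing [LinearOrder α] (w : List α) (γ : Interval) (M : ℕ)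
    (nd : ℕ → List (WithBot α)) (par : ℕ → ℕ) : Prop where
  lt : ∀ i j, i < j → j < M → nd i < nd j
  explicit : ∀ v, IsExplicit w γ v ↔ ∃ k < M, nd k = v
  par_lt : ∀ k < M, par k < M
  isParent : ∀ k < M, IsParent w γ (nd (par k)) (nd k)

namespace IsListing

/-- The indices of the root and of the leaves of the smaller tree. -/
def seeds (w : List α) (I : Interval) (M : ℕ) (nd : ℕ → List (WithBot α)) : Set ℕ :=
  {k | k < M ∧ (k = 0 ∨ ∃ i, IsLeaf w I (nd k) i)}

theorem lt_of_mem_seeds {M : ℕ} {nd : ℕ → List (WithBot α)} : ∀ k ∈ seeds w I M nd, k < M :=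
  fun _ h => h.1

variable [LinearOrder α] {M : ℕ} {nd : ℕ → List (WithBot α)} {par : ℕ → ℕ}

theorem inj (h : IsListing w γ M nd par) (hi : i < M) (hj : j < M) (e : nd i = nd j) : i = j := by
  rcases lt_trichotomy i j with h' | h' | h'
  · exact (lt_irrefl (nd j) (e ▸ h.lt i j h' hj)).elim
  · exact h'
  · exact (lt_irrefl (nd j) (e ▸ h.lt j i h' hi)).elim

theorem le_of_isPrefix (h : IsListing w γ M nd par) (hi : i < M) (e : nd i <+: nd j) : i ≤ j := by
  by_contra! hlt
  exact List.not_lt_of_isPrefix e (h.lt j i hlt hi)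

theorem not_lt_of_le (h : IsListing w γ M nd par) (hj : j < M) (hij : i ≤ j) : ¬ nd j < nd i := by
  rcases hij.eq_or_lt with rfl | hlt
  · exact lt_irrefl _
  · exact _root_.lt_asymm (h.lt i j hlt hj)

theorem isPrefix_of_between (h : IsListing w γ M nd par) {k : ℕ} (hk : k < M) (e : nd i <+: nd k)
    (hij : i ≤ j) (hjk : j ≤ k) : nd i <+: nd j :=
  List.isPrefix_of_between List.prefix_rfl e (h.not_lt_of_le (by omega) hij)
    (h.not_lt_of_le hk hjk)

theorem size_pos (h : IsListing w γ M nd par) : 0 < M := by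
  obtain ⟨k, hk, -⟩ := (h.explicit []).1 (.inl rfl)
  omega

theorem nd_zero (h : IsListing w γ M nd par) : nd 0 = [] := by
  obtain ⟨k, hk, e⟩ := (h.explicit []).1 (.inl rfl)
  have := h.le_of_isPrefix hk (j := 0) (e ▸ List.nil_prefix)
  rwa [Nat.le_zero.1 this] at e

open Classical in
/-- The last descendant of a node. -/
def lastOf (M : ℕ) (nd : ℕ → List (WithBot α)) (v : ℕ) : ℕ :=
  if v < M then Nat.findGreatest (fun k => nd v <+: nd k) (M - 1) else v

theorem isPrefix_iff (h : IsListing w γ M nd par) (hi : i < M) (hj : j < M) :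
    nd i <+: nd j ↔ i ≤ j ∧ j ≤ lastOf M nd i := by
  classical
  rw [lastOf, if_pos hi]
  constructor
  · exact fun e => ⟨h.le_of_isPrefix hi e,
      Nat.le_findGreatest (P := fun k => nd i <+: nd k) (by omega) e⟩
  · rintro ⟨h₁, h₂⟩
    refine h.isPrefix_of_between (k := Nat.findGreatest (fun k => nd i <+: nd k) (M - 1)) ?_ ?_ h₁ h₂
    · have := Nat.findGreatest_le (P := fun k => nd i <+: nd k) (M - 1)
      omega
    · exact Nat.findGreatest_spec (P := fun k => nd i <+: nd k) (show i ≤ M - 1 by omega)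
        List.prefix_rfl

theorem lastOf_lt (hi : i < M) : lastOf M nd i < M := by
  classical
  rw [lastOf, if_pos hi]
  have := Nat.findGreatest_le (P := fun k => nd i <+: nd k) (M - 1)
  omega

theorem le_lastOf (h : IsListing w γ M nd par) (i : ℕ) : i ≤ lastOf M nd i := by
  by_cases hi : i < M
  · exact ((h.isPrefix_iff hi hi).1 List.prefix_rfl).2
  · rw [lastOf, if_neg hi]

theorem par_eq_zero (h : IsListing w γ M nd par) : par 0 = 0 := by
  have h₀ := h.size_pos
  refine h.inj (h.par_lt 0 h₀) h₀ ?_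
  rcases h.isParent 0 h₀ with ⟨-, e⟩ | ⟨-, e, hne, -⟩
  · rw [e, h.nd_zero]
  · rw [h.nd_zero] at e hne
    exact (hne (List.prefix_nil.1 e)).elim

theorem isParent' (h : IsListing w γ M nd par) (hi : i < M) (h0 : 0 < i) :
    IsExplicit w γ (nd (par i)) ∧ nd (par i) <+: nd i ∧ nd (par i) ≠ nd i ∧
      ∀ u', IsExplicit w γ u' → u' <+: nd i → u' ≠ nd i → u' <+: nd (par i) := by
  rcases h.isParent i hi with ⟨e, -⟩ | h'
  · have := h.inj hi h.size_pos (e.trans h.nd_zero.symm)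
    omega
  · exact h'

/-- The induced suffix tree as a tree in preorder. -/
def tree (h : IsListing w γ M nd par) : PreorderTree where
  size := M
  last := lastOf M nd
  par := par
  size_pos := h.size_pos
  le_last := h.le_lastOf
  last_lt _ := lastOf_lt
  last_zero := by
    have h₀ := h.size_pos
    have h₁ : M - 1 < M := by omega
    have := ((h.isPrefix_iff h₀ h₁).1 (by rw [h.nd_zero]; exact List.nil_prefix)).2
    have := lastOf_lt (nd := nd) h₀
    omega
  nested u v huv hv := by
    by_cases hu : u < M
    · have hl := lastOf_lt (nd := nd) hu
      have hv' : v < M := by omega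
      have hl' := lastOf_lt (nd := nd) hv'
      have h₁ := (h.isPrefix_iff hu hv').2 ⟨huv, hv⟩
      have h₂ := (h.isPrefix_iff hv' hl').2 ⟨h.le_lastOf v, le_rfl⟩
      exact ((h.isPrefix_iff hu hl').1 (h₁.trans h₂)).2
    -- Outside the tree a node counts as its own last descendant, so the axioms without a range
    -- condition still hold.
    · rw [lastOf, if_neg hu] at hv
      rw [le_antisymm huv hv]
  par_zero := h.par_eq_zero
  par_lt v hv h0 := by
    obtain ⟨-, h₁, h₂, -⟩ := h.isParent' hv h0
    have h₃ := h.le_of_isPrefix (h.par_lt v hv) h₁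
    exact lt_of_le_of_ne h₃ fun e => h₂ (congrArg nd e)
  le_last_par v hv := by
    rcases Nat.eq_zero_or_pos v with rfl | h0
    · exact Nat.zero_le _
    · exact ((h.isPrefix_iff (h.par_lt v hv) hv).1 (h.isParent' hv h0).2.1).2
  le_par u v hv huv hul := by
    have hu : u < M := huv.trans hv
    have h₁ := (h.isPrefix_iff hu hv).2 ⟨huv.le, hul⟩
    have h₂ := (h.isParent' hv (by omega)).2.2.2 (nd u) ((h.explicit _).2 ⟨u, hu, rfl⟩) h₁
      fun e => by have := h.inj hu hv e; omega
    exact h.le_of_isPrefix hu h₂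

@[simp] theorem tree_size (h : IsListing w γ M nd par) : h.tree.size = M := rfl

theorem anc_iff (h : IsListing w γ M nd par) (hi : i < M) (hj : j < M) :
    h.tree.Anc i j ↔ nd i <+: nd j := (h.isPrefix_iff hi hj).symm

theorem exists_leaf (h : IsListing w γ M nd par) (hi : γ.Contains i) :
    ∃ k < M, nd k = suffixWord w i := (h.explicit _).1 (.inr (.inl ⟨i, hi, rfl⟩))

/-- A branching node is where two leaves diverge, which is their lowest common ancestor; conversely
two distinct leaves do diverge, and the node where they do so is explicit in both trees. The root is
a seed because it is explicit even if it does not branch; it adds no other node. -/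
theorem explicit_iff (h : IsListing w γ M nd par) (hγ : γ.IsWithin ⟨1, w.length⟩)
    (hI : I.IsWithin γ) {k : ℕ} (hk : k < M) :
    IsExplicit w I (nd k) ↔ k ∈ h.tree.closure (seeds w I M nd) := by
  have hlt := lt_of_mem_seeds (w := w) (I := I) (M := M) (nd := nd)
  have hlca : ∀ {x y k : ℕ} {v : List (WithBot α)} {a b : WithBot α}, x < M → y < M → k < M →
      a ≠ b → v ++ [a] <+: nd x → v ++ [b] <+: nd y → nd k = v → k = h.tree.lca x y := by
    intro x y k v a b hx hy hk hab h₁ h₂ hv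
    refine PreorderTree.eq_lca hx hy fun u => ?_
    have hu : h.tree.Anc u k ∨ (h.tree.Anc u x ∧ h.tree.Anc u y) → u < M := by
      rintro (h' | h')
      · exact h'.lt hk
      · exact h'.1.lt hx
    constructor
    · intro h'
      have hu := hu (.inl h')
      rw [h.anc_iff hu hk, hv, List.isPrefix_of_diverge hab h₁ h₂] at h'
      rwa [h.anc_iff hu hx, h.anc_iff hu hy]
    · intro h'
      have hu := hu (.inr h')
      rw [h.anc_iff hu hx, h.anc_iff hu hy, ← List.isPrefix_of_diverge hab h₁ h₂] at h'
      rwa [h.anc_iff hu hk, hv]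
  constructor
  · rintro (e | e | ⟨a, b, hab, ⟨i, hi, h₁⟩, j, hj, h₂⟩)
    · have : k = 0 := h.inj hk h.size_pos (e.trans h.nd_zero.symm)
      exact PreorderTree.subset_closure hlt ⟨hk, .inl this⟩
    · exact PreorderTree.subset_closure hlt ⟨hk, .inr e⟩
    · obtain ⟨x, hx, ex⟩ := h.exists_leaf (hi.mono hI)
      obtain ⟨y, hy, ey⟩ := h.exists_leaf (hj.mono hI)
      exact ⟨x, ⟨hx, .inr ⟨i, hi, ex⟩⟩, y, ⟨hy, .inr ⟨j, hj, ey⟩⟩,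
        hlca hx hy hk hab (ex ▸ h₁) (ey ▸ h₂) rfl⟩
  · have hseed : ∀ k ∈ seeds w I M nd, IsExplicit w I (nd k) := by
      rintro k ⟨-, rfl | e⟩
      · exact .inl h.nd_zero
      · exact .inr (.inl e)
    rintro ⟨x, hx, y, hy, rfl⟩
    rcases hx.2 with rfl | ⟨i, hi, ex⟩
    · rw [PreorderTree.lca_zero_left hy.1]
      exact hseed _ hx
    rcases hy.2 with rfl | ⟨j, hj, ey⟩
    · rw [PreorderTree.lca_zero_right hx.1]
      exact hseed _ hy
    by_cases hij : i = j
    · rw [h.inj hx.1 hy.1 (ex.trans (hij ▸ ey.symm)), PreorderTree.lca_self hy.1]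
      exact hseed _ hy
    · have hi' := (hi.mono hI).mono hγ
      have hj' := (hj.mono hI).mono hγ
      obtain ⟨v, a, b, hab, h₁, h₂⟩ := List.exists_diverge
        (fun e => hij (eq_of_suffixWord_isPrefix hi'.1 hi'.2 hj'.1 hj'.2 e))
        (fun e => hij (eq_of_suffixWord_isPrefix hj'.1 hj'.2 hi'.1 hi'.2 e).symm)
      have hv : IsExplicit w I v := .inr (.inr ⟨a, b, hab, ⟨i, hi, h₁⟩, j, hj, h₂⟩)
      obtain ⟨k, hk, rfl⟩ := (h.explicit _).1 (hv.mono hI)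
      rwa [← hlca hx.1 hy.1 hk hab (ex ▸ h₁) (ey ▸ h₂) rfl]

open Classical in
/-- A criterion for the representation of an induced suffix tree in terms of a larger one. -/
theorem represents (h : IsListing w γ M nd par) (hγ : γ.IsWithin ⟨1, w.length⟩)
    (hI : I.IsWithin γ) {ann : ℕ → ℕ}
    (hann : ∀ k < M, (∀ i, IsLeaf w γ (nd k) i → ann k = i) ∧
      ((¬ ∃ i, IsLeaf w γ (nd k) i) → ann k = 0))
    {mem : ℕ → ℕ} {base : ℕ} {S : ℕ → Prop} (hS : S = (· ∈ h.tree.closure (seeds w I M nd)))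
    (hlen : mem base = Nat.count S M)
    (hrec : ∀ v, S v → (v = 0 → mem (base + 4 * Nat.count S v + 1) = 0) ∧
      (0 < v → ∃ p, S p ∧ p < v ∧ (∀ u, S u → u < v → u ≤ p) ∧
        mem (base + 4 * Nat.count S v + 1) = Nat.count S (h.tree.lca p v)) ∧
      mem (base + 4 * Nat.count S v + 2) = (nd v).length ∧
      (I.Contains (mem (base + 4 * Nat.count S v + 3)) ∧
        nd v <+: suffixWord w (mem (base + 4 * Nat.count S v + 3))) ∧
      mem (base + 4 * Nat.count S v + 4) = ann v) :
    Represents mem base w I := by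
  have hlt := lt_of_mem_seeds (w := w) (I := I) (M := M) (nd := nd)
  have hSlt : ∀ {v}, S v → v < M := fun {v} hv => by
    rw [hS] at hv
    exact PreorderTree.closure_lt (τ := h.tree) hlt hv
  have hSe : ∀ v, v < M → (S v ↔ IsExplicit w I (nd v)) := fun v hv => by
    rw [h.explicit_iff hγ hI hv, hS]
  have hS0 : S 0 := (hSe 0 h.size_pos).2 (.inl h.nd_zero)
  have hget : ∀ v, S v → (((List.range M).filter S).map nd)[Nat.count S v]? = some (nd v) := by
    intro v hv
    rw [List.getElem?_map, List.getElem?_filter_range S (hSlt hv) hv]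
    rfl
  refine ⟨((List.range M).filter S).map nd, ?_, ?_, ?_, ?_⟩
  · rw [List.pairwise_map]
    refine List.Pairwise.imp_of_mem ?_ (List.Pairwise.filter _ List.pairwise_lt_range)
    intro a b ha hb hab
    exact h.lt a b hab (List.mem_range.1 (List.mem_filter.1 hb).1)
  · intro v
    simp only [List.mem_map, List.mem_filter, List.mem_range, decide_eq_true_eq]
    constructor
    · rintro ⟨k, ⟨hk, hk'⟩, rfl⟩
      exact (hSe k hk).1 hk'
    · intro hv
      obtain ⟨k, hk, rfl⟩ := (h.explicit v).1 (hv.mono hI)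
      exact ⟨k, ⟨hk, (hSe k hk).2 hv⟩, rfl⟩
  · rw [hlen, List.length_map, List.length_filter_range]
  · intro k x hx
    obtain ⟨v, hv, hk, rfl⟩ : ∃ v, S v ∧ k = Nat.count S v ∧ x = nd v := by
      rw [List.getElem?_map, Option.map_eq_some_iff] at hx
      obtain ⟨v, hv, rfl⟩ := hx
      have hv' : S v := by simpa using (List.mem_filter.1 (List.mem_of_getElem? hv)).2
      refine ⟨v, hv', ?_, rfl⟩
      have h₁ := List.getElem?_filter_range S (hSlt hv') hv'
      exact (List.getElem?_inj (List.getElem?_eq_some_iff.1 hv).1 (List.nodup_range.filter _)).1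
        (hv.trans h₁.symm)
    have hvM := hSlt hv
    have hve := (hSe v hvM).1 hv
    obtain ⟨h₁, h₂, h₃, h₄, h₅⟩ := hrec v hv
    rw [hk]
    refine ⟨?_, h₃, h₄, fun i hi => ?_, fun hi => ?_⟩
    · rcases Nat.eq_zero_or_pos v with rfl | h0
      · refine ⟨nd 0, ?_, .inl ⟨h.nd_zero, h.nd_zero⟩⟩
        rw [h₁ rfl]
        simpa using hget 0 hS0
      -- The parent is lca(p, v): another proper ancestor of v in the small tree is at most p, so by
      -- convexity it is an ancestor of p as well.
      · obtain ⟨p, hp, hpv, hmax, e⟩ := h₂ h0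
        have hpM := hSlt hp
        have hm : S (h.tree.lca p v) := by
          rw [hS] at hp hv ⊢
          exact PreorderTree.lca_mem_closure hlt hp hv
        have hmM := hSlt hm
        have ha := PreorderTree.lca_anc_right (τ := h.tree) hpM hvM
        have hmp := (PreorderTree.lca_anc_left (τ := h.tree) hpM hvM).1
        refine ⟨_, by rw [e]; exact hget _ hm, .inr ⟨(hSe _ hmM).1 hm, (h.anc_iff hmM hvM).1 ha,
          fun e => ?_, fun u hu hpre hne => ?_⟩⟩
        · have := h.inj hmM hvM e
          omega
        · obtain ⟨k, hk, rfl⟩ := (h.explicit u).1 (hu.mono hI)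
          have hkv := (h.anc_iff hk hvM).2 hpre
          have hkp := hmax k ((hSe k hk).2 hu) (lt_of_le_of_ne hkv.1 fun e => hne (e ▸ rfl))
          refine (h.anc_iff hk hmM).1 ((PreorderTree.anc_lca_iff (τ := h.tree) hpM hvM).2 ⟨?_, hkv⟩)
          exact hkv.convex hkp hpv.le
    · rw [h₅]
      exact (hann v hvM).1 i ⟨hi.1.mono hI, hi.2⟩
    · rw [h₅]
      refine (hann v hvM).2 fun ⟨i, hi'⟩ => hi ⟨i, isLeaf_of_isExplicit hγ hI hve hi'⟩

/-- The size of the tree is linear in the length of the interval. -/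
theorem size_le (h : IsListing w γ M nd par) (hγ : γ.IsWithin ⟨1, w.length⟩) :
    M ≤ 2 * (γ.length + 1) := by
  classical
  have hle := hγ.2.1
  choose! f hf using fun i (hi : γ.Contains i) => h.exists_leaf hi
  set F := insert 0 ((Finset.Icc γ.lo γ.hi).image f)
  have hF : ∀ x ∈ F, x < h.tree.size := by
    intro x hx
    rcases Finset.mem_insert.1 hx with rfl | hx
    · exact h.size_pos
    · obtain ⟨i, hi, rfl⟩ := Finset.mem_image.1 hx
      exact (hf i (Finset.mem_Icc.1 hi)).1
  have hsub : seeds w γ M nd ⊆ (F : Set ℕ) := by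
    rintro k ⟨hk, rfl | ⟨i, hi, e⟩⟩
    · exact Finset.mem_insert_self _ _
    · refine Finset.mem_insert_of_mem (Finset.mem_image.2 ⟨i, Finset.mem_Icc.2 hi, ?_⟩)
      exact h.inj (hf i hi).1 hk ((hf i hi).2.trans e.symm)
  have h₁ := PreorderTree.card_le_of_closure hF fun v hv => by
    obtain ⟨x, hx, y, hy, e⟩ := (h.explicit_iff hγ ⟨le_rfl, hle, le_rfl⟩ hv).1
      ((h.explicit _).2 ⟨v, hv, rfl⟩)
    exact ⟨x, hsub hx, y, hsub hy, e⟩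
  have h₂ := Finset.card_insert_le 0 ((Finset.Icc γ.lo γ.hi).image f)
  have h₃ := Finset.card_image_le (s := Finset.Icc γ.lo γ.hi) (f := f)
  rw [Nat.card_Icc] at h₃
  change F.card ≤ _ at h₂
  rw [tree_size] at h₁
  unfold Interval.length
  omega

end IsListing

/-- The data of a represented induced suffix tree. -/
theorem Represents.exists_listing [LinearOrder α] {mem : ℕ → ℕ} {base : ℕ}
    (h : Represents mem base w γ) :
    ∃ nd : ℕ → List (WithBot α), IsListing w γ (mem base) nd (fun k => mem (base + 4 * k + 1)) ∧
      (∀ k < mem base, mem (base + 4 * k + 2) = (nd k).length) ∧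
      ∀ k < mem base, (∀ i, IsLeaf w γ (nd k) i → mem (base + 4 * k + 4) = i) ∧
        ((¬ ∃ i, IsLeaf w γ (nd k) i) → mem (base + 4 * k + 4) = 0) := by
  obtain ⟨nodes, hsort, hmem, hlen, hrec⟩ := h
  have hget : ∀ k < mem base, nodes[k]? = some (nodes.getD k []) := fun k hk => by
    rw [List.getD_eq_getElem?_getD, List.getElem?_eq_getElem (by omega)]
    rfl
  refine ⟨fun k => nodes.getD k [], ⟨?_, ?_, ?_, ?_⟩, ?_, ?_⟩
  · intro i j hij hj
    have := List.pairwise_iff_getElem.1 hsort i j (by omega) (by omega) hij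
    simpa [List.getD_eq_getElem?_getD, show i < nodes.length by omega, show j < nodes.length by omega]
      using this
  · intro v
    rw [← hmem, List.mem_iff_getElem?]
    constructor
    · rintro ⟨k, hk⟩
      have hk' : k < mem base := by
        rw [hlen]; exact (List.getElem?_eq_some_iff.1 hk).1
      exact ⟨k, hk', Option.some_injective _ ((hget k hk').symm.trans hk)⟩
    · rintro ⟨k, hk, rfl⟩
      exact ⟨k, hget k hk⟩
  · intro k hk
    obtain ⟨⟨u, hu, -⟩, -⟩ := hrec k _ (hget k hk)
    rw [hlen]
    exact (List.getElem?_eq_some_iff.1 hu).1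
  · intro k hk
    obtain ⟨⟨u, hu, h⟩, -⟩ := hrec k _ (hget k hk)
    rw [List.getD_eq_getElem?_getD, hu]
    exact h
  · exact fun k hk => (hrec k _ (hget k hk)).2.1
  · exact fun k hk => (hrec k _ (hget k hk)).2.2.2

end SuffixTree

namespace SuffixTree

open WordRAM WordRAM.Prog WordRAM.Expr

/-! ### The program

Variables: `1` is the number of intervals, `2` the number of nodes, `3` the address of the given
tree, `4` and `5` are counters.

Arrays: `0` is the input; `1` and `2` contain the highest and the lowest bits of numbers; `3` the
last descendants of the nodes, `4` their inlabel numbers, `5` the heads of inlabel numbers, `6` the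
masks of the nodes. -/

/-- The field `f` of the record of the node `v` of the given tree. -/
def field (v : Expr) (f : ℕ) : Expr := get 0 (const 0) (var 3 + const 4 * v + const f)

/-- The element `i` of a one-dimensional array. -/
def arr (r : ℕ) (i : Expr) : Expr := get r (const 0) i

/-- Sets the variable `t` to the lowest ancestor of `x` of the height given by the variable `13`. -/
def climbProg (x t : ℕ) : Prog :=
  .seq (assign 14 (arr 6 (var x) % var 13))
  (.ite .eq (var 14) (const 0) (assign t (var x))
    (.seq (assign 15 (const 2 * arr 1 (var 14)))
      (assign t (field (arr 5 (arr 4 (var x) / var 15 * var 15 + arr 1 (var 14))) 1))))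

/-- Sets the variable `12` to the lowest common ancestor of the variables `10` and `11`. -/
def lcaProg : Prog :=
  .seq (assign 13 (bin .and (arr 6 (var 10)) (arr 6 (var 11))))
  (.seq (assign 13 (arr 2 (var 13 -
    var 13 % arr 1 (bin .xor (arr 4 (var 10)) (arr 4 (var 11))))))
  (.seq (climbProg 10 16)
  (.seq (climbProg 11 17)
  (.ite .lt (var 16) (var 17) (assign 12 (var 16)) (assign 12 (var 17))))))

/-- The arrays contain what is needed for computing lowest common ancestors. -/
structure LcaReady (τ : PreorderTree) (S base : ℕ) (a : ℕ → ℕ → ℕ → ℕ) : Prop where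
  size : base + 4 * τ.size + 20 < S
  par : ∀ v < τ.size, a 0 0 (base + 4 * v + 1) = τ.par v
  high : ∀ x < 2 * τ.size + 1, a 1 0 x = highBit x
  low : ∀ x < 2 * τ.size + 1, 0 < x → IsLowBit x (a 2 0 x)
  inlabel : ∀ v < τ.size, a 4 0 v = τ.inlabel v
  head : τ.IsHead (a 5 0)
  mask : ∀ v < τ.size, τ.IsMask v (a 6 0 v)

theorem LcaReady.congr {τ : PreorderTree} {S base : ℕ} {a a' : ℕ → ℕ → ℕ → ℕ}
    (h : LcaReady τ S base a) (ha : ∀ r ≤ 6, a' r = a r) : LcaReady τ S base a' where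
  size := h.size
  par := by rw [ha 0 (by norm_num)]; exact h.par
  high := by rw [ha 1 (by norm_num)]; exact h.high
  low := by rw [ha 2 (by norm_num)]; exact h.low
  inlabel := by rw [ha 4 (by norm_num)]; exact h.inlabel
  head := by rw [ha 5 (by norm_num)]; exact h.head
  mask := by rw [ha 6 (by norm_num)]; exact h.mask

variable {W S : ℕ} {τ : PreorderTree} {base v : ℕ}

theorem le_of_bound (hW : 32 * (S * S) ≤ W) : 32 * S ≤ W := by
  have := Nat.le_mul_self S
  omega

theorem inlabel_le_size (hv : v < τ.size) : τ.inlabel v ≤ τ.size := by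
  have h₁ := (PreorderTree.inlabel_bounds (τ := τ) v).2
  have h₂ := τ.last_lt v hv
  omega

theorem wp_climbProg (hW : 32 * (S * S) ≤ W) {σ : Store} (h : LcaReady τ S base σ.a) {x t v k : ℕ}
    (hv : v < τ.size) (hx : σ.v x = v) (hx' : x < 13) (hb : σ.v 3 = base) (hk : σ.v 13 = 2 ^ k)
    {Q : Store → Prop} (hQ : ∀ σ', σ'.a = σ.a → σ'.v t = τ.climb (σ.a 5 0) (σ.a 6 0 v) (2 ^ k) v →
      (∀ i, i ≠ 14 → i ≠ 15 → i ≠ t → σ'.v i = σ.v i) → Q σ') :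
    wp W S (climbProg x t) Q σ := by
  have hS := le_of_bound hW
  have hs := h.size
  have hA := (h.mask v hv).lt hv
  have hx14 : x ≠ 14 := by omega
  have hx15 : x ≠ 15 := by omega
  have hhead := PreorderTree.head_lt (k := k) h.head hv (h.mask v hv)
  have hB : σ.a 6 0 v % 2 ^ k ≤ σ.a 6 0 v := Nat.mod_le _ _
  simp only [PreorderTree.climb] at hQ
  simp [wp, climbProg, arr, field, hx, hb, hk, Cmp.Holds, hx14, hx15, h.inlabel v hv]
  generalize hBe : σ.a 6 0 v % 2 ^ k = B at *
  rw [h.high B (by omega)]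
  refine ⟨by omega, by omega, by omega, fun h0 => ⟨by omega, hQ _ rfl ?_ ?_⟩, fun h0 => ?_⟩
  · simp [h0]
  · intro i h₁ h₂ h₃
    simp [h₁, h₃]
  have hH := highBit_le h0
  have hI := inlabel_le_size hv
  have h₁ : τ.inlabel v / (2 * highBit B) * (2 * highBit B) ≤ τ.inlabel v := Nat.div_mul_le_self _ _
  have h₂ : τ.inlabel v / (2 * highBit B) ≤ τ.inlabel v := Nat.div_le_self _ _
  have hhead := hhead h0
  have hpar := h.par _ hhead
  have hpar' := PreorderTree.par_lt_size hhead
  rw [if_neg h0] at hQ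
  generalize τ.inlabel v / (2 * highBit B) * (2 * highBit B) = q at *
  generalize σ.a 5 0 (q + highBit B) = u at *
  rw [hpar]
  refine ⟨by omega, by omega, ⟨by omega, by omega⟩, by omega, hQ _ rfl (by simp) ?_⟩
  intro i h₁ h₂ h₃
  simp [h₁, h₂, h₃]

theorem wp_lcaProg (hW : 32 * (S * S) ≤ W) {σ : Store} (h : LcaReady τ S base σ.a) {x y : ℕ}
    (hx : x < τ.size) (hy : y < τ.size) (hx' : σ.v 10 = x) (hy' : σ.v 11 = y) (hb : σ.v 3 = base)
    {Q : Store → Prop} (hQ : ∀ σ', σ'.a = σ.a → σ'.v 12 = τ.lca x y → 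
      (∀ i < 12, σ'.v i = σ.v i) → (∀ i ≥ 20, σ'.v i = σ.v i) → Q σ') :
    wp W S lcaProg Q σ := by
  have hS := le_of_bound hW
  have hs := h.size
  have hAx := (h.mask x hx).lt hx
  have hIx := inlabel_le_size hx
  have hIy := inlabel_le_size hy
  have hX := xor_lt_two_mul hIx hIy τ.size_pos
  have hlt := Nat.and_le_left (n := σ.a 6 0 x) (m := σ.a 6 0 y)
  have hle := Nat.sub_le (σ.a 6 0 x &&& σ.a 6 0 y)
    ((σ.a 6 0 x &&& σ.a 6 0 y) % highBit (τ.inlabel x ^^^ τ.inlabel y))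
  have hne := PreorderTree.common_ne_zero hx hy (h.mask x hx) (h.mask y hy)
  have hlow := h.low _ (by omega) (Nat.pos_of_ne_zero hne)
  have hlow' := hlow.le
  have hlca := PreorderTree.min_climb_eq_lca h.head hx hy (h.mask x hx) (h.mask y hy) hlow
  have hmod : (σ.a 6 0 x &&& σ.a 6 0 y) % highBit (τ.inlabel x ^^^ τ.inlabel y) ≤
    σ.a 6 0 x &&& σ.a 6 0 y := Nat.mod_le _ _
  obtain ⟨j, hj, -⟩ := hlow
  simp [wp, lcaProg, arr, hx', hy', h.inlabel x hx, h.inlabel y hy, h.high _ hX]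
  refine ⟨by omega, by omega, by omega, by omega, ?_⟩
  refine wp_climbProg hW (by exact h) hx (by simpa) (by norm_num) (by simpa) (by simpa using hj)
    fun σ₁ ha₁ hv₁ hf₁ => ?_
  rw [Store.set_a, Store.set_a] at ha₁ hv₁
  refine wp_climbProg hW (by rw [ha₁]; exact h) hy (by rw [hf₁]; simpa; all_goals norm_num)
    (by norm_num) (by rw [hf₁]; simpa; all_goals norm_num)
    (by rw [hf₁]; simpa using hj; all_goals norm_num) fun σ₂ ha₂ hv₂ hf₂ => ?_
  rw [ha₁] at ha₂ hv₂
  rw [← hj] at hv₁ hv₂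
  rw [← hv₁, ← hv₂, ← hf₂ 16 (by norm_num) (by norm_num) (by norm_num)] at hlca
  have hz := PreorderTree.lca_lt hx hy
  have hrest : ∀ i, i < 12 ∨ 20 ≤ i → σ₂.v i = σ.v i := by
    intro i hi
    rw [hf₂ _ (by omega) (by omega) (by omega), hf₁ _ (by omega) (by omega) (by omega)]
    simp [show i ≠ 13 by omega]
  simp only [Cmp.Holds]
  refine ⟨fun hlt => ⟨?_, hQ _ ha₂ ?_ ?_ ?_⟩, fun hlt => ⟨?_, hQ _ ha₂ ?_ ?_ ?_⟩⟩
  · omega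
  · simp; omega
  · intro i hi
    simp [hrest i (.inl hi), show i ≠ 12 by omega]
  · intro i hi
    simp [hrest i (.inr hi), show i ≠ 12 by omega]
  · omega
  · simp; omega
  · intro i hi
    simp [hrest i (.inl hi), show i ≠ 12 by omega]
  · intro i hi
    simp [hrest i (.inr hi), show i ≠ 12 by omega]

end SuffixTree

/-! ### Frame conditions and simple loops -/

namespace WordRAM

/-- The stores agree except for the arrays of `rs` and the variables of `xs`. -/
structure Store.Agree (rs xs : List ℕ) (σ σ' : Store) : Prop where
  a : ∀ r, r ∉ rs → σ'.a r = σ.a r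
  v : ∀ x, x ∉ xs → σ'.v x = σ.v x

namespace Store.Agree

variable {rs xs rs' xs' : List ℕ} {σ σ' σ'' : Store}

theorem refl (rs xs : List ℕ) (σ : Store) : Agree rs xs σ σ := ⟨fun _ _ => rfl, fun _ _ => rfl⟩

theorem put (h : Agree rs xs σ σ') {r : ℕ} (hr : r ∈ rs) (i j k : ℕ) :
    Agree rs xs σ (σ'.put r i j k) where
  a r' hr' := by
    rw [← h.a r' hr']
    funext i' j'
    rw [put_a, if_neg]
    rintro ⟨rfl, -⟩
    exact hr' hr
  v := h.v

theorem set (h : Agree rs xs σ σ') {x : ℕ} (hx : x ∈ xs) (k : ℕ) : Agree rs xs σ (σ'.set x k) where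
  a := h.a
  v x' hx' := by
    rw [set_v, if_neg, h.v x' hx']
    rintro rfl
    exact hx' hx

theorem trans {rs'' xs'' : List ℕ} (h : Agree rs xs σ σ') (h' : Agree rs' xs' σ' σ'')
    (h₁ : rs ⊆ rs'') (h₂ : rs' ⊆ rs'') (h₃ : xs ⊆ xs'') (h₄ : xs' ⊆ xs'') :
    Agree rs'' xs'' σ σ'' where
  a r hr' := by rw [h'.a r fun e => hr' (h₂ e), h.a r fun e => hr' (h₁ e)]
  v x hx' := by rw [h'.v x fun e => hx' (h₄ e), h.v x fun e => hx' (h₃ e)]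

end Store.Agree

/-- A loop with a constant bound for the time of its body. -/
theorem Prog.Tri.upTo_const {W S : ℕ} (hW : 32 * (S * S) ≤ W) {x : ℕ} {b : Expr} {p : Prog}
    {Q : Store → Prop} {N i₀ T : ℕ} (Inv : ℕ → Store → Prop) {σ : Store} (h0 : Inv 0 σ)
    (hx : σ.v x = i₀) (hN : i₀ + N + 1 < W)
    (hb : ∀ i ≤ N, ∀ σ, Inv i σ → b.Ok W S σ ∧ b.eval S σ = i₀ + N)
    (hstep : ∀ i < N, ∀ σ, σ.v x = i₀ + i → Inv i σ →
      Tri W S p σ T fun σ' => σ'.v x = i₀ + i ∧ Inv (i + 1) (σ'.set x (i₀ + (i + 1))))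
    (hend : ∀ σ, Inv N σ → σ.v x = i₀ + N → Q σ) :
    Tri W S (Prog.upTo x b p) σ ((T + b.cost + 7) * (N + 1)) Q := by
  refine (Tri.upTo hW Inv (fun _ => T) h0 hx hN hb hstep hend).mono ?_ fun _ => id
  rw [Finset.sum_const, Finset.card_range, smul_eq_mul]
  nlinarith

/-- A loop without inner loops after a program without loops. -/
theorem Prog.tri_seq_upTo {W S : ℕ} (hW : 32 * (S * S) ≤ W) {x : ℕ} {b : Expr} {p₀ p : Prog}
    {Q : Store → Prop} (i₀ N : ℕ) (Inv : ℕ → Store → Prop) {σ : Store} (hN : i₀ + N + 1 < W)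
    (h0 : wp W S p₀ (fun σ' => σ'.v x = i₀ ∧ Inv 0 σ') σ)
    (hb : ∀ i ≤ N, ∀ σ, Inv i σ → b.Ok W S σ ∧ b.eval S σ = i₀ + N)
    (hstep : ∀ i < N, ∀ σ, σ.v x = i₀ + i → Inv i σ →
      wp W S p (fun σ' => σ'.v x = i₀ + i ∧ Inv (i + 1) (σ'.set x (i₀ + (i + 1)))) σ)
    (hend : ∀ σ, Inv N σ → σ.v x = i₀ + N → Q σ) :
    Tri W S (.seq p₀ (Prog.upTo x b p)) σ ((Prog.seq p₀ (Prog.upTo x b p)).cost * (N + 1)) Q := by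
  refine (Tri.seq ((tri_of_wp hW p₀ h0).mono le_rfl fun σ' h => ?_)).mono
    (T := p₀.cost + (p.cost + b.cost + 7) * (N + 1)) ?_ fun _ => id
  · exact Tri.upTo_const hW Inv h.2 h.1 hN hb (fun i hi σ hx hI => tri_of_wp hW p (hstep i hi σ hx hI))
      hend
  · have e : (Prog.seq p₀ (Prog.upTo x b p)).cost = p₀.cost + (p.cost + b.cost + 7) + 1 := by
      simp only [Prog.cost, Prog.upTo, Expr.cost, HAdd.hAdd, Add.add]
      change p₀.cost + (p.cost + 5 + 1 + b.cost + 2) = p₀.cost + (p.cost + b.cost + 7) + 1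
      omega
    rw [e]
    nlinarith

end WordRAM

/-! ### Linear preprocessing of the given tree -/

namespace SuffixTree

open WordRAM WordRAM.Prog WordRAM.Expr

variable {W S : ℕ} {τ : PreorderTree} {base v : ℕ}

/-- Computes tables of the highest and the lowest bits of the numbers up to twice the size of the
tree. -/
def tableProg : Prog :=
  .seq (.seq (write 1 (const 0) (const 0) (const 1))
    (.seq (write 1 (const 0) (const 1) (const 1))
    (.seq (write 2 (const 0) (const 1) (const 1)) (assign 4 (const 2)))))
  (upTo 4 (const 2 * var 2 + const 1)
    (.seq (write 1 (const 0) (var 4) (const 2 * arr 1 (var 4 / const 2)))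
    (.ite .eq (var 4 % const 2) (const 1)
      (write 2 (const 0) (var 4) (const 1))
      (write 2 (const 0) (var 4) (const 2 * arr 2 (var 4 / const 2))))))

theorem tri_tableProg : ∀ {W S : ℕ} (_ : 32 * (S * S) ≤ W) {σ : Store} {M : ℕ} (_ : 0 < M)
    (_ : σ.v 2 = M) (_ : 4 * M + 20 < S), Tri W S tableProg σ (tableProg.cost * (2 * M)) fun σ' =>
      Store.Agree [1, 2] [4] σ σ' ∧ (∀ x < 2 * M + 1, σ'.a 1 0 x = highBit x) ∧
      ∀ x < 2 * M + 1, 0 < x → IsLowBit x (σ'.a 2 0 x) := by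
  intro W S hW σ M hM hv hs
  have hS := le_of_bound hW
  have e : 2 * M = 2 * M - 1 + 1 := by omega
  -- The entries up to 1 are written directly; the loop runs from 2 to 2M and has 2M − 1 rounds.
  rw [show ∀ k, k * (2 * M) = k * (2 * M - 1 + 1) from fun k => by rw [← e]]
  refine tri_seq_upTo hW 2 (2 * M - 1) (fun i σ' => Store.Agree [1, 2] [4] σ σ' ∧
    (∀ x < i + 2, σ'.a 1 0 x = highBit x) ∧
    ∀ x < i + 2, 0 < x → IsLowBit x (σ'.a 2 0 x)) (by omega) ?_ ?_ ?_ ?_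
  · simp only [wp, ok_const, eval_const, Store.set_v, if_true, Store.set_a, Store.put_a]
    refine ⟨by omega, by omega, by omega, by omega, by omega, by omega, by omega, by omega, by omega,
      by omega, by omega, by omega, by omega, by omega, by omega, by omega, by omega, by omega,
      by omega, by omega, trivial, ?_, ?_, ?_⟩
    · exact ((((Store.Agree.refl _ _ _).put (by simp) _ _ _).put (by simp) _ _ _).put
        (by simp) _ _ _).set (by simp) _
    · intro x hx
      interval_cases x <;> simp [highBit]
    · intro x hx h0
      interval_cases x
      simpa using isLowBit_of_odd (c := 1) rfl
  · rintro i hi σ' ⟨hA, -⟩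
    have := hA.v 2 (by simp)
    simp [this, hv]
    omega
  · rintro i hi σ' hx ⟨hA, hh, hl⟩
    have h₁ := hh ((2 + i) / 2) (by omega)
    have h₂ : highBit ((2 + i) / 2) ≤ i + 1 := (highBit_le (by omega)).trans (by omega)
    have h₃ := hl ((2 + i) / 2) (by omega) (by omega)
    have h₄ := h₃.le
    have e : (2 + i) / 2 = i / 2 + 1 := by omega
    rw [e] at h₁ h₂ h₃ h₄
    have hA' : ∀ k l, Store.Agree [1, 2] [4] σ
        (((σ'.put 1 0 (2 + i) k).put 2 0 (2 + i) l).set 4 (2 + (i + 1))) := fun k l =>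
      ((hA.put (by simp) _ _ _).put (by simp) _ _ _).set (by simp) _
    have hh' : ∀ x < i + 1 + 2,
        (if x = 2 + i then 2 * highBit (i / 2 + 1) else σ'.a 1 0 x) = highBit x := by
      intro x hx
      split_ifs with h
      · rw [h, highBit_of_two_le (x := 2 + i) (by omega), e]
      · exact hh x (by omega)
    simp [wp, arr, hx, Cmp.Holds, h₁]
    constructorm* _ ∧ _ <;> try omega
    all_goals intro hpar
    all_goals constructorm* _ ∧ _
    all_goals first | omega | exact hA' _ _ | exact hh' | skip
    · intro x hx h0
      split_ifs with h
      · subst h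
        exact isLowBit_of_odd (by omega)
      · exact hl x (by omega) h0
    · intro x hx h0
      split_ifs with h
      · subst h
        exact isLowBit_of_even (by omega) (e ▸ h₃)
      · exact hl x (by omega) h0
  · rintro σ' ⟨hA, hh, hl⟩ -
    exact ⟨hA, fun x hx => hh x (by omega), fun x hx => hl x (by omega)⟩

/-- Initializes the last descendants and the buckets, and inverts the annotation of the leaves. -/
def initProg : Prog :=
  .seq (assign 4 (const 0))
  (upTo 4 (var 2)
    (.seq (write 3 (const 0) (var 4) (var 4))
    (.seq (write 8 (const 0) (var 4) (const 0))
    (.seq (write 10 (const 0) (var 4) (const 0))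
    (write 7 (const 0) (field (var 4) 4) (var 4))))))

/-- All nodes that are not leaves have annotation 0 and overwrite the same cell of the inverse; this
is harmless because positions are positive. -/
theorem tri_initProg : ∀ {W S : ℕ} (_ : 32 * (S * S) ≤ W) {σ : Store} {M base : ℕ}
    (_ : σ.v 2 = M) (_ : σ.v 3 = base) (_ : base + 4 * M + 20 < S) {ann : ℕ → ℕ}
    (_ : ∀ v < M, σ.a 0 0 (base + 4 * v + 4) = ann v) (_ : ∀ v < M, ann v < S)
    (_ : ∀ u < M, ∀ v < M, ann u = ann v → ann u ≠ 0 → u = v),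
    Tri W S initProg σ (initProg.cost * (M + 1)) fun σ' =>
      Store.Agree [3, 7, 8, 10] [4] σ σ' ∧ (∀ v < M, σ'.a 3 0 v = v) ∧ (∀ v < M, σ'.a 8 0 v = 0) ∧
      (∀ v < M, σ'.a 10 0 v = 0) ∧ ∀ v < M, ann v ≠ 0 → σ'.a 7 0 (ann v) = v := by
  intro W S hW σ M base hM hb hs ann ha haS hinj
  have hS := le_of_bound hW
  refine tri_seq_upTo hW 0 M (fun i σ' => Store.Agree [3, 7, 8, 10] [4] σ σ' ∧
    (∀ v < i, σ'.a 3 0 v = v) ∧ (∀ v < i, σ'.a 8 0 v = 0) ∧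
      (∀ v < i, σ'.a 10 0 v = 0) ∧ ∀ v < i, ann v ≠ 0 → σ'.a 7 0 (ann v) = v) (by omega) ?_ ?_ ?_ ?_
  · simp [wp]
    exact ⟨by omega, (Store.Agree.refl _ _ _).set (by simp) _⟩
  · rintro i hi σ' ⟨hA, -⟩
    have := hA.v 2 (by simp)
    simp [this, hM]
  · rintro i hi σ' hx ⟨hA, h₁, h₂, h₃, h₄⟩
    have hv := hA.v 3 (by simp)
    have hb' := congrFun (congrFun (hA.a 0 (by simp)) 0) (base + 4 * i + 4)
    rw [ha i hi] at hb'
    simp only [zero_add] at hx ⊢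
    have := haS i hi
    simp [wp, field, hx, hv, hb, hb']
    constructorm* _ ∧ _ <;> try omega
    · exact ((((hA.put (by simp) _ _ _).put (by simp) _ _ _).put (by simp) _ _ _).put
        (by simp) _ _ _).set (by simp) _
    · intro v hv
      split_ifs with h
      · exact h.symm
      · exact h₁ v (by omega)
    · intro v hv hne
      exact h₂ v (by omega)
    · intro v hv hne
      exact h₃ v (by omega)
    · intro v hv hne
      by_cases he : ann v = ann i
      · rw [if_pos he, hinj v (by omega) i hi he hne]
      · rw [if_neg he]
        refine h₄ v ?_ hne
        have : v ≠ i := fun e => he (e ▸ rfl)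
        omega
  · rintro σ' h -
    exact h

/-- Computes the last descendants, the inlabel numbers and their heads. -/
def inlabelProg : Prog :=
  .seq (assign 4 (const 0))
  (upTo 4 (var 2)
    (.seq (assign 6 (var 2 - const 1 - var 4))
    (.seq (assign 7 (arr 3 (var 6) + const 1))
    (.seq (assign 8 (arr 1 (bin .xor (var 6) (var 7))))
    (.seq (write 4 (const 0) (var 6) (var 7 / var 8 * var 8))
    (.seq (write 5 (const 0) (arr 4 (var 6)) (var 6))
    (.seq (assign 8 (field (var 6) 1))
    (.ite .lt (arr 3 (var 8)) (arr 3 (var 6))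
      (write 3 (const 0) (var 8) (arr 3 (var 6))) .skip))))))))

/-- The nodes are treated from the last to the first. Children pass their last descendants to their
parent before its turn, and since later entries for heads come from smaller nodes, the topmost node
of each chain remains. -/
theorem tri_inlabelProg : ∀ {W S : ℕ} (_ : 32 * (S * S) ≤ W) {σ : Store} {τ : PreorderTree}
    {base : ℕ} (_ : σ.v 2 = τ.size) (_ : σ.v 3 = base) (_ : base + 4 * τ.size + 20 < S)
    (_ : ∀ v < τ.size, σ.a 0 0 (base + 4 * v + 1) = τ.par v)
    (_ : ∀ x < 2 * τ.size + 1, σ.a 1 0 x = highBit x) (_ : ∀ v < τ.size, σ.a 3 0 v = v),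
    Tri W S inlabelProg σ (inlabelProg.cost * (τ.size + 1)) fun σ' =>
      Store.Agree [3, 4, 5] [4, 6, 7, 8] σ σ' ∧ (∀ v < τ.size, σ'.a 3 0 v = τ.last v) ∧
      (∀ v < τ.size, σ'.a 4 0 v = τ.inlabel v) ∧ τ.IsHead (σ'.a 5 0) := by
  intro W S hW σ τ base hM hb hs hpar hhigh hE
  have hS := le_of_bound hW
  refine tri_seq_upTo hW 0 τ.size (fun i σ' => Store.Agree [3, 4, 5] [4, 6, 7, 8] σ σ' ∧
    (∀ v < τ.size, v ≤ σ'.a 3 0 v ∧ σ'.a 3 0 v ≤ τ.last v) ∧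
    ∀ v < τ.size, τ.size - i ≤ v → σ'.a 3 0 v = τ.last v ∧ τ.last v ≤ σ'.a 3 0 (τ.par v) ∧
      σ'.a 4 0 v = τ.inlabel v ∧ σ'.a 5 0 (τ.inlabel v) ≤ v ∧
      τ.inlabel (σ'.a 5 0 (τ.inlabel v)) = τ.inlabel v) (by omega) ?_ ?_ ?_ ?_
  · simp [wp]
    refine ⟨by omega, (Store.Agree.refl _ _ _).set (by simp) _, fun v hv => ?_, by omega⟩
    rw [hE v hv]
    exact ⟨le_rfl, τ.le_last v⟩
  · rintro i hi σ' ⟨hA, -⟩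
    have := hA.v 2 (by simp)
    simp [this, hM]
  · rintro i hi σ' hx ⟨hA, h₁, h₂⟩
    have hv₂ := hA.v 2 (by simp)
    have hv₃ := hA.v 3 (by simp)
    have ha₀ := hA.a 0 (by simp)
    have ha₁ := hA.a 1 (by simp)
    simp only [zero_add] at hx ⊢
    obtain ⟨v, hv⟩ : ∃ v, τ.size - 1 - i = v := ⟨_, rfl⟩
    have hvs : v < τ.size := by omega
    -- If v is not a leaf, the child of v above `last v` has already been treated and has passed on
    -- this value.
    have hlast : σ'.a 3 0 v = τ.last v := by
      refine le_antisymm (h₁ v hvs).2 ?_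
      by_cases hne : v = τ.last v
      · rw [← hne]
        exact (h₁ v hvs).1
      · obtain ⟨c, hc₁, hc₂, hc₃, hc₄⟩ := PreorderTree.Anc.exists_child (τ := τ) (u := v)
          (v := τ.last v) ⟨τ.le_last v, le_rfl⟩ hne (τ.last_lt v hvs)
        have := (h₂ c hc₂ (by omega)).2.1
        rw [hc₃] at this
        exact hc₄.2.trans this
    have hls := τ.last_lt v hvs
    have hxor := xor_lt_two_mul hvs.le (show τ.last v + 1 ≤ τ.size by omega) τ.size_pos
    have hin : (τ.last v + 1) / highBit (v ^^^ (τ.last v + 1)) * highBit (v ^^^ (τ.last v + 1)) =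
      τ.inlabel v := rfl
    have hin' := inlabel_le_size hvs
    have hdiv := Nat.div_le_self (τ.last v + 1) (highBit (v ^^^ (τ.last v + 1)))
    have hps := PreorderTree.par_lt_size hvs
    have hpl := PreorderTree.par_le hvs
    have hhb : highBit (v ^^^ (τ.last v + 1)) < W := by
      rcases Nat.eq_zero_or_pos (v ^^^ (τ.last v + 1)) with h | h
      · rw [h]; simp [highBit]; omega
      · have := highBit_le h.ne'; omega
    simp [wp, arr, field, hx, hv, hv₂, hv₃, hb, hM, hlast, ha₀, ha₁, hhigh _ hxor, hin, hpar v hvs,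
      Cmp.Holds]
    have hAA : Store.Agree [3, 4, 5] [4, 6, 7, 8] σ (((((((σ'.set 6 v).set 7 (τ.last v + 1)).set 8
        (highBit (v ^^^ (τ.last v + 1)))).put 4 0 v (τ.inlabel v)).put 5 0 (τ.inlabel v) v).set 8
        (τ.par v)).set 4 (i + 1)) :=
      ((((((hA.set (by simp) _).set (by simp) _).set (by simp) _).put (by simp) _ _ _).put
        (by simp) _ _ _).set (by simp) _).set (by simp) _
    have hhead : ∀ u < τ.size, τ.size - (i + 1) ≤ u →
        (if u = v then τ.inlabel v else σ'.a 4 0 u) = τ.inlabel u ∧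
        (if τ.inlabel u = τ.inlabel v then v else σ'.a 5 0 (τ.inlabel u)) ≤ u ∧
        τ.inlabel (if τ.inlabel u = τ.inlabel v then v else σ'.a 5 0 (τ.inlabel u)) = τ.inlabel u := by
      intro u hu hu'
      by_cases huv : u = v
      · subst huv
        simp
      · obtain ⟨-, -, g₁, g₂, g₃⟩ := h₂ u hu (by omega)
        refine ⟨by rw [if_neg huv, g₁], ?_, ?_⟩ <;> split_ifs with h
        · omega
        · exact g₂
        · exact h.symm
        · exact g₃
    refine ⟨by omega, by omega, by omega, by omega, by omega, by omega, by omega, by omega,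
      by omega, by omega, by omega, by omega, by omega, by omega, by omega, by omega, by omega,
      by omega, fun hlt => ⟨by omega, by omega, by omega, by omega, ?_, ?_, ?_⟩,
      fun hge => ⟨hAA, h₁, ?_⟩⟩
    · exact ((((((((hA.set (by simp) _).set (by simp) _).set (by simp) _).put (by simp) _ _ _).put
        (by simp) _ _ _).set (by simp) _).put (by simp) _ _ _).set (by simp) _)
    · intro u hu
      split_ifs with h
      · subst h
        exact ⟨hpl.trans (τ.le_last v), τ.nested _ _ hpl (τ.le_last_par v hvs)⟩
      · exact h₁ u hu
    · intro u hu hu'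
      refine ⟨?_, ?_, hhead u hu (by omega)⟩
      · split_ifs with h
        · obtain rfl : u = v := by omega
          rfl
        · by_cases huv : u = v
          · rw [huv, hlast]
          · exact (h₂ u hu (by omega)).1
      · by_cases huv : u = v
        · rw [huv, if_pos rfl]
        · have h := (h₂ u hu (by omega)).2.1
          split_ifs with h'
          · rw [h'] at h
            omega
          · exact h
    · intro u hu hu'
      refine ⟨?_, ?_, hhead u hu (by omega)⟩ <;> by_cases huv : u = v
      · rw [huv, hlast]
      · exact (h₂ u hu (by omega)).1
      · rw [huv]
        exact hge
      · exact (h₂ u hu (by omega)).2.1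
  · rintro σ' ⟨hA, h₁, h₂⟩ -
    exact ⟨hA, fun v hv => (h₂ v hv (by omega)).1, fun v hv => (h₂ v hv (by omega)).2.2.1,
      fun v hv => (h₂ v hv (by omega)).2.2.2⟩

/-- Computes the masks. -/
def maskProg : Prog :=
  .seq (.seq (write 6 (const 0) (const 0) (const 0)) (assign 4 (const 0)))
  (upTo 4 (var 2)
    (write 6 (const 0) (var 4) (bin .or (arr 6 (field (var 4) 1))
      (arr 1 (bin .xor (var 4) (arr 3 (var 4) + const 1))))))

theorem tri_maskProg : ∀ {W S : ℕ} (_ : 32 * (S * S) ≤ W) {σ : Store} {τ : PreorderTree}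
    {base : ℕ} (_ : σ.v 2 = τ.size) (_ : σ.v 3 = base) (_ : base + 4 * τ.size + 20 < S)
    (_ : ∀ v < τ.size, σ.a 0 0 (base + 4 * v + 1) = τ.par v)
    (_ : ∀ x < 2 * τ.size + 1, σ.a 1 0 x = highBit x) (_ : ∀ v < τ.size, σ.a 3 0 v = τ.last v),
    Tri W S maskProg σ (maskProg.cost * (τ.size + 1)) fun σ' =>
      Store.Agree [6] [4] σ σ' ∧ ∀ v < τ.size, τ.IsMask v (σ'.a 6 0 v) := by
  intro W S hW σ τ base hM hb hs hpar hhigh hE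
  have hS := le_of_bound hW
  refine tri_seq_upTo hW 0 τ.size (fun i σ' => Store.Agree [6] [4] σ σ' ∧
    -- The root is its own parent and reads its own cell, which must therefore be 0 at the start.
    (i = 0 → σ'.a 6 0 0 = 0) ∧ ∀ v < τ.size, v < i → τ.IsMask v (σ'.a 6 0 v))
    (by omega) ?_ ?_ ?_ ?_
  · simp [wp]
    exact ⟨by omega, by omega, by omega, ((Store.Agree.refl _ _ _).put (by simp) _ _ _).set (by simp) _⟩
  · rintro i hi σ' ⟨hA, -⟩
    have := hA.v 2 (by simp)
    simp [this, hM]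
  · rintro v hv σ' hx ⟨hA, h₁, h₂⟩
    have hv₃ := hA.v 3 (by simp)
    have ha₀ := hA.a 0 (by simp)
    have ha₁ := hA.a 1 (by simp)
    have ha₃ := hA.a 3 (by simp)
    simp only [zero_add] at hx ⊢
    have hls := τ.last_lt v hv
    have hxor := xor_lt_two_mul hv.le (show τ.last v + 1 ≤ τ.size by omega) τ.size_pos
    have hps := PreorderTree.par_lt_size hv
    have hmask : τ.IsMask v (σ'.a 6 0 (τ.par v) ||| highBit (v ^^^ (τ.last v + 1))) := by
      rcases Nat.eq_zero_or_pos v with rfl | h0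
      · rw [τ.par_zero, h₁ rfl]
        exact PreorderTree.isMask_zero
      · exact (h₂ _ hps (τ.par_lt v hv h0)).step hv
    have hlt := hmask.lt hv
    simp [wp, arr, field, hx, hv₃, hb, ha₀, ha₁, ha₃, hhigh _ hxor, hpar v hv, hE v hv]
    refine ⟨by omega, by omega, by omega, by omega,
      (hA.put (by simp) _ _ _).set (by simp) _, fun u hu huv => ?_⟩
    split_ifs with h
    · rwa [h]
    · exact h₂ u hu (by omega)
  · rintro σ' ⟨hA, h₁, h₂⟩ -
    exact ⟨hA, fun v hv => h₂ v hv hv⟩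

/-- All that precedes the treatment of the intervals. -/
def prepareProg : Prog := .seq tableProg (.seq initProg (.seq inlabelProg maskProg))

theorem tri_prepareProg : ∀ {W S : ℕ} (_ : 32 * (S * S) ≤ W) {σ : Store} {τ : PreorderTree}
    {base : ℕ} (_ : σ.v 2 = τ.size) (_ : σ.v 3 = base) (_ : base + 4 * τ.size + 20 < S)
    (_ : ∀ v < τ.size, σ.a 0 0 (base + 4 * v + 1) = τ.par v) {ann : ℕ → ℕ}
    (_ : ∀ v < τ.size, σ.a 0 0 (base + 4 * v + 4) = ann v) (_ : ∀ v < τ.size, ann v < S)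
    (_ : ∀ u < τ.size, ∀ v < τ.size, ann u = ann v → ann u ≠ 0 → u = v),
    Tri W S prepareProg σ (prepareProg.cost * (2 * τ.size)) fun σ' =>
      Store.Agree [1, 2, 3, 4, 5, 6, 7, 8, 10] [4, 6, 7, 8] σ σ' ∧ LcaReady τ S base σ'.a ∧
      (∀ v < τ.size, σ'.a 8 0 v = 0) ∧ (∀ v < τ.size, σ'.a 10 0 v = 0) ∧
      ∀ v < τ.size, ann v ≠ 0 → σ'.a 7 0 (ann v) = v := by
  intro W S hW σ τ base hM hb hs hpar ann ha haS hinj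
  have hpos := τ.size_pos
  refine (Tri.seq ((tri_tableProg hW hpos hM (by omega)).mono le_rfl ?_)).mono
    (T := tableProg.cost * (2 * τ.size) + (initProg.cost * (τ.size + 1) +
      (inlabelProg.cost * (τ.size + 1) + maskProg.cost * (τ.size + 1)))) ?_ fun _ => id
  · rintro σ₁ ⟨hA₁, hhigh, hlow⟩
    refine Tri.seq ((tri_initProg hW (M := τ.size) (base := base) (ann := ann) ?_ ?_ hs ?_ haS hinj).mono
      le_rfl ?_)
    · rw [hA₁.v 2 (by simp), hM]
    · rw [hA₁.v 3 (by simp), hb]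
    · rwa [hA₁.a 0 (by simp)]
    rintro σ₂ ⟨hA₂, hE, h8, h10, h7⟩
    have hA₂' : Store.Agree [1, 2, 3, 7, 8, 10] [4] σ σ₂ :=
      hA₁.trans hA₂ (by simp) (by simp) (by simp) (by simp)
    refine Tri.seq ((tri_inlabelProg hW (τ := τ) (base := base) ?_ ?_ hs ?_ ?_ hE).mono le_rfl ?_)
    · rw [hA₂'.v 2 (by simp), hM]
    · rw [hA₂'.v 3 (by simp), hb]
    · rwa [hA₂'.a 0 (by simp)]
    · rwa [hA₂.a 1 (by simp)]
    rintro σ₃ ⟨hA₃, hlast, hinl, hhead⟩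
    have hA₃' : Store.Agree [1, 2, 3, 4, 5, 7, 8, 10] [4, 6, 7, 8] σ σ₃ :=
      hA₂'.trans hA₃ (by simp) (by simp) (by simp) (by simp)
    refine (tri_maskProg hW (τ := τ) (base := base) ?_ ?_ hs ?_ ?_ hlast).mono le_rfl ?_
    · rw [hA₃'.v 2 (by simp), hM]
    · rw [hA₃'.v 3 (by simp), hb]
    · rwa [hA₃'.a 0 (by simp)]
    · rwa [hA₃.a 1 (by simp), hA₂.a 1 (by simp)]
    rintro σ₄ ⟨hA₄, hmask⟩
    have hA₄' : Store.Agree [1, 2, 3, 4, 5, 6, 7, 8, 10] [4, 6, 7, 8] σ σ₄ :=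
      hA₃'.trans hA₄ (by simp) (by simp) (by simp) (by simp)
    refine ⟨hA₄', ⟨hs, ?_, ?_, ?_, ?_, ?_, hmask⟩, ?_, ?_, ?_⟩
    · rwa [hA₄'.a 0 (by simp)]
    · rwa [hA₄.a 1 (by simp), hA₃.a 1 (by simp), hA₂.a 1 (by simp)]
    · rwa [hA₄.a 2 (by simp), hA₃.a 2 (by simp), hA₂.a 2 (by simp)]
    · rwa [hA₄.a 4 (by simp)]
    · rwa [hA₄.a 5 (by simp)]
    · rwa [hA₄.a 8 (by simp), hA₃.a 8 (by simp)]
    · rwa [hA₄.a 10 (by simp), hA₃.a 10 (by simp)]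
    · rwa [hA₄.a 7 (by simp), hA₃.a 7 (by simp)]
  · simp only [prepareProg, Prog.cost]
    nlinarith

end SuffixTree

/-! ### Timing of nested loops -/

namespace WordRAM

/-- Two nested loops with a body without loops. -/
theorem Prog.tri_nested {W S : ℕ} (hW : 32 * (S * S) ≤ W) {x y : ℕ} {b b' : Expr} {p₀ h p : Prog}
    {Q : Store → Prop} (N : ℕ) (j₀ n : ℕ → ℕ) (Inv : ℕ → Store → Prop)
    (Inn : ℕ → ℕ → Store → Prop) {σ : Store} (hN : N + 1 < W) (hn : ∀ i < N, j₀ i + n i + 1 < W)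
    (h0 : wp W S p₀ (fun σ' => σ'.v x = 0 ∧ Inv 0 σ') σ)
    (hb : ∀ i ≤ N, ∀ σ, Inv i σ → b.Ok W S σ ∧ b.eval S σ = N)
    (hh : ∀ i < N, ∀ σ, σ.v x = i → Inv i σ →
      wp W S h (fun σ' => σ'.v y = j₀ i ∧ Inn i 0 σ') σ)
    (hb' : ∀ i < N, ∀ j ≤ n i, ∀ σ, Inn i j σ → b'.Ok W S σ ∧ b'.eval S σ = j₀ i + n i)
    (hp : ∀ i < N, ∀ j < n i, ∀ σ, σ.v y = j₀ i + j → Inn i j σ →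
      wp W S p (fun σ' => σ'.v y = j₀ i + j ∧ Inn i (j + 1) (σ'.set y (j₀ i + (j + 1)))) σ)
    (hend' : ∀ i < N, ∀ σ, Inn i (n i) σ → σ.v x = i ∧ Inv (i + 1) (σ.set x (i + 1)))
    (hend : ∀ σ, Inv N σ → Q σ) :
    Tri W S (.seq p₀ (Prog.upTo x b (.seq h (Prog.upTo y b' p)))) σ
      ((Prog.seq p₀ (Prog.upTo x b (.seq h (Prog.upTo y b' p)))).cost *
        ((∑ i ∈ Finset.range N, (n i + 1)) + 1)) Q := by
  set C := (Prog.seq p₀ (Prog.upTo x b (.seq h (Prog.upTo y b' p)))).cost with hC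
  have e : C = p₀.cost + (h.cost + (p.cost + b'.cost + 7)) + b.cost + 9 := by
    rw [hC]
    simp only [Prog.cost, Prog.upTo, Expr.cost, HAdd.hAdd, Add.add]
    change p₀.cost + (h.cost + (p.cost + 5 + 1 + b'.cost + 2) + 5 + 1 + b.cost + 2) =
      p₀.cost + (h.cost + (p.cost + b'.cost + 7)) + b.cost + 9
    omega
  refine (Tri.seq ((tri_of_wp hW p₀ h0).mono le_rfl fun σ' hσ' => ?_)).mono
    (T := p₀.cost + ((∑ i ∈ Finset.range N,
      (h.cost + (p.cost + b'.cost + 7) * (n i + 1) + (b.cost + 7))) + (b.cost + 2))) ?_ fun _ => id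
  · refine Tri.upTo hW Inv (i₀ := 0) (N := N) _ hσ'.2 hσ'.1 (by omega) (by simpa using hb) ?_ ?_
    · intro i hi σ hx hI
      simp only [zero_add] at hx ⊢
      refine Tri.seq ((tri_of_wp hW h (hh i hi σ hx hI)).mono le_rfl fun σ' hσ' => ?_)
      exact Tri.upTo_const hW (Inn i) hσ'.2 hσ'.1 (hn i hi) (hb' i hi)
        (fun j hj σ hy hI => tri_of_wp hW p (hp i hi j hj σ hy hI)) fun σ hI _ => hend' i hi σ hI
    · exact fun σ hI _ => hend σ hI
  · have h₁ : ∑ i ∈ Finset.range N, (h.cost + (p.cost + b'.cost + 7) * (n i + 1) + (b.cost + 7)) ≤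
        ∑ i ∈ Finset.range N, C * (n i + 1) := by
      refine Finset.sum_le_sum fun i _ => ?_
      rw [e]
      nlinarith
    rw [mul_add, Finset.mul_sum, mul_one]
    omega

end WordRAM

namespace SuffixTree

open WordRAM WordRAM.Prog WordRAM.Expr

/-! ### Buckets -/

/-- The bucket of `v` contains `x`; it has `cnt v` elements. -/
def Has {β : Type*} (cnt : ℕ → ℕ) (item : ℕ → ℕ → β) (v : ℕ) (x : β) : Prop :=
  ∃ k < cnt v, item v k = x

theorem has_push {β : Type*} {cnt cnt' : ℕ → ℕ} {item item' : ℕ → ℕ → β} {v : ℕ} {x : β}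
    (hc : ∀ u, cnt' u = if u = v then cnt v + 1 else cnt u)
    (hi : ∀ u k, item' u k = if u = v ∧ k = cnt v then x else item u k) (u : ℕ) (y : β) :
    Has cnt' item' u y ↔ Has cnt item u y ∨ (u = v ∧ y = x) := by
  unfold Has
  simp only [hc, hi]
  by_cases h : u = v
  · subst h
    simp only [if_true, true_and]
    constructor
    · rintro ⟨k, hk, rfl⟩
      by_cases hk' : k = cnt u
      · exact .inr (by rw [if_pos hk'])
      · exact .inl ⟨k, by omega, by rw [if_neg hk']⟩
    · rintro (⟨k, hk, rfl⟩ | rfl)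
      · exact ⟨k, by omega, by rw [if_neg (by omega)]⟩
      · exact ⟨cnt u, by omega, by rw [if_pos rfl]⟩
  · simp [h]

theorem sum_push {cnt cnt' : ℕ → ℕ} {v M : ℕ} (hv : v < M)
    (hc : ∀ u, cnt' u = if u = v then cnt v + 1 else cnt u) :
    ∑ u ∈ Finset.range M, cnt' u = ∑ u ∈ Finset.range M, cnt u + 1 := by
  have : ∀ u, cnt' u = cnt u + if u = v then 1 else 0 := by
    intro u
    rw [hc]
    split_ifs with h
    · rw [h]
    · rfl
  simp only [this, Finset.sum_add_distrib, Finset.sum_ite_eq', Finset.mem_range, hv, if_true]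

theorem le_sum_range {cnt : ℕ → ℕ} {v M : ℕ} (hv : v < M) :
    cnt v ≤ ∑ u ∈ Finset.range M, cnt u :=
  Finset.single_le_sum (f := cnt) (fun _ _ => Nat.zero_le _) (Finset.mem_range.2 hv)

/-! ### The intervals -/

/-- The intervals `[lo k .. hi k]`, `k < m`; `f` maps positions to leaves of `τ`. -/
structure Family (τ : PreorderTree) (S m : ℕ) (lo hi f : ℕ → ℕ) : Prop where
  lo_le : ∀ k < m, lo k ≤ hi k
  leaf_lt : ∀ k < m, ∀ i, lo k ≤ i → i ≤ hi k → f i < τ.size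
  hi_lt : ∀ k < m, hi k + 2 < S
  card_lt : 2 * m + 5 < S
  size_lt : 4 * τ.size + 20 < S
  total_lt : 2 * ∑ k ∈ Finset.range m, (hi k + 1 - lo k) < S

/-- The root and the leaves of the `k`-th interval. -/
def Family.leaves (lo hi f : ℕ → ℕ) (k : ℕ) : Set ℕ :=
  {x | x = 0 ∨ ∃ i, lo k ≤ i ∧ i ≤ hi k ∧ f i = x}

/-- The tree of the `k`-th interval consists of the root, and the pointer to it is set. -/
structure Rooted (S : ℕ) (lo : ℕ → ℕ) (a : ℕ → ℕ → ℕ → ℕ) (k : ℕ) : Prop where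
  top : a 14 0 k = 0
  index : a 15 k 0 = 0
  count : a 16 k 0 = 1
  par : a 16 k 1 = 0
  length : a 16 k 2 = 0
  pos : a 16 k 3 = lo k
  ann : a 16 k 4 = 0
  pointer : a 17 0 k = address S 16 k 0

theorem Rooted.congr {S : ℕ} {lo : ℕ → ℕ} {a a' : ℕ → ℕ → ℕ → ℕ} {k : ℕ} (h : Rooted S lo a k)
    (ha : ∀ r, 14 ≤ r → a' r = a r) : Rooted S lo a' k := by
  obtain ⟨g₁, g₂, g₃, g₄, g₅, g₆, g₇, g₈⟩ := h
  have h₁ := ha 14 (by norm_num)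
  have h₂ := ha 15 (by norm_num)
  have h₃ := ha 16 (by norm_num)
  have h₄ := ha 17 (by norm_num)
  constructor <;> simp only [*]

/-- Nothing has been added to the tree of the `k`-th interval. -/
structure Started (S : ℕ) (lo : ℕ → ℕ) (a : ℕ → ℕ → ℕ → ℕ) (k : ℕ) : Prop
    extends Rooted S lo a k where
  last : a 13 0 k = 0

/-- Starts the trees of the intervals, and puts the intervals into the buckets of their leaves.
The bucket `v` consists of the cells `v`, `k` of array `9` with `k` smaller than the cell `v` of array
`8`. -/
def familyProg : Prog :=
  .seq (assign 4 (const 0))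
  (upTo 4 (var 1)
    (.seq
      (.seq (write 13 (const 0) (var 4) (const 0))
      (.seq (write 14 (const 0) (var 4) (const 0))
      (.seq (write 15 (var 4) (const 0) (const 0))
      (.seq (write 16 (var 4) (const 0) (const 1))
      (.seq (write 16 (var 4) (const 1) (const 0))
      (.seq (write 16 (var 4) (const 2) (const 0))
      (.seq (write 16 (var 4) (const 3) (arr 0 (const 2 * var 4 + const 3)))
      (.seq (write 16 (var 4) (const 4) (const 0))
      (.seq (write 17 (const 0) (var 4) ((const 16 * size + var 4) * size))
      (assign 5 (arr 0 (const 2 * var 4 + const 3))))))))))))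
    (upTo 5 (arr 0 (const 2 * var 4 + const 4) + const 1)
      (.seq (assign 6 (arr 7 (var 5)))
      (.seq (assign 7 (arr 8 (var 6)))
      (.seq (write 9 (var 6) (var 7) (var 4))
      (write 8 (const 0) (var 6) (var 7 + const 1))))))))

/-- Besides the contents of the buckets, their total size is followed: it bounds the time of the
next phase and keeps all bucket indices below S. -/
theorem tri_familyProg {W S : ℕ} (hW : 32 * (S * S) ≤ W) {σ : Store} {τ : PreorderTree} {m : ℕ}
    {lo hi f : ℕ → ℕ} (hF : Family τ S m lo hi f) (hm : σ.v 1 = m)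
    (hlo : ∀ k < m, σ.a 0 0 (2 * k + 3) = lo k) (hhi : ∀ k < m, σ.a 0 0 (2 * k + 4) = hi k)
    (hf : ∀ k < m, ∀ i, lo k ≤ i → i ≤ hi k → σ.a 7 0 i = f i) (h8 : ∀ v < τ.size, σ.a 8 0 v = 0) :
    Tri W S familyProg σ
      (familyProg.cost * ((∑ k ∈ Finset.range m, (hi k + 1 - lo k + 1)) + 1)) fun σ' =>
      Store.Agree [8, 9, 13, 14, 15, 16, 17] [4, 5, 6, 7] σ σ' ∧ (∀ k < m, Started S lo σ'.a k) ∧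
      (∀ v < τ.size, ∀ x, Has (σ'.a 8 0) (σ'.a 9) v x ↔
        x < m ∧ ∃ i, lo x ≤ i ∧ i ≤ hi x ∧ f i = v) ∧
      ∑ v ∈ Finset.range τ.size, σ'.a 8 0 v = ∑ k ∈ Finset.range m, (hi k + 1 - lo k) := by
  have hS := le_of_bound hW
  have hc := hF.card_lt
  refine tri_nested hW m lo (fun k => hi k + 1 - lo k)
    (fun j σ' => Store.Agree [8, 9, 13, 14, 15, 16, 17] [4, 5, 6, 7] σ σ' ∧
      (∀ k < j, Started S lo σ'.a k) ∧
      (∀ v < τ.size, ∀ x, Has (σ'.a 8 0) (σ'.a 9) v x ↔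
        x < j ∧ ∃ i, lo x ≤ i ∧ i ≤ hi x ∧ f i = v) ∧
      ∑ v ∈ Finset.range τ.size, σ'.a 8 0 v = ∑ k ∈ Finset.range j, (hi k + 1 - lo k))
    (fun k j σ' => Store.Agree [8, 9, 13, 14, 15, 16, 17] [4, 5, 6, 7] σ σ' ∧ σ'.v 4 = k ∧
      (∀ k' < k + 1, Started S lo σ'.a k') ∧
      (∀ v < τ.size, ∀ x, Has (σ'.a 8 0) (σ'.a 9) v x ↔
        (x < k ∧ ∃ i, lo x ≤ i ∧ i ≤ hi x ∧ f i = v) ∨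
        (x = k ∧ ∃ i, lo k ≤ i ∧ i < lo k + j ∧ f i = v)) ∧
      ∑ v ∈ Finset.range τ.size, σ'.a 8 0 v = ∑ k ∈ Finset.range k, (hi k + 1 - lo k) + j)
    (by omega) ?_ ?_ ?_ ?_ ?_ ?_ ?_ ?_
  · intro k hk
    have := hF.lo_le k hk
    have := hF.hi_lt k hk
    omega
  · simp [wp]
    refine ⟨by omega, (Store.Agree.refl _ _ _).set (by simp) _, ?_, h8⟩
    intro v hv x
    simp [Has, h8 v hv]
  · rintro k hk σ' ⟨hA, -⟩
    simp [hA.v 1 (by simp), hm]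
  · rintro k hk σ' hx ⟨hA, h₁, h₂, h₃⟩
    have ha := hA.a 0 (by simp)
    have := hF.hi_lt k hk
    have := hF.lo_le k hk
    have had := address_aux_lt hW (r := 16) (a := k) (S := S) (by norm_num) (by omega)
    simp [wp, arr, hx, ha, hlo k hk]
    constructorm* _ ∧ _ <;> try omega
    · exact ((((((((((hA.put (by simp) _ _ _).put (by simp) _ _ _).put (by simp) _ _ _).put
        (by simp) _ _ _).put (by simp) _ _ _).put
        (by simp) _ _ _).put (by simp) _ _ _).put (by simp) _ _ _).put (by simp) _ _ _).set (by simp) _)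
    · intro k' hk'
      by_cases e : k' = k
      · subst e
        refine ⟨⟨?_, ?_, ?_, ?_, ?_, ?_, ?_, ?_⟩, ?_⟩ <;> simp [address]
      · obtain ⟨⟨g₁, g₂, g₃, g₄, g₅, g₆, g₇, g₈⟩, g₉⟩ := h₁ k' (by omega)
        refine ⟨⟨?_, ?_, ?_, ?_, ?_, ?_, ?_, ?_⟩, ?_⟩ <;> simp [*]
    · intro v hv x
      refine Iff.trans (b := Has (σ'.a 8 0) (σ'.a 9) v x) (by unfold Has; simp) ?_
      rw [h₂ v hv x]
      constructor
      · exact .inl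
      · rintro (h | ⟨-, i, h, h', -⟩)
        · exact h
        · omega
  · rintro k hk j hj σ' ⟨hA, hv, -⟩
    have ha := hA.a 0 (by simp)
    have := hF.hi_lt k hk
    have := hF.lo_le k hk
    simp [arr, ha, hv, hhi k hk]
    omega
  · rintro k hk j hj σ' hy ⟨hA, hx, h₁, h₂, h₃⟩
    have ha := hA.a 7 (by simp)
    have := hF.hi_lt k hk
    have := hF.size_lt
    have hlf := hF.leaf_lt k hk (lo k + j) (by omega) (by omega)
    have hfk := hf k hk (lo k + j) (by omega) (by omega)
    have hcnt := le_sum_range (cnt := σ'.a 8 0) hlf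
    have htot : ∑ k ∈ Finset.range k, (hi k + 1 - lo k) + (hi k + 1 - lo k) ≤
        ∑ k ∈ Finset.range m, (hi k + 1 - lo k) := by
      rw [← Finset.sum_range_succ]
      exact Finset.sum_le_sum_of_subset (Finset.range_subset_range.2 (by omega))
    have := hF.total_lt
    simp [wp, arr, hy, hx, ha, hfk]
    constructorm* _ ∧ _ <;> try omega
    · exact (((((hA.set (by simp) _).set (by simp) _).put (by simp) _ _ _).put (by simp) _ _ _).set
        (by simp) _)
    · intro k' hk'
      obtain ⟨⟨g₁, g₂, g₃, g₄, g₅, g₆, g₇, g₈⟩, g₉⟩ := h₁ k' (by omega)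
      refine ⟨⟨?_, ?_, ?_, ?_, ?_, ?_, ?_, ?_⟩, ?_⟩ <;> simp [*]
    · intro v hv x
      rw [has_push (cnt := σ'.a 8 0) (item := σ'.a 9) (v := f (lo k + j)) (x := k)
        (by intro u; simp) (by intro u k'; simp), h₂ v hv x, or_assoc]
      refine or_congr Iff.rfl ⟨?_, ?_⟩
      · rintro (⟨h, i, h₄, h₅, h₆⟩ | ⟨rfl, rfl⟩)
        · exact ⟨h, i, h₄, by omega, h₆⟩
        · exact ⟨rfl, lo x + j, by omega, by omega, rfl⟩
      · rintro ⟨h, i, h₄, h₅, h₆⟩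
        by_cases e : i = lo k + j
        · exact .inr ⟨by rw [← h₆, e], h⟩
        · exact .inl ⟨h, i, h₄, by omega, h₆⟩
    · rw [sum_push (cnt := σ'.a 8 0) hlf (by intro u; simp), h₃]
      rfl
  · rintro k hk σ' ⟨hA, hx, h₁, h₂, h₃⟩
    have := hF.lo_le k hk
    refine ⟨hx, hA.set (by simp) _, h₁, fun v hv x => ?_, ?_⟩
    · rw [Store.set_a, h₂ v hv x]
      constructor
      · rintro (⟨h, h'⟩ | ⟨rfl, i, h₄, h₅, h₆⟩)
        · exact ⟨by omega, h'⟩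
        · exact ⟨by omega, i, h₄, by omega, h₆⟩
      · rintro ⟨h, i, h₄, h₅, h₆⟩
        by_cases e : x = k
        · subst e
          exact .inr ⟨rfl, i, h₄, by omega, h₆⟩
        · exact .inl ⟨by omega, i, h₄, h₅, h₆⟩
    · rw [Store.set_a, h₃, Finset.sum_range_succ]
  · exact fun σ' h => h

end SuffixTree

namespace SuffixTree

open WordRAM WordRAM.Prog WordRAM.Expr

variable {W S : ℕ} {τ : PreorderTree} {base m : ℕ} {lo hi f : ℕ → ℕ}

/-! ### The nodes of the trees -/

/-- The `k`-th element of the bucket of `v` in the second family of buckets: an interval and one of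
its positions. -/
def entry (a : ℕ → ℕ → ℕ → ℕ) (v k : ℕ) : ℕ × ℕ := (a 11 v k, a 12 v k)

/-- Puts the pair of the variables `6` and `7` into the bucket of the variable `t`. -/
def pushProg (t : ℕ) : Prog :=
  .seq (assign 8 (arr 10 (var t)))
  (.seq (write 11 (var t) (var 8) (var 6))
  (.seq (write 12 (var t) (var 8) (var 7))
  (write 10 (const 0) (var t) (var 8 + const 1))))

/-- The bound on the total size ensures that the next free cell of the bucket is inside the array.
-/
theorem wp_pushProg (hW : 32 * (S * S) ≤ W) {σ : Store} {t v x p : ℕ} (ht : σ.v t = v) (ht8 : t ≠ 8)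
    (h6 : σ.v 6 = x) (h7 : σ.v 7 = p) (hv : v < τ.size) (hs : τ.size < S)
    (hsum : ∑ u ∈ Finset.range τ.size, σ.a 10 0 u < S) {Q : Store → Prop}
    (hQ : ∀ σ', Store.Agree [10, 11, 12] [8] σ σ' →
      (∀ u y, Has (σ'.a 10 0) (entry σ'.a) u y ↔
        Has (σ.a 10 0) (entry σ.a) u y ∨ (u = v ∧ y = (x, p))) →
      ∑ u ∈ Finset.range τ.size, σ'.a 10 0 u = ∑ u ∈ Finset.range τ.size, σ.a 10 0 u + 1 → Q σ') :
    wp W S (pushProg t) Q σ := by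
  have hS := le_of_bound hW
  have hcnt := le_sum_range (cnt := σ.a 10 0) hv
  simp [wp, pushProg, arr, ht, h6, h7, ht8]
  refine ⟨by omega, by omega, by omega, by omega, by omega, by omega, by omega, by omega, by omega,
    by omega, hQ _ ?_ (fun u y => ?_) ?_⟩
  · exact ((((Store.Agree.refl _ _ _).set (by simp) _).put (by simp) _ _ _).put (by simp) _ _ _).put
      (by simp) _ _ _
  · refine has_push (by intro u; simp) (fun u k => ?_) u y
    by_cases h : u = v ∧ k = σ.a 10 0 v <;> simp [entry, h]
  · exact sum_push hv (by intro u; simp)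

/-- Joins the leaves of each interval in preorder, and puts the intervals into the buckets of the
lowest common ancestors of neighbours. -/
def joinBody : Prog :=
  .seq (.seq (assign 6 (get 9 (var 4) (var 5)))
    (.seq (assign 10 (arr 13 (var 6))) (assign 11 (var 4))))
  (.seq lcaProg
  (.seq (assign 7 (field (var 4) 4))
  (.seq (pushProg 12)
  (.seq (pushProg 4)
  (write 13 (const 0) (var 6) (var 4))))))

def joinProg : Prog :=
  .seq (assign 4 (const 0))
  (upTo 4 (var 2) (.seq (assign 5 (const 0)) (upTo 5 (arr 8 (var 4)) joinBody)))

namespace Family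

theorem leaves_lt (hF : Family τ S m lo hi f) {k : ℕ} (hk : k < m) :
    ∀ x ∈ leaves lo hi f k, x < τ.size := by
  rintro x (rfl | ⟨i, h₁, h₂, rfl⟩)
  · exact τ.size_pos
  · exact hF.leaf_lt k hk i h₁ h₂

end Family

/-- The nodes of the trees of the intervals are collected as far as they are spanned by the leaves up
to those in the array `13`, which precede `v` or satisfy `D`. -/
structure Joined (τ : PreorderTree) (m : ℕ) (lo hi f : ℕ → ℕ) (v : ℕ) (D : ℕ → Prop)
    (a : ℕ → ℕ → ℕ → ℕ) : Prop where
  mem : ∀ k < m, a 13 0 k ∈ Family.leaves lo hi f k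
  le : ∀ k < m, a 13 0 k ≤ v
  max : ∀ k < m, ∀ y ∈ Family.leaves lo hi f k, y < v ∨ (y = v ∧ D k) → y ≤ a 13 0 k
  sound : ∀ u k p, Has (a 10 0) (entry a) u (k, p) → u < τ.size → k < m ∧ lo k ≤ p ∧ p ≤ hi k ∧
    u ∈ τ.closure (Family.leaves lo hi f k) ∧ τ.Anc u (f p)
  complete : ∀ k < m, ∀ x ∈ Family.leaves lo hi f k, ∀ y ∈ Family.leaves lo hi f k,
    x ≤ a 13 0 k → y ≤ a 13 0 k → τ.lca x y = 0 ∨ ∃ p, Has (a 10 0) (entry a) (τ.lca x y) (k, p)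

theorem Joined.mono {v : ℕ} {D D' : ℕ → Prop} {a : ℕ → ℕ → ℕ → ℕ}
    (h : Joined τ m lo hi f v D a) (hD : ∀ k, D' k → D k) : Joined τ m lo hi f v D' a :=
  ⟨h.mem, h.le, fun k hk y hy hyv => h.max k hk y hy (hyv.imp id (And.imp id (hD k))), h.sound,
    h.complete⟩

/-- For a leaf y < v of the interval and its last leaf l so far, y ≤ l ≤ v, so lca(y, v) is lca(y,
l), collected before, or lca(l, v), collected now. The position p of v is recorded with both new
elements since both are ancestors of v. -/
theorem Joined.step (hF : Family τ S m lo hi f) {v x p : ℕ} {D : ℕ → Prop} {a a' : ℕ → ℕ → ℕ → ℕ}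
    (h : Joined τ m lo hi f v D a) (hv : v < τ.size) (hx : x < m) (hp : lo x ≤ p) (hp' : p ≤ hi x)
    (hfp : f p = v) (h13 : ∀ k, a' 13 0 k = if k = x then v else a 13 0 k)
    (hB : ∀ u y, Has (a' 10 0) (entry a') u y ↔ Has (a 10 0) (entry a) u y ∨
      (u = τ.lca (a 13 0 x) v ∧ y = (x, p)) ∨ (u = v ∧ y = (x, p))) :
    Joined τ m lo hi f v (fun k => D k ∨ k = x) a' := by
  have hvL : v ∈ Family.leaves lo hi f x := .inr ⟨p, hp, hp', hfp⟩
  have hLx := hF.leaves_lt hx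
  refine ⟨?_, ?_, ?_, ?_, ?_⟩
  · intro k hk
    rw [h13]
    split_ifs with e
    · rwa [e]
    · exact h.mem k hk
  · intro k hk
    rw [h13]
    split_ifs with e
    · exact le_rfl
    · exact h.le k hk
  · intro k hk y hy hyv
    rw [h13]
    split_ifs with e
    · omega
    · exact h.max k hk y hy (by tauto)
  · intro u k q hu hus
    rcases (hB u _).1 hu with h₁ | ⟨rfl, h₁⟩ | ⟨rfl, h₁⟩
    · exact h.sound u k q h₁ hus
    · obtain ⟨rfl, rfl⟩ := Prod.mk.inj h₁
      refine ⟨hx, hp, hp', ⟨_, h.mem k hx, _, hvL, rfl⟩, ?_⟩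
      rw [hfp]
      exact PreorderTree.lca_anc_right (hLx _ (h.mem k hx)) hv
    · obtain ⟨rfl, rfl⟩ := Prod.mk.inj h₁
      refine ⟨hx, hp, hp', PreorderTree.subset_closure hLx hvL, ?_⟩
      rw [hfp]
      exact PreorderTree.Anc.refl _
  · intro k hk
    have hold : ∀ y ∈ Family.leaves lo hi f k, ∀ z ∈ Family.leaves lo hi f k, y ≤ a 13 0 k →
        z ≤ a 13 0 k → τ.lca y z = 0 ∨ ∃ p, Has (a' 10 0) (entry a') (τ.lca y z) (k, p) := by
      intro y hy z hz hy' hz'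
      refine (h.complete k hk y hy z hz hy' hz').imp id fun ⟨q, hq⟩ => ⟨q, ?_⟩
      rw [hB]
      exact .inl hq
    by_cases e : k = x
    · subst e
      have key : ∀ y ∈ Family.leaves lo hi f k, ∀ z ∈ Family.leaves lo hi f k, y ≤ z → z ≤ v →
          τ.lca y z = 0 ∨ ∃ p, Has (a' 10 0) (entry a') (τ.lca y z) (k, p) := by
        intro y hy z hz hyz hzv
        have hle := h.le k hk
        rcases hzv.eq_or_lt with rfl | hlt
        · rcases hyz.eq_or_lt with rfl | hlt
          · rw [PreorderTree.lca_self hv]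
            exact .inr ⟨p, (hB _ _).2 (.inr (.inr ⟨rfl, rfl⟩))⟩
          · have hyl := h.max k hk y hy (.inl hlt)
            rcases PreorderTree.lca_eq_or hyl hle hv with e | e <;> rw [e]
            · exact hold _ hy _ (h.mem k hk) hyl le_rfl
            · exact .inr ⟨p, (hB _ _).2 (.inr (.inl ⟨rfl, rfl⟩))⟩
        · have := h.max k hk z hz (.inl hlt)
          exact hold y hy z hz (by omega) this
      intro y hy z hz hy' hz'
      rw [h13, if_pos rfl] at hy' hz'
      rcases le_total y z with h' | h'
      · exact key y hy z hz h' hz'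
      · rw [PreorderTree.lca_comm (hLx y hy) (hLx z hz)]
        exact key z hz y hy h' hy'
    · rw [h13, if_neg e]
      exact hold

/-- The last leaf of each interval starts as the root, whose lowest common ancestor with anything is
the root, so the first leaf needs no special case. The root itself is excepted from completeness
because it is already in every tree. -/
theorem tri_joinProg (hW : 32 * (S * S) ≤ W) {σ : Store} (hF : Family τ S m lo hi f)
    (hR : LcaReady τ S base σ.a) (hM : σ.v 2 = τ.size) (hb : σ.v 3 = base)
    (hann : ∀ k < m, ∀ i, lo k ≤ i → i ≤ hi k → σ.a 0 0 (base + 4 * f i + 4) = i)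
    (h13 : ∀ k < m, σ.a 13 0 k = 0) (h10 : ∀ v < τ.size, σ.a 10 0 v = 0)
    (hA : ∀ v < τ.size, ∀ x, Has (σ.a 8 0) (σ.a 9) v x ↔
        x < m ∧ ∃ i, lo x ≤ i ∧ i ≤ hi x ∧ f i = v)
    (hsum : ∑ v ∈ Finset.range τ.size, σ.a 8 0 v = ∑ k ∈ Finset.range m, (hi k + 1 - lo k)) :
    Tri W S joinProg σ
      (joinProg.cost * ((∑ v ∈ Finset.range τ.size, (σ.a 8 0 v + 1)) + 1)) fun σ' =>
      Store.Agree [10, 11, 12, 13] [4, 5, 6, 7, 8, 10, 11, 12, 13, 14, 15, 16, 17, 18, 19] σ σ' ∧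
      (∀ u k p, Has (σ'.a 10 0) (entry σ'.a) u (k, p) → u < τ.size → k < m ∧ lo k ≤ p ∧ p ≤ hi k ∧
        u ∈ τ.closure (Family.leaves lo hi f k) ∧ τ.Anc u (f p)) ∧
      (∀ k < m, ∀ z ∈ τ.closure (Family.leaves lo hi f k),
        z = 0 ∨ ∃ p, Has (σ'.a 10 0) (entry σ'.a) z (k, p)) ∧
      ∑ v ∈ Finset.range τ.size, σ'.a 10 0 v = 2 * ∑ k ∈ Finset.range m, (hi k + 1 - lo k) := by
  have hS := le_of_bound hW
  have hc := hF.size_lt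
  have htot := hF.total_lt
  have hcnt : ∀ v < τ.size, σ.a 8 0 v ≤ ∑ k ∈ Finset.range m, (hi k + 1 - lo k) := fun v hv => by
    rw [← hsum]
    exact le_sum_range hv
  refine tri_nested hW τ.size (fun _ => 0) (σ.a 8 0)
    (fun v σ' => Store.Agree [10, 11, 12, 13]
        [4, 5, 6, 7, 8, 10, 11, 12, 13, 14, 15, 16, 17, 18, 19] σ σ' ∧
      Joined τ m lo hi f v (fun _ => False) σ'.a ∧
      ∑ v ∈ Finset.range τ.size, σ'.a 10 0 v = 2 * ∑ u ∈ Finset.range v, σ.a 8 0 u)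
    (fun v j σ' => Store.Agree [10, 11, 12, 13]
        [4, 5, 6, 7, 8, 10, 11, 12, 13, 14, 15, 16, 17, 18, 19] σ σ' ∧
      σ'.v 4 = v ∧ Joined τ m lo hi f v (fun k => ∃ j' < j, σ.a 9 v j' = k) σ'.a ∧
      ∑ v ∈ Finset.range τ.size, σ'.a 10 0 v = 2 * (∑ u ∈ Finset.range v, σ.a 8 0 u + j))
    (by omega) ?_ ?_ ?_ ?_ ?_ ?_ ?_ ?_
  · intro v hv
    have := hcnt v hv
    omega
  · simp [wp]
    refine ⟨by omega, (Store.Agree.refl _ _ _).set (by simp) _, ⟨?_, ?_, ?_, ?_, ?_⟩, h10⟩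
    · exact fun k hk => .inl (h13 k hk)
    · exact fun k hk => (h13 k hk).le
    · rintro k hk y hy (h | h)
      · omega
      · exact h.2.elim
    · rintro u k p ⟨j, hj, -⟩ hu
      change j < σ.a 10 0 u at hj
      rw [h10 u hu] at hj
      omega
    · intro k hk x hx y hy hx' hy'
      change x ≤ σ.a 13 0 k at hx'
      rw [h13 k hk] at hx'
      obtain rfl := Nat.le_zero.1 hx'
      exact .inl (PreorderTree.lca_zero_left (hF.leaves_lt hk y hy))
  · rintro v hv σ' ⟨hA', -⟩
    simp [hA'.v 2 (by simp), hM]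
  · rintro v hv σ' hx ⟨hA', hJ, hs⟩
    simp [wp, hx]
    refine ⟨by omega, hA'.set (by simp) _, ?_, hs⟩
    exact hJ
  · rintro v hv j hj σ' ⟨hA', hx, -⟩
    simp [arr, hx, hA'.a 8 (by simp)]
    omega
  · rintro v hv j hj σ' hy ⟨hA', hx, hJ, hs⟩
    simp only [zero_add] at hy
    obtain ⟨x, hxe⟩ : ∃ x, σ.a 9 v j = x := ⟨_, rfl⟩
    obtain ⟨hxm, p, hp, hp', hfp⟩ := (hA v hv x).1 ⟨j, hj, hxe⟩
    have ha9 := hA'.a 9 (by simp)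
    have hcm := hF.card_lt
    have hlM := hF.leaves_lt hxm _ (hJ.mem x hxm)
    have hcv := hcnt v hv
    have hsums : ∑ u ∈ Finset.range v, σ.a 8 0 u + σ.a 8 0 v ≤
        ∑ k ∈ Finset.range m, (hi k + 1 - lo k) := by
      rw [← hsum, ← Finset.sum_range_succ]
      exact Finset.sum_le_sum_of_subset (Finset.range_subset_range.2 (by omega))
    have hb' := hA'.v 3 (by simp)
    have hR' : LcaReady τ S base σ'.a := hR.congr fun r hr => hA'.a r (by simp; omega)
    have hRs := hR.size
    have hpS := hF.hi_lt x hxm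
    simp only [joinBody, wp]
    simp [arr, hx, hy, ha9, hxe]
    refine ⟨by omega, by omega, by omega, by omega, by omega, ?_⟩
    refine wp_lcaProg hW (by simpa using hR') hlM hv (by simp) (by simp) (by simpa [hb'] using hb)
      fun σ₁ ha₁ hz₁ hl₁ hg₁ => ?_
    rw [Store.set_a, Store.set_a, Store.set_a] at ha₁
    have e3 : σ₁.v 3 = base := by rw [hl₁ 3 (by norm_num)]; simp [hb', hb]
    have e4 : σ₁.v 4 = v := by rw [hl₁ 4 (by norm_num)]; simp [hx]
    have e5 : σ₁.v 5 = j := by rw [hl₁ 5 (by norm_num)]; simp [hy]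
    have e6 : σ₁.v 6 = x := by rw [hl₁ 6 (by norm_num)]; simp
    have hAA : Store.Agree [10, 11, 12, 13]
        [4, 5, 6, 7, 8, 10, 11, 12, 13, 14, 15, 16, 17, 18, 19] σ σ₁ := by
      refine ⟨fun r hr => by rw [ha₁]; exact hA'.a r hr, fun i hi => ?_⟩
      rw [← hA'.v i hi]
      simp at hi
      by_cases h12 : i < 12
      · rw [hl₁ i h12]; simp [hi]
      · rw [hg₁ i (by omega)]; simp [hi]
    have hfield : σ₁.a 0 0 (base + 4 * v + 4) = p := by
      rw [hAA.a 0 (by simp), ← hfp, hann x hxm p hp hp']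
    simp [field, e3, e4, hfield]
    refine ⟨by omega, by omega, ?_⟩
    refine wp_pushProg (τ := τ) (v := τ.lca (σ'.a 13 0 x) v) (x := x) (p := p) hW (by simp [hz₁])
      (by norm_num) (by simp [e6]) (by simp) ?_ (by omega) (by simp [ha₁]; omega) fun σ₂ hA₂ hB₂ hs₂ => ?_
    · exact PreorderTree.lca_lt hlM hv
    refine wp_pushProg (τ := τ) (v := v) (x := x) (p := p) hW (by simp [hA₂.v 4, e4])
      (by norm_num) (by simp [hA₂.v 6, e6]) (by simp [hA₂.v 7]) hv (by omega)
      (by rw [hs₂]; simp [ha₁]; omega) fun σ₃ hA₃ hB₃ hs₃ => ?_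
    have f4 : σ₃.v 4 = v := by rw [hA₃.v 4 (by simp), hA₂.v 4 (by simp)]; simp [e4]
    have f5 : σ₃.v 5 = j := by rw [hA₃.v 5 (by simp), hA₂.v 5 (by simp)]; simp [e5]
    have f6 : σ₃.v 6 = x := by rw [hA₃.v 6 (by simp), hA₂.v 6 (by simp)]; simp [e6]
    have f13 : σ₃.a 13 = σ'.a 13 := by
      rw [hA₃.a 13 (by simp), hA₂.a 13 (by simp), Store.set_a, ha₁]
    have hA₁₂ := (hAA.set (x := 7) (by simp) p).trans hA₂ (List.Subset.refl _) (by simp)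
      (List.Subset.refl _) (by simp)
    have hA₁₃ := hA₁₂.trans hA₃ (List.Subset.refl _) (by simp) (List.Subset.refl _) (by simp)
    simp [f4, f5, f6]
    refine ⟨by omega, by omega, by omega, (hA₁₃.put (by simp) _ _ _).set (by simp) _, ?_, ?_⟩
    · refine (hJ.step hF hv hxm hp hp' hfp (fun k => ?_) fun u y => ?_).mono ?_
      · simp [f13]
      · refine Iff.trans (b := Has (σ₃.a 10 0) (entry σ₃.a) u y) (by simp [Has, entry]) ?_
        rw [hB₃, hB₂, Store.set_a, ha₁, or_assoc]
      · rintro k ⟨j', h, rfl⟩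
        rcases h.eq_or_lt with rfl | h
        · exact .inr hxe
        · exact .inl ⟨j', h, rfl⟩
    · rw [hs₃, hs₂, Store.set_a, ha₁, hs]
      ring
  · rintro v hv σ' ⟨hA', hx, hJ, hs⟩
    refine ⟨hx, hA'.set (by simp) _, ⟨hJ.mem, fun k hk => (hJ.le k hk).trans (by omega), ?_, hJ.sound,
      hJ.complete⟩, ?_⟩
    · rintro k hk y hy (h | h)
      · by_cases e : y = v
        · rcases hy with rfl | ⟨i, h₁, h₂, h₃⟩
          · exact Nat.zero_le _
          · exact hJ.max k hk y (.inr ⟨i, h₁, h₂, h₃⟩)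
              (.inr ⟨e, (hA v hv k).2 ⟨hk, i, h₁, h₂, h₃.trans e⟩⟩)
        · exact hJ.max k hk y hy (.inl (by omega))
      · exact h.2.elim
    · rw [Finset.sum_range_succ]
      exact hs
  · rintro σ' ⟨hA', hJ, hs⟩
    refine ⟨hA', hJ.sound, ?_, hs.trans (by rw [hsum])⟩
    rintro k hk z ⟨x, hx, y, hy, rfl⟩
    have hL := hF.leaves_lt hk
    exact hJ.complete k hk x hx y hy (hJ.max k hk x hx (.inl (hL x hx)))
      (hJ.max k hk y hy (.inl (hL y hy)))

end SuffixTree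

namespace SuffixTree

open WordRAM WordRAM.Prog WordRAM.Expr

variable {W S : ℕ} {τ : PreorderTree} {base m : ℕ} {lo hi f : ℕ → ℕ}

/-! ### Writing the trees -/

/-- Appends the node given by the variable `4` to the tree of the interval given by the current
element of its bucket, unless it is there already. -/
def emitBody : Prog :=
  .seq (.seq (assign 6 (get 11 (var 4) (var 5)))
    (assign 10 (arr 14 (var 6))))
  (.ite .eq (var 10) (var 4) skip
  (.seq (assign 11 (var 4))
  (.seq lcaProg
  (.seq (assign 7 (get 16 (var 6) (const 0)))
  (.seq (assign 8 (const 4 * var 7))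
  (.seq (write 16 (var 6) (var 8 + const 1) (get 15 (var 6) (var 12)))
  (.seq (write 16 (var 6) (var 8 + const 2) (field (var 4) 2))
  (.seq (write 16 (var 6) (var 8 + const 3) (get 12 (var 4) (var 5)))
  (.seq (write 16 (var 6) (var 8 + const 4) (field (var 4) 4))
  (.seq (write 16 (var 6) (const 0) (var 7 + const 1))
  (.seq (write 15 (var 6) (var 4) (var 7))
  (write 14 (const 0) (var 6) (var 4)))))))))))))

def emitProg : Prog :=
  .seq (assign 4 (const 0))
  (upTo 4 (var 2) (.seq (assign 5 (const 0)) (upTo 5 (arr 10 (var 4)) emitBody)))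

open Classical in
/-- The record of `u` in the tree of the nodes `T`, for the interval `[l .. r]`; `g` gives the fields
of the records of the given tree. -/
structure IsRecord (τ : PreorderTree) (T : ℕ → Prop) (l r : ℕ) (f : ℕ → ℕ) (g : ℕ → ℕ → ℕ)
    (row : ℕ → ℕ) (u : ℕ) : Prop where
  par_zero : u = 0 → row (4 * Nat.count T u + 1) = 0
  par : 0 < u → ∃ p, T p ∧ p < u ∧ (∀ y, T y → y < u → y ≤ p) ∧
    row (4 * Nat.count T u + 1) = Nat.count T (τ.lca p u)
  length : row (4 * Nat.count T u + 2) = g u 2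
  le_pos : l ≤ row (4 * Nat.count T u + 3)
  pos_le : row (4 * Nat.count T u + 3) ≤ r
  anc : τ.Anc u (f (row (4 * Nat.count T u + 3)))
  ann : row (4 * Nat.count T u + 4) = g u 4

open Classical in
theorem IsRecord.congr {T : ℕ → Prop} {l r : ℕ} {g : ℕ → ℕ → ℕ} {row row' : ℕ → ℕ} {u : ℕ}
    (h : IsRecord τ T l r f g row u)
    (hr : ∀ j, 1 ≤ j → j ≤ 4 → row' (4 * Nat.count T u + j) = row (4 * Nat.count T u + j)) :
    IsRecord τ T l r f g row' u where
  par_zero hu := by rw [hr 1 (by norm_num) (by norm_num), h.par_zero hu]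
  par hu := by rw [hr 1 (by norm_num) (by norm_num)]; exact h.par hu
  length := by rw [hr 2 (by norm_num) (by norm_num), h.length]
  le_pos := by rw [hr 3 (by norm_num) (by norm_num)]; exact h.le_pos
  pos_le := by rw [hr 3 (by norm_num) (by norm_num)]; exact h.pos_le
  anc := by rw [hr 3 (by norm_num) (by norm_num)]; exact h.anc
  ann := by rw [hr 4 (by norm_num) (by norm_num), h.ann]

open Classical in
/-- The trees of the sets `T k` are complete up to the nodes in the array `14`, which precede `v` or
satisfy `D`. -/
structure Emitted (τ : PreorderTree) (T : ℕ → ℕ → Prop) (m : ℕ) (lo hi f : ℕ → ℕ) (g : ℕ → ℕ → ℕ)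
    (v : ℕ) (D : ℕ → Prop) (a : ℕ → ℕ → ℕ → ℕ) : Prop where
  mem : ∀ k < m, T k (a 14 0 k)
  le : ∀ k < m, a 14 0 k ≤ v
  max : ∀ k < m, ∀ y, T k y → y < v ∨ (y = v ∧ D k) → y ≤ a 14 0 k
  count : ∀ k < m, a 16 k 0 = Nat.count (T k) (a 14 0 k + 1)
  index : ∀ k < m, ∀ u, T k u → u ≤ a 14 0 k → a 15 k u = Nat.count (T k) u
  record : ∀ k < m, ∀ u, T k u → u ≤ a 14 0 k → IsRecord τ (T k) (lo k) (hi k) f g (a 16 k) u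

variable {T : ℕ → ℕ → Prop} {g : ℕ → ℕ → ℕ}

open Classical in
-- Since nothing lies strictly between the last appended node l and v, the current number of records
-- is the rank of v.
theorem count_eq_of_forall_le {P : ℕ → Prop} {l v : ℕ} (hlv : l < v)
    (h : ∀ y, P y → y < v → y ≤ l) : Nat.count P (l + 1) = Nat.count P v := by
  obtain ⟨d, rfl⟩ := Nat.exists_eq_add_of_le (show l + 1 ≤ v by omega)
  rw [Nat.count_add P (l + 1) d, Nat.left_eq_add, Nat.count_iff_forall_not]
  intro y hy hPy
  have := h _ hPy (by omega)
  omega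

namespace Emitted

theorem mono {v v' : ℕ} {D D' : ℕ → Prop} {a : ℕ → ℕ → ℕ → ℕ} (h : Emitted τ T m lo hi f g v D a)
    (hv : v ≤ v')
    (hD : ∀ k < m, ∀ y, T k y → y < v' ∨ (y = v' ∧ D' k) → y ≤ v ∧ (y = v → y = 0 ∨ D k)) :
    Emitted τ T m lo hi f g v' D' a where
  mem := h.mem
  le k hk := (h.le k hk).trans hv
  max k hk y hy hyv := by
    obtain ⟨h₁, h₂⟩ := hD k hk y hy hyv
    rcases h₁.eq_or_lt with e | e
    · rcases h₂ e with h₃ | h₃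
      · omega
      · exact h.max k hk y hy (.inr ⟨e, h₃⟩)
    · exact h.max k hk y hy (.inl e)
  count := h.count
  index := h.index
  record := h.record

open Classical in
-- The parent, the lowest common ancestor of v and the last node, belongs to the tree and is at most
-- the last node, so its record exists and its entry in array `15` has been written. This array
-- needs no initialization for that reason.
theorem step {v x p : ℕ} {D : ℕ → Prop} {a a' : ℕ → ℕ → ℕ → ℕ} (h : Emitted τ T m lo hi f g v D a)
    (hlt : ∀ u, T x u → u < τ.size) (hlca : ∀ u u', T x u → T x u' → T x (τ.lca u u'))
    (hx : x < m) (hv : T x v) (hne : a 14 0 x ≠ v) (hp : lo x ≤ p) (hp' : p ≤ hi x)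
    (ha : τ.Anc v (f p)) (h14 : ∀ k, a' 14 0 k = if k = x then v else a 14 0 k)
    (h15 : ∀ k u, a' 15 k u = if k = x ∧ u = v then a 16 x 0 else a 15 k u)
    (h16 : ∀ k j, a' 16 k j = if k = x ∧ j = 0 then a 16 x 0 + 1 else
      if k = x ∧ j = 4 * a 16 x 0 + 4 then g v 4 else
      if k = x ∧ j = 4 * a 16 x 0 + 3 then p else
      if k = x ∧ j = 4 * a 16 x 0 + 2 then g v 2 else
      if k = x ∧ j = 4 * a 16 x 0 + 1 then a 15 x (τ.lca (a 14 0 x) v) else a 16 k j) :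
    Emitted τ T m lo hi f g v (fun k => D k ∨ k = x) a' := by
  have hl : a 14 0 x < v := lt_of_le_of_ne (h.le x hx) hne
  have hmax : ∀ y, T x y → y < v → y ≤ a 14 0 x := fun y hy hyv => h.max x hx y hy (.inl hyv)
  have hc : a 16 x 0 = Nat.count (T x) v := by
    rw [h.count x hx, count_eq_of_forall_le hl hmax]
  have hlca' := PreorderTree.lca_anc_left (hlt _ (h.mem x hx)) (hlt _ hv)
  have h15' := h.index x hx _ (hlca _ _ (h.mem x hx) hv) hlca'.1
  rw [hc] at h15 h16
  rw [h15'] at h16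
  have hcount : ∀ u, T x u → u < v → Nat.count (T x) u < Nat.count (T x) v :=
    fun u hu huv => Nat.count_strict_mono hu huv
  have hold : ∀ k < m, k ≠ x → a' 14 0 k = a 14 0 k ∧ a' 15 k = a 15 k ∧ a' 16 k = a 16 k := by
    intro k hk e
    refine ⟨by rw [h14, if_neg e], ?_, ?_⟩
    · funext u
      simp [h15, e]
    · funext u
      simp [h16, e]
  have hnew : a' 14 0 x = v := by rw [h14, if_pos rfl]
  refine ⟨?_, ?_, ?_, ?_, ?_, ?_⟩ <;> intro k hk <;> by_cases e : k = x
  · rw [e, hnew]; exact hv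
  · rw [(hold k hk e).1]; exact h.mem k hk
  · rw [e, hnew]
  · rw [(hold k hk e).1]; exact h.le k hk
  · rw [e, hnew]; omega
  · rw [(hold k hk e).1]
    exact fun y hy hyv => h.max k hk y hy (by tauto)
  · rw [e, hnew, Nat.count_succ, if_pos hv, h16, if_pos ⟨rfl, rfl⟩]
  · rw [(hold k hk e).1, (hold k hk e).2.2]; exact h.count k hk
  · subst e
    rw [hnew]
    intro u hu huv
    rw [h15]
    split_ifs with e
    · rw [e.2]
    · exact h.index k hk u hu (hmax u hu (lt_of_le_of_ne huv fun e' => e ⟨rfl, e'⟩))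
  · rw [(hold k hk e).1, (hold k hk e).2.1]; exact h.index k hk
  · subst e
    rw [hnew]
    intro u hu huv
    rcases huv.eq_or_lt with rfl | huv
    · have e1 : a' 16 k (4 * Nat.count (T k) u + 1) = Nat.count (T k) (τ.lca (a 14 0 k) u) := by
        simp [h16]
      have e2 : a' 16 k (4 * Nat.count (T k) u + 2) = g u 2 := by simp [h16]
      have e3 : a' 16 k (4 * Nat.count (T k) u + 3) = p := by simp [h16]
      have e4 : a' 16 k (4 * Nat.count (T k) u + 4) = g u 4 := by simp [h16]
      refine ⟨fun h0 => by omega, fun _ => ⟨_, h.mem k hk, hl, hmax, e1⟩, e2, ?_, ?_, ?_, e4⟩ <;>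
        rw [e3] <;> assumption
    · refine (h.record k hk u hu (hmax u hu huv)).congr fun j hj hj' => ?_
      have := hcount u hu huv
      rw [h16, if_neg (by omega), if_neg (by omega), if_neg (by omega), if_neg (by omega),
        if_neg (by omega)]
  · rw [(hold k hk e).1, (hold k hk e).2.2]; exact h.record k hk

end Emitted

open Classical in
-- The sets `T k` are only required to contain the root and to be closed under lowest common
-- ancestors. The root's record was written beforehand, which is why its length and annotation in
-- the given tree must be 0.
theorem tri_emitProg (hW : 32 * (S * S) ≤ W) {σ : Store} (hF : Family τ S m lo hi f)
    (hR : LcaReady τ S base σ.a) (hM : σ.v 2 = τ.size) (hb : σ.v 3 = base)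
    (hst : ∀ k < m, Rooted S lo σ.a k) (h0 : ∀ k < m, T k 0)
    (hlt : ∀ k < m, ∀ u, T k u → u < τ.size)
    (hlca : ∀ k < m, ∀ u u', T k u → T k u' → T k (τ.lca u u'))
    (hroot : σ.a 0 0 (base + 2) = 0) (hroot' : σ.a 0 0 (base + 4) = 0)
    (hsound : ∀ u k p, Has (σ.a 10 0) (entry σ.a) u (k, p) → u < τ.size → k < m ∧ lo k ≤ p ∧
      p ≤ hi k ∧ T k u ∧ τ.Anc u (f p))
    (hcomplete : ∀ k < m, ∀ z, T k z → z = 0 ∨ ∃ p, Has (σ.a 10 0) (entry σ.a) z (k, p))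
    (hsum : ∑ v ∈ Finset.range τ.size, σ.a 10 0 v = 2 * ∑ k ∈ Finset.range m, (hi k + 1 - lo k)) :
    Tri W S emitProg σ
      (emitProg.cost * ((∑ v ∈ Finset.range τ.size, (σ.a 10 0 v + 1)) + 1)) fun σ' =>
      σ'.a 17 = σ.a 17 ∧ ∀ k < m, σ'.a 16 k 0 = Nat.count (T k) τ.size ∧
        ∀ u, T k u → IsRecord τ (T k) (lo k) (hi k) f (fun u j => σ.a 0 0 (base + 4 * u + j))
          (σ'.a 16 k) u := by
  have hS := le_of_bound hW
  have hc := hF.size_lt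
  have htot := hF.total_lt
  have hcnt : ∀ v < τ.size, σ.a 10 0 v < S := fun v hv => by
    have := le_sum_range (cnt := σ.a 10 0) hv
    omega
  set g : ℕ → ℕ → ℕ := fun u j => σ.a 0 0 (base + 4 * u + j) with hg
  refine tri_nested hW τ.size (fun _ => 0) (σ.a 10 0)
    (fun v σ' => Store.Agree [14, 15, 16]
        [4, 5, 6, 7, 8, 10, 11, 12, 13, 14, 15, 16, 17, 18, 19] σ σ' ∧
      Emitted τ T m lo hi f g v (fun _ => False) σ'.a)
    (fun v j σ' => Store.Agree [14, 15, 16]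
        [4, 5, 6, 7, 8, 10, 11, 12, 13, 14, 15, 16, 17, 18, 19] σ σ' ∧
      σ'.v 4 = v ∧ Emitted τ T m lo hi f g v (fun k => ∃ j' < j, σ.a 11 v j' = k) σ'.a)
    (by omega) ?_ ?_ ?_ ?_ ?_ ?_ ?_ ?_
  · intro v hv
    have := hcnt v hv
    omega
  · simp [wp]
    refine ⟨by omega, (Store.Agree.refl _ _ _).set (by simp) _, ⟨?_, ?_, ?_, ?_, ?_, ?_⟩⟩ <;>
      intro k hk <;> obtain ⟨g₂, g₃, g₄, g₅, g₆, g₇, g₈, -⟩ := hst k hk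
    · rw [g₂]; exact h0 k hk
    · rw [g₂]
    · rintro y hy (h | h)
      · omega
      · exact h.2.elim
    · rw [g₂, g₄, Nat.count_succ, if_pos (h0 k hk), Nat.count_zero]
    · rw [g₂]
      intro u hu hu'
      obtain rfl := Nat.le_zero.1 hu'
      rw [g₃, Nat.count_zero]
    · rw [g₂]
      intro u hu hu'
      obtain rfl := Nat.le_zero.1 hu'
      have hlh := hF.lo_le k hk
      constructor <;> simp only [Nat.count_zero, mul_zero, zero_add]
      · exact fun _ => g₅
      · omega
      · rw [g₆, hg]
        exact hroot.symm
      · exact g₇.ge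
      · rw [g₇]; exact hlh
      · rw [g₇]
        exact PreorderTree.anc_zero (hF.leaf_lt k hk _ le_rfl hlh)
      · rw [g₈, hg]
        exact hroot'.symm
  · rintro v hv σ' ⟨hA', -⟩
    simp [hA'.v 2 (by simp), hM]
  · rintro v hv σ' hx ⟨hA', hJ⟩
    simp [wp, hx]
    refine ⟨by omega, hA'.set (by simp) _, hJ⟩
  · rintro v hv j hj σ' ⟨hA', hx, -⟩
    simp [arr, hx, hA'.a 10 (by simp)]
    omega
  · rintro v hv j hj σ' hy ⟨hA', hx, hJ⟩
    simp only [zero_add] at hy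
    obtain ⟨⟨x, p⟩, hxp⟩ : ∃ y, entry σ.a v j = y := ⟨_, rfl⟩
    obtain ⟨hxm, hp, hp', hvT, hanc⟩ := hsound v x p ⟨j, hj, hxp⟩ hv
    obtain ⟨hxe, hpe⟩ := Prod.mk.inj hxp
    have ha11 := hA'.a 11 (by simp)
    have ha12 := hA'.a 12 (by simp)
    have hcm := hF.card_lt
    have hlM := hlt x hxm _ (hJ.mem x hxm)
    have hcv := hcnt v hv
    have hb' := hA'.v 3 (by simp)
    have hR' : LcaReady τ S base σ'.a := hR.congr fun r hr => hA'.a r (by simp; omega)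
    have hRs := hR.size
    have hpS := hF.hi_lt x hxm
    have hD : ∀ k, (∃ j' ≤ j, σ.a 11 v j' = k) → (∃ j' < j, σ.a 11 v j' = k) ∨ k = x := by
      rintro k ⟨j', h, rfl⟩
      rcases h.eq_or_lt with rfl | h
      · exact .inr hxe
      · exact .inl ⟨j', h, rfl⟩
    simp only [emitBody, wp]
    simp [arr, hx, hy, ha11, hxe, Cmp.Holds]
    refine ⟨by omega, by omega, by omega, by omega, fun he => ?_, fun hne => ?_⟩
    -- All elements for the node v are in one bucket, so a repetition shows up as v being the last
    -- appended node of its tree. This also skips the root.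
    · refine ⟨((hA'.set (by simp) _).set (by simp) _).set (by simp) _, hJ.mem, hJ.le, ?_,
        hJ.count, hJ.index, hJ.record⟩
      rintro k hk y hy (h | ⟨rfl, h⟩)
      · exact hJ.max k hk y hy (.inl h)
      · rcases hD k h with h | rfl
        · exact hJ.max k hk y hy (.inr ⟨rfl, h⟩)
        · exact he.ge

    refine ⟨by omega, ?_⟩
    refine wp_lcaProg hW (by simpa using hR') hlM hv (by simp) (by simp) (by simpa [hb'] using hb)
      fun σ₁ ha₁ hz₁ hl₁ hg₁ => ?_
    rw [Store.set_a, Store.set_a, Store.set_a] at ha₁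
    have e3 : σ₁.v 3 = base := by rw [hl₁ 3 (by norm_num)]; simp [hb', hb]
    have e4 : σ₁.v 4 = v := by rw [hl₁ 4 (by norm_num)]; simp [hx]
    have e5 : σ₁.v 5 = j := by rw [hl₁ 5 (by norm_num)]; simp [hy]
    have e6 : σ₁.v 6 = x := by rw [hl₁ 6 (by norm_num)]; simp
    have hAA : Store.Agree [14, 15, 16]
        [4, 5, 6, 7, 8, 10, 11, 12, 13, 14, 15, 16, 17, 18, 19] σ σ₁ := by
      refine ⟨fun r hr => by rw [ha₁]; exact hA'.a r hr, fun i hi => ?_⟩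
      rw [← hA'.v i hi]
      simp at hi
      by_cases h12 : i < 12
      · rw [hl₁ i h12]; simp [hi]
      · rw [hg₁ i (by omega)]; simp [hi]
    have hzM := PreorderTree.lca_lt hlM hv
    have hcl : σ'.a 16 x 0 ≤ τ.size := by
      rw [hJ.count x hxm]
      exact (Nat.count_le _).trans (by omega)
    have ha0 := hA'.a 0 (by simp)
    simp [field, e3, e4, e5, e6, hz₁, ha₁, ha12, show σ.a 12 v j = p from hpe, ha0]
    constructorm* _ ∧ _ <;> try omega
    · exact ((((((((((hAA.set (by simp) _).set (by simp) _).put (by simp) _ _ _).put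
        (by simp) _ _ _).put (by simp) _ _ _).put (by simp) _ _ _).put
        (by simp) _ _ _).put (by simp) _ _ _).put (by simp) _ _ _).set (by simp) _)
    · refine (hJ.step (hlt x hxm) (hlca x hxm) hxm hvT hne hp hp' hanc (fun k => ?_) (fun k u => ?_)
        fun k j => ?_).mono le_rfl ?_
      · simp [ha₁]
      · simp [ha₁]
      · simp [ha₁, hg]
      · rintro k hk y hy (h | ⟨h, j', h', hj'⟩)
        · exact ⟨h.le, fun e => absurd e h.ne⟩
        · exact ⟨h.le, fun _ => .inr (hD k ⟨j', h', hj'⟩)⟩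
  · rintro v hv σ' ⟨hA', hx, hJ⟩
    refine ⟨hx, hA'.set (by simp) _, hJ.mono (by omega) ?_⟩
    rintro k hk y hy (h | h)
    · refine ⟨by omega, ?_⟩
      rintro rfl
      refine (hcomplete k hk y hy).imp id ?_
      rintro ⟨p, j, hj, hp⟩
      exact ⟨j, hj, (Prod.mk.inj hp).1⟩
    · exact h.2.elim
  · rintro σ' ⟨hA', hJ⟩
    refine ⟨hA'.a 17 (by simp), fun k hk => ?_⟩
    have hmax : ∀ y, T k y → y ≤ σ'.a 14 0 k :=
      fun y hy => hJ.max k hk y hy (.inl (hlt k hk y hy))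
    exact ⟨(hJ.count k hk).trans (count_eq_of_forall_le (hlt k hk _ (hJ.mem k hk)) fun y hy _ => hmax y hy),
      fun u hu => hJ.record k hk u hu (hmax u hu)⟩

end SuffixTree

namespace SuffixTree

open WordRAM WordRAM.Prog WordRAM.Expr

/-! ### The algorithm -/

/-- Builds the trees, if the variables `1`, `2` and `3` are set. -/
def treesProg : Prog :=
  .seq prepareProg (.seq familyProg (.seq joinProg (.seq emitProg
    (assign 0 (const 17 * size * size)))))

open Classical in
-- With L the total length, the four phases are linear in 2M, L + m + 1, L + M + 1 and 2L + M + 1,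
-- where M is the size of the tree.
theorem tri_treesProg {W S : ℕ} (hW : 32 * (S * S) ≤ W) {σ : Store} {τ : PreorderTree}
    {base m : ℕ} {lo hi f ann : ℕ → ℕ} (hF : Family τ S m lo hi f) (hm : σ.v 1 = m)
    (hM : σ.v 2 = τ.size) (hb : σ.v 3 = base) (hs : base + 4 * τ.size + 20 < S)
    (hlo : ∀ k < m, σ.a 0 0 (2 * k + 3) = lo k) (hhi : ∀ k < m, σ.a 0 0 (2 * k + 4) = hi k)
    (hpos : ∀ k < m, 0 < lo k) (hpar : ∀ v < τ.size, σ.a 0 0 (base + 4 * v + 1) = τ.par v)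
    (hann : ∀ v < τ.size, σ.a 0 0 (base + 4 * v + 4) = ann v) (hannS : ∀ v < τ.size, ann v < S)
    (hinj : ∀ u < τ.size, ∀ v < τ.size, ann u = ann v → ann u ≠ 0 → u = v)
    (hf : ∀ k < m, ∀ i, lo k ≤ i → i ≤ hi k → ann (f i) = i) (h0 : ann 0 = 0)
    (hroot : σ.a 0 0 (base + 2) = 0) :
    Tri W S treesProg σ
      (treesProg.cost * (2 * (τ.size + m + ∑ k ∈ Finset.range m, (hi k + 1 - lo k) + 1))) fun σ' =>
      σ'.v 0 = address S 17 0 0 ∧ ∀ k < m, σ'.a 17 0 k = address S 16 k 0 ∧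
        σ'.a 16 k 0 = Nat.count (· ∈ τ.closure (Family.leaves lo hi f k)) τ.size ∧
        ∀ u ∈ τ.closure (Family.leaves lo hi f k),
          IsRecord τ (· ∈ τ.closure (Family.leaves lo hi f k)) (lo k) (hi k) f
            (fun u j => σ.a 0 0 (base + 4 * u + j)) (σ'.a 16 k) u := by
  set L := ∑ k ∈ Finset.range m, (hi k + 1 - lo k) with hL
  have hM0 := τ.size_pos
  refine (Tri.seq ((tri_prepareProg hW hM hb hs hpar hann hannS hinj).mono le_rfl ?_)).mono
    (T := prepareProg.cost * (2 * τ.size) + (familyProg.cost * (L + m + 1) +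
      (joinProg.cost * (L + τ.size + 1) + (emitProg.cost * (2 * L + τ.size + 1) +
        (assign 0 (const 17 * size * size)).cost)))) ?_ fun _ => id
  swap
  · simp only [treesProg, Prog.cost]
    nlinarith
  rintro σ₁ ⟨hA₁, hR₁, h8, h10, h7⟩
  have a0 := hA₁.a 0 (by simp)
  refine Tri.seq ((tri_familyProg hW (lo := lo) (hi := hi) (f := f) hF ?_ ?_ ?_ ?_ h8).mono ?_ ?_)
  · rw [hA₁.v 1 (by simp), hm]
  · rwa [a0]
  · rwa [a0]
  · intro k hk i h₁ h₂
    have := h7 (f i) (hF.leaf_lt k hk i h₁ h₂)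
    rw [hf k hk i h₁ h₂] at this
    have := hpos k hk
    exact ‹i ≠ 0 → _› (by omega)
  · rw [Finset.sum_add_distrib]
    simp [hL]
  rintro σ₂ ⟨hA₂, hst, hhas, hsum⟩
  have a0₂ := (hA₂.a 0 (by simp)).trans a0
  have hR₂ : LcaReady τ S base σ₂.a := hR₁.congr fun r hr => hA₂.a r (by simp; omega)
  have e2 : σ₂.v 2 = τ.size := by rw [hA₂.v 2 (by simp), hA₁.v 2 (by simp), hM]
  have e3 : σ₂.v 3 = base := by rw [hA₂.v 3 (by simp), hA₁.v 3 (by simp), hb]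
  refine Tri.seq ((tri_joinProg hW hF hR₂ e2 e3 ?_ (fun k hk => (hst k hk).last) ?_ hhas hsum).mono ?_ ?_)
  · intro k hk i h₁ h₂
    rw [a0₂, hann _ (hF.leaf_lt k hk i h₁ h₂), hf k hk i h₁ h₂]
  · rwa [hA₂.a 10 (by simp)]
  · rw [Finset.sum_add_distrib, hsum]
    simp [hL]
  rintro σ₃ ⟨hA₃, hsound, hcomplete, hsum₃⟩
  have a0₃ := (hA₃.a 0 (by simp)).trans a0₂
  have hR₃ : LcaReady τ S base σ₃.a := hR₂.congr fun r hr => hA₃.a r (by simp; omega)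
  have hlt := fun k (hk : k < m) => hF.leaves_lt hk
  refine Tri.seq ((tri_emitProg (T := fun k => (· ∈ τ.closure (Family.leaves lo hi f k))) hW hF hR₃
    ?_ ?_ ?_ ?_ ?_ ?_ ?_ ?_ hsound hcomplete hsum₃).mono ?_ ?_)
  · rw [hA₃.v 2 (by simp), e2]
  · rw [hA₃.v 3 (by simp), e3]
  · exact fun k hk => (hst k hk).toRooted.congr fun r hr => hA₃.a r (by simp; omega)
  · exact fun k hk => PreorderTree.subset_closure (hlt k hk) (.inl rfl)
  · exact fun k hk u hu => PreorderTree.closure_lt (hlt k hk) hu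
  · exact fun k hk u u' hu hu' => PreorderTree.lca_mem_closure (hlt k hk) hu hu'
  · rwa [a0₃]
  · rw [a0₃]
    exact (hann 0 hM0).trans h0
  · rw [Finset.sum_add_distrib, hsum₃]
    simp [hL]
  rintro σ₄ ⟨h17, hrec⟩
  have had := address_lt hW (r := 17) (a := 0) (b := 0) (S := S) (by norm_num) (by omega) (by omega)
  have had' := address_aux_lt hW (r := 17) (a := 0) (S := S) (by norm_num) (by omega)
  refine tri_of_wp hW (assign 0 (const 17 * size * size)) ?_
  simp only [address, add_zero] at had had'
  simp [wp, address]
  refine ⟨by omega, by omega, fun k hk => ⟨?_, by simpa [a0₃] using hrec k hk⟩⟩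
  rw [h17, hA₃.a 17 (by simp), (hst k hk).pointer]
  rfl

end SuffixTree

namespace SuffixTree

open WordRAM

/-- Loads the numbers of intervals and nodes, and computes the address of the given tree and a bound
of the coordinates. -/
def loadProg : Program :=
  .seq (.const 3 2) (.seq (.load 2 3) (.seq (.const 3 2) (.seq (.op .mul 5 2 3) (.seq (.const 3 3)
  (.seq (.op .add 6 5 3) (.seq (.load 4 6) (.seq (.const 3 1) (.seq (.load 7 3)
  (.seq (.op .mul 9 5 7) (.seq (.op .add 1 9 6) (.seq (.op .add 1 1 7) (.seq (.const 3 4)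
  (.seq (.op .mul 3 3 4) (.seq (.op .add 1 1 3) (.seq (.const 3 40) (.op .add 1 1 3))))))))))))))))

theorem exec_loadProg {W S : ℕ} (s : State)
    (hS : S = 2 * s.mem 2 * s.mem 1 + (2 * s.mem 2 + 3) + s.mem 1 +
      4 * s.mem (2 * s.mem 2 + 3) + 40) (hW : 32 * (S * S) ≤ W) :
    ∃ s', Exec W loadProg s 17 s' ∧ s'.mem = s.mem ∧ s'.reg 1 = S ∧ s'.reg 2 = s.mem 2 ∧
      s'.reg 4 = s.mem (2 * s.mem 2 + 3) ∧ s'.reg 6 = 2 * s.mem 2 + 3 := by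
  have hSW := le_of_bound hW
  refine ⟨_, Exec.seq (.const _ _ _ ?_) (.seq (.load _ _ _) (.seq (.const _ _ _ ?_)
    (.seq (.op _ _ _ _ _ ?_) (.seq (.const _ _ _ ?_) (.seq (.op _ _ _ _ _ ?_) (.seq (.load _ _ _)
    (.seq (.const _ _ _ ?_) (.seq (.load _ _ _) (.seq (.op _ _ _ _ _ ?_) (.seq (.op _ _ _ _ _ ?_)
    (.seq (.op _ _ _ _ _ ?_) (.seq (.const _ _ _ ?_) (.seq (.op _ _ _ _ _ ?_)
    (.seq (.op _ _ _ _ _ ?_) (.seq (.const _ _ _ ?_) (.op _ _ _ _ _ ?_)))))))))))))))),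
    ?_, ?_, ?_, ?_, ?_⟩ <;>
  (try simp [Op.eval, mul_comm (s.mem 2) 2]) <;> omega

/-- Nothing is known about the initial contents of most cells, so the store is read off from the
state. -/
theorem models_ofState {S : ℕ} (s : State) (h : s.reg 1 = S) :
    s.Models S ⟨fun x => s.reg (2 * x), fun r a b => s.mem (address S r a b)⟩ :=
  ⟨h, fun _ => rfl, fun _ _ _ _ _ => rfl⟩

theorem Family.leaves_eq_seeds {α : Type*} [LinearOrder α] {w : List α} {γ I : Interval} {M : ℕ}
    {nd : ℕ → List (WithBot α)} {par lo hi f : ℕ → ℕ} (h : IsListing w γ M nd par)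
    (hI : I.IsWithin γ) (hf : ∀ i, γ.Contains i → f i < M ∧ nd (f i) = suffixWord w i) {k : ℕ}
    (hlo : lo k = I.lo) (hhi : hi k = I.hi) :
    Family.leaves lo hi f k = IsListing.seeds w I M nd := by
  ext v
  simp only [Family.leaves, IsListing.seeds, Set.mem_ofPred_eq, hlo, hhi]
  constructor
  · rintro (rfl | ⟨i, h₁, h₂, rfl⟩)
    · exact ⟨h.size_pos, .inl rfl⟩
    · have hi : I.Contains i := ⟨h₁, h₂⟩
      obtain ⟨h₃, h₄⟩ := hf i (hi.mono hI)
      exact ⟨h₃, .inr ⟨i, hi, h₄⟩⟩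
  · rintro ⟨hv, rfl | ⟨i, hi, e⟩⟩
    · exact .inl rfl
    · obtain ⟨h₃, h₄⟩ := hf i (hi.mono hI)
      exact .inr ⟨i, hi.1, hi.2, h.inj h₃ hv (h₄.trans e.symm)⟩

theorem totalLength_eq_sum (K : List Interval) (d : Interval) :
    totalLength K = ∑ k ∈ Finset.range K.length, (K.getD k d).length := by
  induction K with
  | nil => rfl
  | cons I K ih =>
    rw [List.length_cons, Finset.sum_range_succ']
    simp only [List.getD_cons_succ, List.getD_cons_zero, ← ih]
    simp [totalLength, add_comm]

/-- This is where the absence of repetitions matters: it makes the number of intervals, hence the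
word size, polynomial. -/
theorem length_le_mul_self {K : List Interval} {n : ℕ} (hK : K.Nodup)
    (h : ∀ I ∈ K, 1 ≤ I.lo ∧ I.lo ≤ n ∧ 1 ≤ I.hi ∧ I.hi ≤ n) : K.length ≤ n * n := by
  have hinj : Function.Injective fun I : Interval => (I.lo, I.hi) := by
    rintro ⟨a, b⟩ ⟨c, d⟩ e
    simpa using e
  rw [← List.length_map (f := fun I : Interval => (I.lo, I.hi)),
    ← List.toFinset_card_of_nodup (hK.map hinj)]
  refine (Finset.card_le_card (t := Finset.Icc 1 n ×ˢ Finset.Icc 1 n) fun x hx => ?_).trans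
    (by simp)
  obtain ⟨I, hI, rfl⟩ := List.mem_map.1 (List.mem_toFinset.1 hx)
  obtain ⟨h₁, h₂, h₃, h₄⟩ := h I hI
  simp [*]

/-- With N = n + 2 ≥ 3, the dominant term of S is cubic and 9 ≤ N ^ 2 absorbs the constants into S ≤
N ^ 5; the factor 32 is at most N ^ 4. -/
theorem size_bound {n m e M S : ℕ} (hn : 1 ≤ n) (hm : m ≤ n * n) (he : e ≤ n)
    (hM : M ≤ 2 * (n + 1)) (hS : S = 2 * m * e + (2 * m + 3) + e + 4 * M + 40) :
    32 * (S * S) ≤ (n + 2) ^ 14 := by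
  obtain ⟨N, hN⟩ : ∃ N, n + 2 = N := ⟨_, rfl⟩
  have hN3 : 3 ≤ N := by omega
  have h₁ : S ≤ N ^ 5 := by
    have h₂ : m * e ≤ N ^ 2 * N :=
      Nat.mul_le_mul (by nlinarith) (by omega)
    have h₃ : m ≤ N ^ 2 := by nlinarith
    have h₄ : 9 ≤ N ^ 2 := by nlinarith
    have h₅ : 3 * N ^ 2 ≤ N ^ 3 := by nlinarith
    have h₆ : 9 * N ^ 3 ≤ N ^ 5 := by
      calc 9 * N ^ 3 ≤ N ^ 2 * N ^ 3 := Nat.mul_le_mul_right _ h₄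
        _ = N ^ 5 := by ring
    have h₇ : 9 * N ≤ N ^ 3 := by
      calc 9 * N ≤ N ^ 2 * N := Nat.mul_le_mul_right _ h₄
        _ = N ^ 3 := by ring
    have h₈ : 2 * m * e = 2 * (m * e) := by ring
    have h₉ : N ^ 2 * N = N ^ 3 := by ring
    omega
  rw [hN]
  calc 32 * (S * S) ≤ N ^ 4 * (N ^ 5 * N ^ 5) := by
        refine Nat.mul_le_mul ?_ (Nat.mul_le_mul h₁ h₁)
        calc 32 ≤ 3 ^ 4 := by norm_num
          _ ≤ N ^ 4 := Nat.pow_le_pow_left hN3 4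
    _ = N ^ 14 := by ring

end SuffixTree

open SuffixTree WordRAM in
theorem mainTheorem9 :
    ∃ (P : WordRAM.Program) (c C : ℕ),
      ∀ (α : Type*) [LinearOrder α] (w : List α) (γ : SuffixTree.Interval)
        (K : List SuffixTree.Interval) (s : WordRAM.State),
        γ.IsWithin ⟨1, w.length⟩ →
        K.Nodup →
        (∀ I ∈ K, I.IsWithin γ) →
        SuffixTree.IsInput w γ K s →
        ∃ (t : ℕ) (s' : WordRAM.State),
          WordRAM.Exec ((w.length + 2) ^ c) P s t s' ∧
          t ≤ C * (γ.length + SuffixTree.totalLength K) ∧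
          SuffixTree.IsOutput w K s' := by
  classical
  refine ⟨.seq loadProg treesProg.compile, 14, 17 + treesProg.cost * 10, ?_⟩
  rintro α _ w γ K s hγ hnd hK ⟨-, hs1, hs2, hsK, hrep⟩
  obtain ⟨nd, hL, hlen, hann⟩ := hrep.exists_listing
  obtain ⟨M, hM⟩ : ∃ M, s.mem (2 * K.length + 3) = M := ⟨_, rfl⟩
  rw [hM] at hL hlen hann
  have hMγ := hL.size_le hγ
  obtain ⟨g₁, g₂, g₃⟩ := hγ
  simp only at g₁ g₃
  have hγlen : γ.length = γ.hi + 1 - γ.lo := rfl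
  have hm := length_le_mul_self (n := w.length) hnd fun I hI => by
    obtain ⟨h₁, h₂, h₃⟩ := hK I hI
    omega
  -- The summands bound, in this order, twice the total length, the start of the given tree, the
  -- positions, and the records with some slack. All are computable from the input in constant time.
  obtain ⟨S, hS⟩ : ∃ S, S = 2 * K.length * γ.hi + (2 * K.length + 3) + γ.hi + 4 * M + 40 := ⟨_, rfl⟩
  have hW := size_bound (by omega) hm g₃ (by omega) hS
  obtain ⟨s₁, hex, hmem, r₁, r₂, r₄, r₆⟩ := exec_loadProg s (by rw [hs2, hs1, hM, hS]) hW
  rw [hs2] at r₂ r₄ r₆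
  rw [hM] at r₄
  set J : ℕ → Interval := fun k => K.getD k ⟨1, 1⟩ with hJ
  have hJK : ∀ k < K.length, K[k]? = some (J k) := fun k hk => by simp [hJ, hk]
  have hJw : ∀ k < K.length, (J k).IsWithin γ := fun k hk => hK _ (List.mem_of_getElem? (hJK k hk))
  choose! f hf using fun i (hi : γ.Contains i) => hL.exists_leaf hi
  have hleaf : ∀ k < K.length, ∀ i, (J k).lo ≤ i → i ≤ (J k).hi → f i < M ∧
      nd (f i) = suffixWord w i := fun k hk i h h' => hf i
    (Interval.Contains.mono (I := J k) ⟨h, h'⟩ (hJw k hk))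
  obtain ⟨ann, hannd⟩ : ∃ ann : ℕ → ℕ, ∀ v, s.mem (2 * K.length + 3 + 4 * v + 4) = ann v :=
    ⟨_, fun _ => rfl⟩
  simp only [hannd] at hann
  have hann0 : ∀ v < M, ann v ≠ 0 → IsLeaf w γ (nd v) (ann v) := by
    intro v hv h
    by_cases e : ∃ i, IsLeaf w γ (nd v) i
    · obtain ⟨i, hi⟩ := e
      rwa [(hann v hv).1 i hi]
    · exact (h ((hann v hv).2 e)).elim
  have htot := totalLength_eq_sum K ⟨1, 1⟩
  have hle : K.length ≤ totalLength K := by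
    rw [htot]
    refine (Finset.card_nsmul_le_sum (Finset.range K.length) _ 1 fun k hk => ?_).trans' (by simp)
    have := (hJw k (Finset.mem_range.1 hk)).2.1
    change 1 ≤ (J k).hi + 1 - (J k).lo
    omega
  -- Positions start at 1, so no interval is longer than the right end of γ.
  have htot' : 2 * totalLength K ≤ 2 * K.length * γ.hi := by
    rw [htot, mul_assoc]
    refine Nat.mul_le_mul_left _ ((Finset.sum_le_card_nsmul (Finset.range K.length) _ γ.hi
      fun k hk => ?_).trans (by simp))
    obtain ⟨h₁, h₂, h₃⟩ := hJw k (Finset.mem_range.1 hk)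
    change (J k).hi + 1 - (J k).lo ≤ γ.hi
    omega
  have hsum : ∑ k ∈ Finset.range K.length, ((J k).hi + 1 - (J k).lo) = totalLength K := htot.symm
  have hF : Family hL.tree S K.length (fun k => (J k).lo) (fun k => (J k).hi) f := by
    refine ⟨fun k hk => (hJw k hk).2.1, fun k hk i h h' => (hleaf k hk i h h').1, fun k hk => ?_, ?_,
      ?_, ?_⟩
    · have := (hJw k hk).2.2
      omega
    · omega
    · rw [hL.tree_size]
      omega
    · rw [hsum]
      omega
  -- Row 0 of array `0` is the beginning of the memory itself, so the input is read in place.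
  have hcell : ∀ i, s₁.mem (address S 0 0 i) = s.mem i := fun i => by rw [hmem]; simp [address]
  have hannS : ∀ v < M, ann v < S := by
    intro v hv
    by_cases h : ann v = 0
    · omega
    · have := (hann0 v hv h).1.2
      omega
  have hinj : ∀ u < M, ∀ v < M, ann u = ann v → ann u ≠ 0 → u = v := by
    intro u hu v hv e h
    exact hL.inj hu hv ((hann0 u hu h).2.trans (e ▸ (hann0 v hv (e ▸ h)).2.symm))
  have hannf : ∀ k < K.length, ∀ i, (J k).lo ≤ i → i ≤ (J k).hi → ann (f i) = i := by
    intro k hk i h h'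
    have := hleaf k hk i h h'
    exact (hann _ this.1).1 i ⟨Interval.Contains.mono (I := J k) ⟨h, h'⟩ (hJw k hk), this.2⟩
  have hann_root : ann 0 = 0 := by
    by_contra h
    have := (hann0 0 hL.size_pos h).2
    rw [hL.nd_zero] at this
    exact suffixWord_ne_nil w _ this.symm
  have hlen_root := hlen 0 hL.size_pos
  rw [hL.nd_zero] at hlen_root
  obtain ⟨t, s', σ', hex', ht, hmod, hout, htrees⟩ := tri_treesProg hW
    (base := 2 * K.length + 3) (ann := ann) hF
    (σ := ⟨fun x => s₁.reg (2 * x), fun r a b => s₁.mem (address S r a b)⟩)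
    r₂ r₄ r₆ (by rw [hL.tree_size]; omega)
    (fun k hk => (hcell _).trans (hsK k _ (hJK k hk)).1)
    (fun k hk => (hcell _).trans (hsK k _ (hJK k hk)).2)
    (fun k hk => g₁.trans (hJw k hk).1)
    (fun v hv => hcell _) (fun v hv => (hcell _).trans (hannd v)) hannS hinj hannf hann_root
    ((hcell _).trans hlen_root) s₁
    (models_ofState s₁ r₁)
  refine ⟨17 + t, s', hex.seq hex', ?_, fun k I hI => ?_⟩
  · rw [hL.tree_size, hsum] at ht
    -- The left side is at most 4|γ| + 4‖K‖ + 6, since M ≤ 2(|γ| + 1) and every interval has length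
    -- at least 1; the 6 is absorbed because |γ| ≥ 1.
    have h₁ : 2 * (M + K.length + totalLength K + 1) ≤ 10 * (γ.length + totalLength K) := by omega
    have h₂ := Nat.mul_le_mul_left treesProg.cost h₁
    have h₃ : (17 + treesProg.cost * 10) * (γ.length + totalLength K) =
      17 * (γ.length + totalLength K) + treesProg.cost * (10 * (γ.length + totalLength K)) := by ring
    omega
  · have hk : k < K.length := (List.getElem?_eq_some_iff.1 hI).1
    obtain rfl : J k = I := Option.some.inj ((hJK k hk).symm.trans hI)
    obtain ⟨hptr, hcount, hrec⟩ := htrees k hk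
    have hbase : s'.mem (s'.reg 0 + k) = address S 16 k 0 := by
      rw [show s'.reg 0 = address S 17 0 0 from (hmod.var 0).trans hout, ← hptr,
        ← hmod.cell 17 0 k (by omega) (by omega)]
      rfl
    rw [hbase]
    -- A row of an array is contiguous in memory, so row k of array `16` is literally the stored
    -- tree.
    have hrow : ∀ j < S, s'.mem (address S 16 k 0 + j) = σ'.a 16 k j := fun j hj => by
      rw [← hmod.cell 16 k j (by omega) hj]
      rfl
    rw [Family.leaves_eq_seeds hL (hJw k hk) hf rfl rfl] at hcount hrec
    have hsl := IsListing.lt_of_mem_seeds (w := w) (I := J k) (M := M) (nd := nd)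
    refine hL.represents ⟨g₁, g₂, g₃⟩ (hJw k hk) (ann := ann) hann rfl
      ((hrow 0 (by omega)).trans hcount) fun v hv => ?_
    have hvM : v < M := PreorderTree.closure_lt (τ := hL.tree) hsl hv
    obtain ⟨q₁, q₂, q₃, q₄, q₅, q₆, q₇⟩ := hrec v hv
    have hc : Nat.count (· ∈ hL.tree.closure (IsListing.seeds w (J k) M nd)) v ≤ v :=
      Nat.count_le _
    have hrow' : ∀ j ≤ 4, s'.mem (address S 16 k 0 +
        4 * Nat.count (· ∈ hL.tree.closure (IsListing.seeds w (J k) M nd)) v + j) =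
        σ'.a 16 k (4 * Nat.count (· ∈ hL.tree.closure (IsListing.seeds w (J k) M nd)) v + j) := by
      intro j hj
      rw [add_assoc, hrow _ (by omega)]
    rw [hrow' 1 (by norm_num), hrow' 2 (by norm_num), hrow' 3 (by norm_num), hrow' 4 le_rfl]
    have hpf := hleaf k hk _ q₄ q₅
    refine ⟨q₁, q₂, ?_, ⟨⟨q₄, q₅⟩, ?_⟩, ?_⟩
    · exact q₃.trans ((hcell _).trans (hlen v hvM))
    · rw [← hpf.2]
      exact (hL.anc_iff hvM hpf.1).1 q₆
    · exact q₇.trans ((hcell _).trans (hannd v))
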